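/- There exist a closed connected smooth 4-manifold $M$, a 2-dimensional $C^\infty$ foliation $\mathcal F$ of $M$ (of codimension 2) and a transverse invariant volume $\Omega$ of $\mathcal F$ such that $\Omega$ is ergodic, every leaf of $\mathcal F$ is Følner (in particular $\mathcal F$ is a Følner foliation), and $\mathcal F$ is non-amenable with respect to $\Omega$. Here $\mathcal F$ is given by a finite regular foliated atlas: $C^\infty$ charts $\phi_i:U_i\to P_i\times T_i$ onto products of open unit discs of $\mathbb R^2$ such that the $U_i$ cover $M$, each plaque (fibre of $U_i\to T_i$) of $U_i$ meets at most one plaque of $U_j$, and each closure $\overline{U_i}$ lies in the domain of a foliated chart of $\mathcal F$. Let $T=\coprod_i T_i$ be the associated total transversal, $\mathcal R$ the equivalence relation "lying in the same leaf" on $T$, and $\gamma_{ij}$ the holonomy diffeomorphism between open subsets of $T_i$ and $T_j$ sending $y$ to $z$ when the plaques of $y$ and $z$ intersect. * A transverse invariant volume is a $C^\infty$ nowhere vanishing differential 2-form $\Omega$ on $T$ with $\gamma_{ij}^*\Omega=\Omega$ for all $i,j$; it defines a measure $\nu=|\Omega|$ on $T$. It is ergodic if every $\mathcal R$-saturated Borel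 subset of $T$ is $\nu$-null or $\nu$-conull. * The leaf through $t\in T$ is Følner if, in the graph with vertex set $T$ whose edges join distinct points $s,s'$ with intersecting plaques, there are finite non-empty sets $A\subset\mathcal R[t]$ with $|\partial A|/|A|$ arbitrarily small, where $\partial A$ is the set of edges with exactly one end point in $A$. The foliation is Følner if $\nu$-almost every leaf is Følner. * $\mathcal F$ is amenable with respect to $\Omega$ if for $\nu$-almost every $y\in T$ there is a mean $m_y$ (a positive linear functional with $m_y(1)=1$) on the bounded functions on $\mathcal R[y]$ such that, for every bounded measurable function $f$ of two variables, $y\mapsto m_y(f(y,\cdot))$ is $\nu$-measurable, and such that for $\nu$-almost every $y$, $m_z=m_y$ for all $z\in\mathcal R[y]$. -/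

import Mathlib

open Set MeasureTheory
open scoped Manifold ContDiff Topology

/-! ### Discrete measured equivalence relations: ergodicity and amenability -/

section EquivalenceRelations

variable {X : Type*}

/-- `f` is bounded on `C`. -/
def BddFunOn (C : Set X) (f : X → ℝ) : Prop :=
  ∃ K : ℝ, ∀ z ∈ C, |f z| ≤ K

/-- `m` is a mean on `C`: a positive linear functional, taking the value `1` at the constant
function `1`, on the bounded functions on `C`. A function on `C` is represented by any of its
extensions to `X`; positivity on `C` makes the value depend on the restriction to `C` only. -/
structure IsMeanOn (C : Set X) (m : (X → ℝ) → ℝ) : Prop where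
  map_add : ∀ f g : X → ℝ, BddFunOn C f → BddFunOn C g → m (f + g) = m f + m g
  map_smul : ∀ (c : ℝ) (f : X → ℝ), BddFunOn C f → m (c • f) = c * m f
  nonneg : ∀ f : X → ℝ, BddFunOn C f → (∀ z ∈ C, 0 ≤ f z) → 0 ≤ m f
  map_one : m (fun _ => 1) = 1

/-- The class of `y` for the equivalence relation `R`. -/
def eqvClass (R : Setoid X) (y : X) : Set X :=
  {z | R y z}

variable [MeasurableSpace X]

/-- `R` is ergodic for `ν`: every saturated measurable set is null or conull. -/
def ErgodicRel (R : Setoid X) (ν : Measure X) : Prop :=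
  ∀ B : Set X, MeasurableSet B → (∀ y z, R y z → (y ∈ B ↔ z ∈ B)) → ν B = 0 ∨ ν Bᶜ = 0

/-- `R` is `ν`-amenable: for almost every `y` there is a mean `m y` on the class of `y`, in such a
way that `y ↦ m y` is measurable (applied to the slices of a bounded measurable function of two
variables, it gives a `ν`-measurable function) and invariant (`m y` and `m z` are the same mean if
`y` and `z` are equivalent). -/
def AmenableRel (R : Setoid X) (ν : Measure X) : Prop :=
  ∃ m : X → (X → ℝ) → ℝ,
    (∀ᵐ y ∂ν, IsMeanOn (eqvClass R y) (m y)) ∧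
    (∀ f : X × X → ℝ, Measurable f → (∃ K : ℝ, ∀ t, |f t| ≤ K) →
      AEMeasurable (fun y => m y (fun z => f (y, z))) ν) ∧
    (∀ᵐ y ∂ν, ∀ z, R y z → ∀ f : X → ℝ, BddFunOn (eqvClass R y) f → m y f = m z f)

end EquivalenceRelations

/-- The isoperimetric ratios of finite sets of vertices of the graph `G` contained in `C` are not
bounded away from `0`; the boundary of `A` is the set of edges with exactly one end point in `A`,
oriented from `A` to its complement. -/
def IsFolnerIn {V : Type*} (G : SimpleGraph V) (C : Set V) : Prop :=
  ∀ ε : ℝ, 0 < ε → ∃ A : Finset V, A.Nonempty ∧ (A : Set V) ⊆ C ∧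
    {e : V × V | e.1 ∈ A ∧ e.2 ∉ A ∧ G.Adj e.1 e.2}.Finite ∧
    ({e : V × V | e.1 ∈ A ∧ e.2 ∉ A ∧ G.Adj e.1 e.2}.ncard : ℝ) ≤ ε * A.card

/-! ### Smooth foliations -/

section Foliations

variable {m p q : ℕ} {M : Type*} [TopologicalSpace M]

/-- The local plaques of `φ` and `ψ`, i.e. the fibres of the second coordinates, agree near
every common point of the two domains. -/
def SameLocalPlaques
    (φ ψ : OpenPartialHomeomorph M (EuclideanSpace ℝ (Fin p) × EuclideanSpace ℝ (Fin q))) : Prop :=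
  ∀ x ∈ φ.source ∩ ψ.source, ∃ V ∈ 𝓝 x, ∀ y ∈ V, ∀ z ∈ V,
    ((φ y).2 = (φ z).2 ↔ (ψ y).2 = (ψ z).2)

variable [ChartedSpace (EuclideanSpace ℝ (Fin m)) M]

variable (m) in
/-- `φ` is a `C^∞` diffeomorphism from an open subset of `M` onto the product of the open unit
discs of `ℝ^p` and `ℝ^q`. -/
def IsSmoothProductChart
    (φ : OpenPartialHomeomorph M (EuclideanSpace ℝ (Fin p) × EuclideanSpace ℝ (Fin q))) : Prop :=
  φ.target = Metric.ball 0 1 ×ˢ Metric.ball 0 1 ∧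
  ContMDiffOn (𝓡 m) 𝓘(ℝ, EuclideanSpace ℝ (Fin p) × EuclideanSpace ℝ (Fin q)) ∞ φ φ.source ∧
  ContMDiffOn 𝓘(ℝ, EuclideanSpace ℝ (Fin p) × EuclideanSpace ℝ (Fin q)) (𝓡 m) ∞ φ.symm φ.target

variable (m p q M) in
/-- A `C^∞` foliation of dimension `p` and codimension `q` of the (compact) `m`-manifold `M`, given
by a finite regular foliated atlas. -/
structure SmoothFoliation where
  /-- the number of charts -/
  n : ℕ
  /-- the charts `U_i → P_i × T_i`; the plaques of `U_i` are the fibres of the second coordinate -/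
  chart : Fin n → OpenPartialHomeomorph M (EuclideanSpace ℝ (Fin p) × EuclideanSpace ℝ (Fin q))
  smooth_chart : ∀ i, IsSmoothProductChart m (chart i)
  cover : ∀ x, ∃ i, x ∈ (chart i).source
  /-- Each plaque of `U_i` meets at most one plaque of `U_j`; hence the changes of charts have the
  form `(x, y) ↦ (ψ x y, γ y)`. -/
  plaque_unique : ∀ i j, ∀ x ∈ (chart i).source ∩ (chart j).source,
    ∀ y ∈ (chart i).source ∩ (chart j).source,
      (chart i x).2 = (chart i y).2 → (chart j x).2 = (chart j y).2
  /-- The closure of `U_i` lies in the domain of a foliated chart, perhaps not in the atlas. -/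
  closure_subset : ∀ i,
    ∃ φ : OpenPartialHomeomorph M (EuclideanSpace ℝ (Fin p) × EuclideanSpace ℝ (Fin q)),
      IsSmoothProductChart m φ ∧ (∀ j, SameLocalPlaques φ (chart j)) ∧
        closure (chart i).source ⊆ φ.source

namespace SmoothFoliation

variable (F : SmoothFoliation m p q M)

/-- The total transversal `T = ∐ T_i`, where `T_i` is the open unit disc of `ℝ^q`. -/
abbrev Transversal : Type :=
  Fin F.n × Metric.ball (0 : EuclideanSpace ℝ (Fin q)) 1

/-- The plaque of `U_i` corresponding to the point `(i, y)` of `T`. -/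
def plaque (t : F.Transversal) : Set M :=
  {x | x ∈ (F.chart t.1).source ∧ (F.chart t.1 x).2 = t.2}

/-- Two points of `M` lie in the same leaf if they are joined by a chain of plaques in which
consecutive plaques intersect. -/
def leafRel : Setoid M :=
  Relation.EqvGen.setoid (fun x y => ∃ t : F.Transversal, x ∈ F.plaque t ∧ y ∈ F.plaque t)

/-- The embedding of `T_i` into `U_i` as `{0} × T_i`, for each `i`. -/
noncomputable def point (t : F.Transversal) : M :=
  (F.chart t.1).symm (0, (t.2 : EuclideanSpace ℝ (Fin q)))

/-- The equivalence relation induced by the foliation on `T`: to lie in the same leaf. -/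
noncomputable def transRel : Setoid F.Transversal :=
  F.leafRel.comap F.point

/-- The graph on `T` defined by the generators of the holonomy pseudogroup: the holonomy map from
`T_i` to `T_j` sends `y` to `z` exactly when the plaques of `y` and `z` intersect. -/
def holonomyGraph : SimpleGraph F.Transversal where
  Adj s t := s ≠ t ∧ (F.plaque s ∩ F.plaque t).Nonempty
  symm := ⟨fun _ _ h => ⟨h.1.symm, by rw [inter_comm]; exact h.2⟩⟩
  loopless := ⟨fun _ h => h.1 rfl⟩

/-- The leaf through the point `t` of `T` is Følner, i.e. the equivalence class of `t` is Følner as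
a graph. -/
def IsFolnerAt (t : F.Transversal) : Prop :=
  IsFolnerIn F.holonomyGraph (eqvClass F.transRel t)

/-- A transverse invariant volume: a smooth nowhere vanishing differential form
`density i • dy₁ ∧ ⋯ ∧ dy_q` of degree `q` on each `T_i`, such that the holonomy maps
`γ` from `T_i` to `T_j` pull the form on `T_j` back to the form on `T_i`. -/
structure InvariantVolume where
  /-- the coefficient of the form on `T_i` -/
  density : Fin F.n → EuclideanSpace ℝ (Fin q) → ℝ
  smooth : ∀ i, ContDiffOn ℝ ∞ (density i) (Metric.ball 0 1)
  ne_zero : ∀ i, ∀ y ∈ Metric.ball (0 : EuclideanSpace ℝ (Fin q)) 1, density i y ≠ 0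
  /-- Near `(F.chart i x).2`, the function differentiated here is the holonomy map from `T_i`
  to `T_j` at `x`. -/
  invariant : ∀ i j, ∀ x ∈ (F.chart i).source ∩ (F.chart j).source,
    density j (F.chart j x).2 *
      (fderiv ℝ (fun y => (F.chart j ((F.chart i).symm ((F.chart i x).1, y))).2)
        (F.chart i x).2).det = density i (F.chart i x).2

/-- The measure on `T` defined by a transverse invariant volume. -/
noncomputable def InvariantVolume.measure {F : SmoothFoliation m p q M} (Ω : F.InvariantVolume) :
    Measure F.Transversal :=
  ((Measure.count : Measure (Fin F.n)).prod
    (Measure.comap Subtype.val (volume : Measure (EuclideanSpace ℝ (Fin q))))).withDensity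
      (fun t => ENNReal.ofReal |Ω.density t.1 t.2|)

end SmoothFoliation

end Foliations

/-!
The foliation is the suspension of an action of a finitely generated group of area preserving
diffeomorphisms of the torus, with a closed surface of genus `3` as base; its leaves correspond to
the orbits of the group, and every property in the statement is a property of the action.

*The action.* The group is generated by the shears `h (x, y) = (x + φ y, y)`,
`v₁ (x, y) = (x, y + ψ x)` and `v₂ (x, y) = (x, y + √2 ψ x)`, where `φ` and `ψ` are smooth functions
on the circle. Modulo `1` one has `φ y = 3 y` for `|y| ≤ 0.27` and `ψ x = 3 x` for `|x| ≤ 0.27`, so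
that `h` and `v₁` coincide there with the matrices `A = [1, 3; 0, 1]` and `B = [1, 0; 3, 1]`. Moreover
`0 < |φ| < 1` except at `y = 0` and `y = 1/2`, and `ψ` vanishes at distance at least `0.33` from `0`.

*Non-amenability* (`not_amenableRel_holonomyRel`). The matrices `A` and `B` generate a free group,
acting on the torus in an essentially free way. Suppose that there is a measurable invariant family
of means on the orbits of the holonomy group. Transport the partition of the free group by the first
letter to the orbits of the free group contained in each class. For a letter `a` and a point `s` at
which `a` agrees with an element of the holonomy group, the means of the piece of `a⁻¹` at `s` and
of the piece of `a` at `a s` add up to at least `1`, since left multiplication by `a` sends the words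
that do not start with `a⁻¹` to words that start with `a`. By integration the measures of the two
agreement sets add up to at most the total mass `1`, while they are equal to `0.54`
(`not_amenableRel_of_free`).

*Ergodicity* (`ergodicRel_holonomyRel`). On the agreement sets almost all the vertical and almost all
the horizontal slices of a saturated set are invariant under irrational rotations. Hence the set is
null or conull in the strip `|x| ≤ 0.27`, and the iterates of `h` bring almost every point to this
strip.

*Følner leaves* (`exists_holonomyRel_segment`). Every orbit contains arbitrarily long segments
`s₀, h s₀, …, hⁿ s₀` that consist of fixed points of `v₁` and `v₂`: since one of the rotation numbers
`ψ x` and `√2 ψ x` is irrational if `ψ x ≠ 0`, the point can be moved vertically to a place where `h`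
is so slow that it needs more than `n` steps to cross the region `0.33 ≤ x ≤ 0.67`. The boundary of
the corresponding set of vertices is concentrated at the two ends of the segment, so that its size
is bounded independently of `n`. This is a statement on every orbit, and not just on almost every
one; it is the reason for the generator `v₂`.

*The suspension.* The base is the boundary of a tubular neighbourhood of a planar chain of three
loops. It consists of an upper and a lower sheet, joined along one exterior and three interior
collars. The total space is the product of the base and the torus as a topological space. The
foliated charts are those of the horizontal foliation, except that over the interior collar of
number `j` the fibre is twisted by an isotopy from the identity to the generator of number `j`. Hence
the holonomy across this collar is that generator (`transRel_iff`).
-/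

/-! ### Level sets as smooth surfaces -/

/-- A nonzero linear form is the last coordinate of some linear system of coordinates. -/
theorem exists_continuousLinearEquiv_snd_eq {E G : Type*} [NormedAddCommGroup E] [NormedSpace ℝ E]
    [FiniteDimensional ℝ E] [NormedAddCommGroup G] [NormedSpace ℝ G] [FiniteDimensional ℝ G]
    (hd : Module.finrank ℝ E = Module.finrank ℝ G + 1) (l : E →L[ℝ] ℝ) (hl : l ≠ 0) :
    ∃ L : E ≃L[ℝ] G × ℝ, ∀ x, (L x).2 = l x := by
  have hl' : (l : E →ₗ[ℝ] ℝ) ≠ 0 := fun h => hl (by ext x; exact LinearMap.congr_fun h x)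
  obtain ⟨v, hv⟩ : ∃ v, l v = 1 := by
    obtain ⟨w, hw⟩ := LinearMap.surjective hl' 1
    exact ⟨w, hw⟩
  have hk : Module.finrank ℝ (LinearMap.ker (l : E →ₗ[ℝ] ℝ)) = Module.finrank ℝ G := by
    have h1 := LinearMap.finrank_range_add_finrank_ker (l : E →ₗ[ℝ] ℝ)
    rw [LinearMap.range_eq_top.2 (LinearMap.surjective hl'), finrank_top, Module.finrank_self] at h1
    omega
  let φ := LinearEquiv.ofFinrankEq _ _ hk
  have hker : ∀ x, x - l x • v ∈ LinearMap.ker (l : E →ₗ[ℝ] ℝ) := fun x => by simp [hv]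
  let f : E →ₗ[ℝ] LinearMap.ker (l : E →ₗ[ℝ] ℝ) :=
    LinearMap.codRestrict _ (LinearMap.id - (l : E →ₗ[ℝ] ℝ).smulRight v) hker
  let L : E →ₗ[ℝ] G × ℝ := (φ.toLinearMap ∘ₗ f).prod (l : E →ₗ[ℝ] ℝ)
  have hinj : Function.Injective L := by
    rw [← LinearMap.ker_eq_bot, LinearMap.ker_eq_bot']
    intro x hx
    have h2 : l x = 0 := congrArg Prod.snd hx
    have h1 : φ (f x) = 0 := congrArg Prod.fst hx
    have h3 : f x = 0 := by simpa using h1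
    have h4 : x - l x • v = 0 := congrArg Subtype.val h3
    simpa [h2] using h4
  have hfr : Module.finrank ℝ E = Module.finrank ℝ (G × ℝ) := by
    rw [Module.finrank_prod, Module.finrank_self, hd]
  exact ⟨(LinearEquiv.ofInjectiveOfFinrankEq L hinj hfr).toContinuousLinearEquiv, fun x => rfl⟩

/-- Near a regular point, the zero set of a smooth function has a chart onto the unit ball which is
the restriction of a smooth function and has a smooth inverse. -/
theorem exists_levelSet_chart {E G : Type*} [NormedAddCommGroup E] [NormedSpace ℝ E]
    [FiniteDimensional ℝ E] [NormedAddCommGroup G] [NormedSpace ℝ G] [FiniteDimensional ℝ G]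
    (hd : Module.finrank ℝ E = Module.finrank ℝ G + 1) {F : E → ℝ} (hF : ContDiff ℝ ∞ F)
    (p : {x // F x = 0}) (hp : fderiv ℝ F p ≠ 0) {O : Set E} (hO : IsOpen O) (hpO : (p : E) ∈ O) :
    ∃ (κ : OpenPartialHomeomorph {x // F x = 0} G) (A : E → G) (σ : G → E),
      p ∈ κ.source ∧ κ p = 0 ∧ κ.target = Metric.ball 0 1 ∧ (∀ x ∈ κ.source, (x : E) ∈ O) ∧
      ContDiff ℝ ∞ A ∧ (∀ x, κ x = A x) ∧ ContDiffOn ℝ ∞ σ (Metric.ball 0 1) ∧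
      ∀ u ∈ Metric.ball (0 : G) 1, (κ.symm u : E) = σ u := by
  classical
  have : CompleteSpace E := FiniteDimensional.complete ℝ E
  have : CompleteSpace G := FiniteDimensional.complete ℝ G
  obtain ⟨L, hL⟩ := exists_continuousLinearEquiv_snd_eq hd _ hp
  let Φ : E → G × ℝ := fun x => ((L x).1, F x)
  have hΦ : ContDiff ℝ ∞ Φ := (contDiff_fst.comp L.contDiff).prodMk hF
  have hone : (∞ : ℕ∞ω) ≠ 0 := by simp
  have hFd : ∀ x, DifferentiableAt ℝ F x := fun x => hF.differentiable hone x
  have hΦp : HasFDerivAt Φ (L : E →L[ℝ] G × ℝ) p := by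
    have h1 : HasFDerivAt Φ (((ContinuousLinearMap.fst ℝ G ℝ).comp (L : E →L[ℝ] G × ℝ)).prod
        (fderiv ℝ F p)) p :=
      ((ContinuousLinearMap.fst ℝ G ℝ).comp (L : E →L[ℝ] G × ℝ)).hasFDerivAt.prodMk
        (hFd p).hasFDerivAt
    convert h1 using 1
    ext x
    · rfl
    · exact hL x
  let e := hΦ.contDiffAt.toOpenPartialHomeomorph Φ hΦp hone
  have he : ∀ x, e x = Φ x := fun x => rfl
  have hpe : (p : E) ∈ e.source := hΦ.contDiffAt.mem_toOpenPartialHomeomorph_source hΦp hone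
  -- On `V` the derivative of `Φ` is invertible, so that the local inverse is smooth on all of it.
  let V : Set E := {x | fderiv ℝ Φ x ∈ range ((↑) : (E ≃L[ℝ] G × ℝ) → E →L[ℝ] G × ℝ)} ∩ O
  have hVo : IsOpen V :=
    ((ContinuousLinearEquiv.isOpen).preimage (hΦ.continuous_fderiv hone)).inter hO
  have hpV : (p : E) ∈ V := ⟨⟨L, hΦp.fderiv.symm⟩, hpO⟩
  have hW : IsOpen (e.target ∩ e.symm ⁻¹' V) := e.isOpen_inter_preimage_symm hVo
  have hpW : ((L p).1, (0 : ℝ)) ∈ e.target ∩ e.symm ⁻¹' V := by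
    have h1 : e p = ((L p).1, (0 : ℝ)) := by rw [he]; simp only [Φ, p.2]
    rw [← h1]
    exact ⟨e.map_source hpe, by rw [mem_preimage, e.left_inv hpe]; exact hpV⟩
  obtain ⟨ρ, hρ, hball⟩ := Metric.isOpen_iff.1 hW _ hpW
  let q : G := (L p).1
  let σ : G → E := fun u => e.symm (q + ρ • u, 0)
  have hmem : ∀ u ∈ Metric.ball (0 : G) 1, (q + ρ • u, (0 : ℝ)) ∈ e.target ∩ e.symm ⁻¹' V := by
    intro u hu
    apply hball
    rw [mem_ball_zero_iff] at hu
    rw [Metric.mem_ball, Prod.dist_eq, dist_self, max_lt_iff]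
    refine ⟨?_, hρ⟩
    rw [dist_eq_norm]
    simp only [q, add_sub_cancel_left, norm_smul, Real.norm_eq_abs, abs_of_pos hρ]
    nlinarith
  have hσs : ∀ u ∈ Metric.ball (0 : G) 1, Φ (σ u) = (q + ρ • u, 0) := fun u hu =>
    e.right_inv (hmem u hu).1
  have hσF : ∀ u ∈ Metric.ball (0 : G) 1, F (σ u) = 0 := fun u hu =>
    congrArg Prod.snd (hσs u hu)
  have hσ : ContDiffOn ℝ ∞ σ (Metric.ball 0 1) := by
    intro u hu
    obtain ⟨L', hL'⟩ := (hmem u hu).2.1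
    have h1 : ContDiffAt ℝ ∞ e.symm (q + ρ • u, 0) :=
      e.contDiffAt_symm (f₀' := L') (hmem u hu).1
        (by rw [hL']; exact (hΦ.differentiable hone _).hasFDerivAt) hΦ.contDiffAt
    have h2 : ContDiff ℝ ∞ (fun u : G => (q + ρ • u, (0 : ℝ))) := by fun_prop
    exact (h1.comp u h2.contDiffAt).contDiffWithinAt
  let A : E → G := fun x => ρ⁻¹ • ((L x).1 - q)
  have hA : ContDiff ℝ ∞ A := by
    have h1 : ContDiff ℝ ∞ (fun x => (L x).1) := contDiff_fst.comp L.contDiff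
    exact (h1.sub contDiff_const).const_smul _
  have hqA : ∀ x, q + ρ • A x = (L x).1 := fun x => by
    simp only [A, smul_smul, mul_inv_cancel₀ hρ.ne', one_smul, add_sub_cancel]
  have hΦA : ∀ x : {x // F x = 0}, (q + ρ • A x, (0 : ℝ)) = e x := fun x => by
    rw [hqA, he]; simp only [Φ, x.2]
  let inv : G → {x // F x = 0} := fun u => if h : F (σ u) = 0 then ⟨σ u, h⟩ else p
  have hinv : ∀ u ∈ Metric.ball (0 : G) 1, (inv u : E) = σ u := fun u hu => by
    simp only [inv, hσF u hu, dif_pos]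
  have hAσ : ∀ u ∈ Metric.ball (0 : G) 1, A (σ u) = u := fun u hu => by
    have h1 : (L (σ u)).1 = q + ρ • u := congrArg Prod.fst (hσs u hu)
    simp only [A, h1, add_sub_cancel_left, smul_smul, inv_mul_cancel₀ hρ.ne', one_smul]
  have hσA : ∀ x : {x // F x = 0}, (x : E) ∈ e.source → σ (A x) = x := fun x hx => by
    simp only [σ, hΦA]
    exact e.left_inv hx
  let κ : OpenPartialHomeomorph {x // F x = 0} G :=
    { toFun := fun x => A x
      invFun := inv
      source := {x | (x : E) ∈ e.source ∧ A x ∈ Metric.ball (0 : G) 1}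
      target := Metric.ball 0 1
      map_source' := fun x hx => hx.2
      map_target' := fun u hu => by
        refine ⟨?_, ?_⟩
        · rw [hinv u hu]; exact e.map_target (hmem u hu).1
        · rw [hinv u hu, hAσ u hu]; exact hu
      left_inv' := fun x hx => by
        apply Subtype.ext
        rw [hinv _ hx.2, hσA x hx.1]
      right_inv' := fun u hu => by rw [hinv u hu, hAσ u hu]
      open_source := (e.open_source.preimage continuous_subtype_val).inter
        (Metric.isOpen_ball.preimage (hA.continuous.comp continuous_subtype_val))
      open_target := Metric.isOpen_ball
      continuousOn_toFun := (hA.continuous.comp continuous_subtype_val).continuousOn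
      continuousOn_invFun := by
        rw [continuousOn_iff_continuous_domRestrict, continuous_induced_rng]
        exact (continuousOn_iff_continuous_domRestrict.1 hσ.continuousOn).congr
          fun u => (hinv u u.2).symm }
  refine ⟨κ, A, σ, ⟨hpe, ?_⟩, ?_, rfl, ?_, hA, fun x => rfl, hσ, fun u hu => hinv u hu⟩
  · simp [A, q]
  · change A p = 0
    simp [A, q]
  · intro x hx
    have h1 := (hmem _ hx.2).2
    rw [mem_preimage, hΦA, e.left_inv hx.1] at h1
    exact h1.2

/-! ### The base surface -/

/-- Signed position of `(x, y)` with respect to the planar core curve `y² + T(x)² = 1`, where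
`T(x) = 4x³ - 3x`. The core curve is a chain of three loops, touching at `x = ±1/2`; the function
is positive outside of the chain and negative inside of each loop. -/
noncomputable def coreFun (x y : ℝ) : ℝ :=
  y ^ 2 + (4 * x ^ 3 - 3 * x) ^ 2 - 1

/-- Equation of the boundary of a tubular neighbourhood in `ℝ³` of the core curve. -/
noncomputable def baseFun (p : ℝ × ℝ × ℝ) : ℝ :=
  p.2.2 ^ 2 + coreFun p.1 p.2.1 ^ 2 - 1 / 4

/-- The base of the suspension: a closed surface of genus `3`. -/
abbrev BaseSurface : Type :=
  {p : ℝ × ℝ × ℝ // baseFun p = 0}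

theorem contDiff_baseFun : ContDiff ℝ ∞ baseFun := by
  unfold baseFun coreFun
  fun_prop

theorem continuous_coreFun : Continuous fun q : ℝ × ℝ => coreFun q.1 q.2 := by
  unfold coreFun
  fun_prop

theorem one_sub_cheb_sq (x : ℝ) :
    1 - (4 * x ^ 3 - 3 * x) ^ 2 = (1 - x ^ 2) * (4 * x ^ 2 - 1) ^ 2 := by
  ring

/-- The surface is smooth: the critical values of `coreFun` are `-1` and `0`, whereas a critical point
of `baseFun` on the surface would be a critical point of `coreFun` with value `±1/2`. -/
theorem fderiv_baseFun_ne_zero (p : BaseSurface) : fderiv ℝ baseFun p ≠ 0 := by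
  obtain ⟨⟨x, y, z⟩, hp⟩ := p
  intro h
  simp only at h
  have key : ∀ v : ℝ × ℝ × ℝ, HasDerivAt (fun t : ℝ => baseFun ((x, y, z) + t • v)) 0 0 := by
    intro v
    have h1 : HasFDerivAt baseFun (0 : (ℝ × ℝ × ℝ) →L[ℝ] ℝ) ((x, y, z) + (0 : ℝ) • v) := by
      rw [zero_smul, add_zero, ← h]
      exact (contDiff_baseFun.differentiable (by simp) _).hasFDerivAt
    have h2 : HasDerivAt (fun t : ℝ => (x, y, z) + t • v) v 0 := by
      simpa using ((hasDerivAt_id (0 : ℝ)).smul_const v).const_add (x, y, z)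
    have h3 := h1.comp_hasDerivAt (0 : ℝ) h2
    rwa [zero_apply] at h3
  have hz := key (0, 0, 1)
  have hy := key (0, 1, 0)
  have hx := key (1, 0, 0)
  simp only [baseFun, coreFun, Prod.mk_add_mk, Prod.smul_mk, smul_eq_mul, mul_zero, mul_one,
    add_zero] at hx hy hz hp
  have hz' : HasDerivAt (fun t : ℝ => (z + t) ^ 2 + (y ^ 2 + (4 * x ^ 3 - 3 * x) ^ 2 - 1) ^ 2 - 1 / 4)
      (2 * z) 0 := by
    have h1 := ((((hasDerivAt_id (0 : ℝ)).const_add z).pow 2).add_const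
      ((y ^ 2 + (4 * x ^ 3 - 3 * x) ^ 2 - 1) ^ 2)).sub_const (1 / 4)
    refine h1.congr_deriv ?_
    simp
  have hz0 : z = 0 := by
    have := hz.unique hz'
    linarith
  have hy' : HasDerivAt (fun t : ℝ => z ^ 2 + ((y + t) ^ 2 + (4 * x ^ 3 - 3 * x) ^ 2 - 1) ^ 2 - 1 / 4)
      (2 * (y ^ 2 + (4 * x ^ 3 - 3 * x) ^ 2 - 1) * (2 * y)) 0 := by
    have h1 := ((((((hasDerivAt_id (0 : ℝ)).const_add y).pow 2).add_const
      ((4 * x ^ 3 - 3 * x) ^ 2)).sub_const 1).pow 2).const_add (z ^ 2) |>.sub_const (1 / 4)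
    refine h1.congr_deriv ?_
    simp
  have hw : y ^ 2 + (4 * x ^ 3 - 3 * x) ^ 2 - 1 ≠ 0 := by
    intro h0
    rw [h0, hz0] at hp
    norm_num at hp
  have hy0 : y = 0 := by
    have := hy.unique hy'
    have h2 : (y ^ 2 + (4 * x ^ 3 - 3 * x) ^ 2 - 1) * y = 0 := by linarith
    exact (mul_eq_zero.1 h2).resolve_left hw
  have hx' : HasDerivAt (fun t : ℝ =>
        z ^ 2 + (y ^ 2 + (4 * (x + t) ^ 3 - 3 * (x + t)) ^ 2 - 1) ^ 2 - 1 / 4)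
      (2 * (y ^ 2 + (4 * x ^ 3 - 3 * x) ^ 2 - 1) *
        (2 * (4 * x ^ 3 - 3 * x) * (4 * (3 * x ^ 2) - 3))) 0 := by
    have h0 := (hasDerivAt_id (0 : ℝ)).const_add x
    have h1 := ((((((h0.pow 3).const_mul 4).sub (h0.const_mul 3)).pow 2).const_add
      (y ^ 2)).sub_const 1).pow 2 |>.const_add (z ^ 2) |>.sub_const (1 / 4)
    refine h1.congr_deriv ?_
    simp
  have h3 := hx.unique hx'
  rw [hz0, hy0] at hp
  rw [hy0] at h3 hw
  have h4 : (4 * x ^ 3 - 3 * x) * (4 * (3 * x ^ 2) - 3) = 0 := by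
    have h5 : ((0 : ℝ) ^ 2 + (4 * x ^ 3 - 3 * x) ^ 2 - 1) *
      ((4 * x ^ 3 - 3 * x) * (4 * (3 * x ^ 2) - 3)) = 0 := by linarith
    exact (mul_eq_zero.1 h5).resolve_left hw
  rcases mul_eq_zero.1 h4 with h5 | h5
  · rw [h5] at hp
    norm_num at hp
  · apply hw
    have h6 : x ^ 2 = 1 / 4 := by linarith
    have h7 : (4 * x ^ 3 - 3 * x) ^ 2 = x ^ 2 * (4 * x ^ 2 - 3) ^ 2 := by ring
    rw [h7, h6]
    norm_num

theorem baseFun_abs_le {p : ℝ × ℝ × ℝ} (hp : baseFun p = 0) :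
    |p.1| ≤ 2 ∧ |p.2.1| ≤ 2 ∧ |p.2.2| ≤ 2 := by
  obtain ⟨x, y, z⟩ := p
  simp only [baseFun] at hp ⊢
  have hw : coreFun x y ≤ 1 := by nlinarith [sq_nonneg z]
  have hz : z ^ 2 ≤ 1 := by nlinarith [sq_nonneg (coreFun x y)]
  simp only [coreFun] at hw
  refine ⟨?_, ?_, ?_⟩
  · rw [← sq_le_sq₀ (abs_nonneg x) (by norm_num), sq_abs]
    by_contra! hx
    have h1 : (4 * x ^ 3 - 3 * x) ^ 2 = x ^ 2 * (4 * x ^ 2 - 3) ^ 2 := by ring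
    have h2 : 4 < (4 * x ^ 2 - 3) := by linarith
    nlinarith [sq_nonneg y]
  · rw [← sq_le_sq₀ (abs_nonneg y) (by norm_num), sq_abs]
    nlinarith [sq_nonneg (4 * x ^ 3 - 3 * x)]
  · rw [← sq_le_sq₀ (abs_nonneg z) (by norm_num), sq_abs]
    linarith

instance : CompactSpace BaseSurface := by
  refine isCompact_iff_compactSpace.1 (?_ : IsCompact {p | baseFun p = 0})
  refine Metric.isCompact_of_isClosed_isBounded
    (isClosed_eq contDiff_baseFun.continuous continuous_const) ?_
  refine (Metric.isBounded_closedBall (x := (0 : ℝ × ℝ × ℝ)) (r := 2)).subset fun p hp => ?_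
  obtain ⟨h1, h2, h3⟩ := baseFun_abs_le hp
  rw [mem_closedBall_zero_iff, Prod.norm_def, Prod.norm_def]
  exact max_le h1 (max_le h2 h3)

/-- The pieces of the base over which the suspension is trivialized: the upper and the lower sheet,
and the collars joining them along the exterior and along the three interior boundary curves. -/
inductive Zone : Type
  | up
  | down
  | out
  | inn (j : Fin 3)

/-- The interior of the loop number `j` of the core curve lies over this set of abscissas. -/
noncomputable def lobe : Fin 3 → Set ℝ
  | 0 => Iio (-1 / 2)
  | 1 => Ioo (-1 / 2) (1 / 2)
  | 2 => Ioi (1 / 2)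

theorem isOpen_lobe (j : Fin 3) : IsOpen (lobe j) := by
  fin_cases j
  · exact isOpen_Iio
  · exact isOpen_Ioo
  · exact isOpen_Ioi

/-- The open set corresponding to a zone. The zones of the sheets are chosen such that `ramp` is
constant on each of them. -/
noncomputable def Zone.carrier : Zone → Set (ℝ × ℝ × ℝ)
  | .up => {p | 1 / 4 < p.2.2}
  | .down => {p | p.2.2 < 0}
  | .out => {p | 0 < coreFun p.1 p.2.1}
  | .inn j => {p | coreFun p.1 p.2.1 < 0 ∧ p.1 ∈ lobe j}

theorem Zone.isOpen_carrier (k : Zone) : IsOpen k.carrier := by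
  have hc : Continuous fun p : ℝ × ℝ × ℝ => coreFun p.1 p.2.1 :=
    continuous_coreFun.comp (f := fun p : ℝ × ℝ × ℝ => (p.1, p.2.1)) (by fun_prop)
  cases k with
  | up => exact isOpen_lt continuous_const (by fun_prop)
  | down => exact isOpen_lt (by fun_prop) continuous_const
  | out => exact isOpen_lt continuous_const hc
  | inn j => exact (isOpen_lt hc continuous_const).inter ((isOpen_lobe j).preimage continuous_fst)

theorem Zone.exists_mem (p : BaseSurface) : ∃ k : Zone, (p : ℝ × ℝ × ℝ) ∈ k.carrier := by
  obtain ⟨⟨x, y, z⟩, hp⟩ := p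
  simp only [baseFun] at hp
  rcases lt_trichotomy (coreFun x y) 0 with h | h | h
  · have h1 : x ≠ -1 / 2 := by
      rintro rfl
      simp only [coreFun] at h
      nlinarith [sq_nonneg y]
    have h2 : x ≠ 1 / 2 := by
      rintro rfl
      simp only [coreFun] at h
      nlinarith [sq_nonneg y]
    rcases lt_or_gt_of_ne h1 with h1 | h1
    · exact ⟨.inn 0, h, h1⟩
    rcases lt_or_gt_of_ne h2 with h2 | h2
    · exact ⟨.inn 1, h, h1, h2⟩
    · exact ⟨.inn 2, h, h2⟩
  · rw [h] at hp
    rcases le_or_gt z (1 / 4) with h1 | h1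
    · refine ⟨.down, ?_⟩
      change z < 0
      nlinarith
    · exact ⟨.up, h1⟩
  · exact ⟨.out, h⟩

/-- `p` and `p'` lie in a connected subset of the part of the base in the zone `k`. -/
def Zone.Joined (k : Zone) (p p' : BaseSurface) : Prop :=
  ∃ K : Set BaseSurface, IsPreconnected K ∧ (∀ q ∈ K, (q : ℝ × ℝ × ℝ) ∈ k.carrier) ∧ p ∈ K ∧ p' ∈ K

/-- The central zone of the upper (`b = true`) or lower (`b = false`) sheet. -/
def Zone.sheet (b : Bool) : Zone := if b then .up else .down

/-- The sign `±1` of a sheet. -/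
noncomputable def sheetSign (b : Bool) : ℝ := if b then 1 else -1

theorem sheetSign_sq (b : Bool) : sheetSign b ^ 2 = 1 := by
  cases b <;> simp [sheetSign]

/-- The base point of a sheet, on the core curve. -/
noncomputable def corePoint (b : Bool) : BaseSurface :=
  ⟨(1, 0, sheetSign b * (1 / 2)), by
    simp only [baseFun, coreFun, mul_pow, sheetSign_sq]; norm_num⟩

/-- Each closed sheet is a graph over the planar domain `|coreFun| ≤ 1/2`. -/
theorem baseFun_lift (b : Bool) {q : ℝ × ℝ} (hq : |coreFun q.1 q.2| ≤ 1 / 2) :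
    baseFun (q.1, q.2, sheetSign b * √(1 / 4 - coreFun q.1 q.2 ^ 2)) = 0 := by
  have h : 0 ≤ 1 / 4 - coreFun q.1 q.2 ^ 2 := by
    have := sq_le_sq' (neg_le_of_abs_le hq) (le_of_abs_le hq)
    linarith
  simp only [baseFun, mul_pow, sheetSign_sq, Real.sq_sqrt h]
  ring

theorem BaseSurface.eq_lift {b : Bool} {p : BaseSurface} (hp : 0 ≤ sheetSign b * p.1.2.2) :
    p.1.2.2 = sheetSign b * √(1 / 4 - coreFun p.1.1 p.1.2.1 ^ 2) := by
  have h1 : 1 / 4 - coreFun p.1.1 p.1.2.1 ^ 2 = (sheetSign b * p.1.2.2) ^ 2 := by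
    have := p.2
    simp only [baseFun] at this
    rw [mul_pow, sheetSign_sq]
    linarith
  rw [h1, Real.sqrt_sq hp, ← mul_assoc, ← sq, sheetSign_sq, one_mul]

theorem BaseSurface.abs_coreFun_le (p : BaseSurface) : |coreFun p.1.1 p.1.2.1| ≤ 1 / 2 := by
  have h := p.2
  simp only [baseFun] at h
  apply abs_le_of_sq_le_sq _ (by norm_num)
  nlinarith [sq_nonneg p.1.2.2]

/-- Connected planar sets lift to connected sets in each of the two sheets. -/
theorem Zone.joined_of_planar {k : Zone} {b : Bool} {D : Set (ℝ × ℝ)} (hD : IsPreconnected D)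
    (hD' : ∀ q ∈ D, |coreFun q.1 q.2| ≤ 1 / 2)
    (hk : ∀ q ∈ D, (q.1, q.2, sheetSign b * √(1 / 4 - coreFun q.1 q.2 ^ 2)) ∈ k.carrier)
    {p p' : BaseSurface} (hp : 0 ≤ sheetSign b * p.1.2.2) (hp' : 0 ≤ sheetSign b * p'.1.2.2)
    (hpD : (p.1.1, p.1.2.1) ∈ D) (hpD' : (p'.1.1, p'.1.2.1) ∈ D) : k.Joined p p' := by
  let lift : ℝ × ℝ → ℝ × ℝ × ℝ := fun q =>
    (q.1, q.2, sheetSign b * √(1 / 4 - coreFun q.1 q.2 ^ 2))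
  have hlift : Continuous lift := by
    have := continuous_coreFun
    fun_prop
  have heq : ∀ {p : BaseSurface}, 0 ≤ sheetSign b * p.1.2.2 → lift (p.1.1, p.1.2.1) = p.1 := by
    intro p hp
    ext
    · rfl
    · rfl
    · exact (BaseSurface.eq_lift hp).symm
  refine ⟨Subtype.val ⁻¹' (lift '' D), ?_, ?_, ?_, ?_⟩
  · have h : ((↑) : BaseSurface → ℝ × ℝ × ℝ) '' (((↑) : BaseSurface → ℝ × ℝ × ℝ) ⁻¹' (lift '' D)) =
        lift '' D := by
      refine image_preimage_eq_of_subset ?_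
      rintro _ ⟨q, hq, rfl⟩
      exact ⟨⟨_, baseFun_lift b (hD' q hq)⟩, rfl⟩
    have hi : Topology.IsInducing ((↑) : BaseSurface → ℝ × ℝ × ℝ) := ⟨rfl⟩
    rw [← hi.isPreconnected_image, h]
    exact hD.image _ hlift.continuousOn
  · rintro q ⟨q', hq', h⟩
    rw [← h]
    exact hk q' hq'
  · exact ⟨_, hpD, heq hp⟩
  · exact ⟨_, hpD', heq hp'⟩

/-- A path from a point of the planar domain to the core curve, along which the sign of `coreFun`
is constant and its absolute value does not exceed the initial value. Inside of a loop, the abscissa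
is constant along the path. -/
theorem exists_path_to_core (x y : ℝ) (hw : coreFun x y ≠ 0) :
    ∃ f : ℝ → ℝ × ℝ, Continuous f ∧ f 0 = (x, y) ∧ coreFun (f 1).1 (f 1).2 = 0 ∧
      ∀ t ∈ Icc (0 : ℝ) 1, |coreFun (f t).1 (f t).2| ≤ |coreFun x y| ∧
        (t < 1 → 0 < coreFun x y → 0 < coreFun (f t).1 (f t).2) ∧
        (t < 1 → coreFun x y < 0 → coreFun (f t).1 (f t).2 < 0 ∧ (f t).1 = x) := by
  set w := coreFun x y with hwd
  set T := (4 * x ^ 3 - 3 * x) with hT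
  have hyw : y ^ 2 = 1 - T ^ 2 + w := by rw [hwd]; simp only [coreFun, hT]; ring
  by_cases hc : w < 0 ∨ |x| ≤ 1
  · -- along the vertical through the point `coreFun` can be decreased linearly to `0`
    obtain ⟨ε, hε, hy⟩ : ∃ ε : ℝ, ε ^ 2 = 1 ∧ y = ε * √(1 - T ^ 2 + w) := by
      rcases le_or_gt 0 y with h | h
      · exact ⟨1, by norm_num, by rw [← hyw, Real.sqrt_sq h, one_mul]⟩
      · exact ⟨-1, by norm_num, by rw [← hyw, Real.sqrt_sq_eq_abs, abs_of_neg h]; ring⟩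
    have hnn : ∀ t ∈ Icc (0 : ℝ) 1, 0 ≤ 1 - T ^ 2 + (1 - t) * w := by
      rintro t ⟨ht0, ht1⟩
      rcases hc with hc | hc
      · nlinarith [sq_nonneg y]
      · have h1 : 0 ≤ 1 - T ^ 2 := by
          rw [hT, one_sub_cheb_sq]
          have : x ^ 2 ≤ 1 := by rwa [sq_le_one_iff_abs_le_one]
          exact mul_nonneg (by linarith) (sq_nonneg _)
        nlinarith [sq_nonneg y]
    have hval : ∀ t ∈ Icc (0 : ℝ) 1, coreFun x (ε * √(1 - T ^ 2 + (1 - t) * w)) = (1 - t) * w := by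
      intro t ht
      simp only [coreFun, ← hT, mul_pow, hε, Real.sq_sqrt (hnn t ht)]
      ring
    refine ⟨fun t => (x, ε * √(1 - T ^ 2 + (1 - t) * w)), by fun_prop, ?_, ?_, ?_⟩
    · simp [← hy]
    · rw [hval 1 (by simp)]; ring
    · intro t ht
      rw [hval t ht]
      refine ⟨?_, fun h1 h2 => mul_pos (by linarith) h2, fun h1 h2 =>
        ⟨mul_neg_of_pos_of_neg (by linarith) h2, rfl⟩⟩
      rw [abs_mul, abs_of_nonneg (by linarith [ht.2] : 0 ≤ 1 - t)]
      exact mul_le_of_le_one_left (abs_nonneg _) (by linarith [ht.1])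
  · push Not at hc
    obtain ⟨hw0, hx⟩ := hc
    have hw1 : 0 < w := lt_of_le_of_ne hw0 hw.symm
    obtain ⟨ε, hε, hxε⟩ : ∃ ε : ℝ, ε ^ 2 = 1 ∧ 1 < ε * x := by
      rcases le_or_gt 0 x with h | h
      · exact ⟨1, by norm_num, by rwa [one_mul, ← abs_of_nonneg h]⟩
      · exact ⟨-1, by norm_num, by rwa [neg_one_mul, ← abs_of_neg h]⟩
    have hval : ∀ t : ℝ, coreFun ((1 - t) * x + t * ε) ((1 - t) * y) = (1 - t) ^ 2 * y ^ 2 +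
        (((1 - t) * (ε * x) + t) ^ 2 - 1) * (4 * ((1 - t) * (ε * x) + t) ^ 2 - 1) ^ 2 := by
      intro t
      have h1 : (1 - t) * (ε * x) + t = ε * ((1 - t) * x + t * ε) := by linear_combination -t * hε
      have h2 : ((1 - t) * (ε * x) + t) ^ 2 = ((1 - t) * x + t * ε) ^ 2 := by
        rw [h1, mul_pow, hε, one_mul]
      rw [h2]
      simp only [coreFun]
      ring
    have hw' : w = y ^ 2 + ((ε * x) ^ 2 - 1) * (4 * (ε * x) ^ 2 - 1) ^ 2 := by
      have := hval 0
      simp only [sub_zero, one_mul, zero_mul, add_zero] at this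
      rw [hwd, this]; ring
    refine ⟨fun t => ((1 - t) * x + t * ε, (1 - t) * y), by fun_prop, by simp, ?_, ?_⟩
    · rw [hval]; ring
    · intro t ht
      rw [hval]
      obtain ⟨u, hu⟩ : ∃ u, u = (1 - t) * (ε * x) + t := ⟨_, rfl⟩
      obtain ⟨v, hv⟩ : ∃ v, v = ε * x := ⟨_, rfl⟩
      rw [← hv] at hw' hu hxε
      rw [← hv, ← hu]
      have hu1 : 1 ≤ u := by nlinarith [ht.1, ht.2]
      have hu2 : u ≤ v := by nlinarith [ht.1, ht.2]
      have hu3 : 1 ≤ u ^ 2 := by nlinarith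
      have h3 : 0 ≤ (u ^ 2 - 1) * (4 * u ^ 2 - 1) ^ 2 := mul_nonneg (by linarith) (sq_nonneg _)
      have h4 : 0 ≤ (1 - t) ^ 2 * y ^ 2 := by positivity
      refine ⟨?_, fun h1 _ => ?_, fun _ h2 => absurd h2 hw0.not_gt⟩
      · rw [abs_of_nonneg (by linarith), abs_of_nonneg hw0, hw']
        have h5 : u ^ 2 ≤ v ^ 2 := by nlinarith
        have h6 : (1 - t) ^ 2 * y ^ 2 ≤ y ^ 2 :=
          mul_le_of_le_one_left (sq_nonneg y) (by nlinarith [ht.1, ht.2])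
        have h7 : (4 * u ^ 2 - 1) ^ 2 ≤ (4 * v ^ 2 - 1) ^ 2 :=
          pow_le_pow_left₀ (by linarith) (by linarith) 2
        have h8 : (u ^ 2 - 1) * (4 * u ^ 2 - 1) ^ 2 ≤ (v ^ 2 - 1) * (4 * v ^ 2 - 1) ^ 2 :=
          mul_le_mul (by linarith) h7 (sq_nonneg _) (by linarith)
        linarith
      · have hu4 : 1 < u := by nlinarith
        have hu5 : 1 < u ^ 2 := by nlinarith
        have h9 : 0 < (u ^ 2 - 1) * (4 * u ^ 2 - 1) ^ 2 :=
          mul_pos (by linarith) (pow_pos (by linarith) 2)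
        linarith

/-- Every point of the core curve is joined to the base point of each sheet. -/
theorem Zone.joined_core {b : Bool} {p : BaseSurface} (hp : 0 ≤ sheetSign b * p.1.2.2)
    (hw : coreFun p.1.1 p.1.2.1 = 0) : (Zone.sheet b).Joined p (corePoint b) := by
  obtain ⟨⟨x, y, z⟩, hF⟩ := p
  simp only at hw hp
  have hyx : y ^ 2 = 1 - (4 * x ^ 3 - 3 * x) ^ 2 := by simp only [coreFun] at hw; linarith
  obtain ⟨ε, hε, hy⟩ : ∃ ε : ℝ, ε ^ 2 = 1 ∧ y = ε * √(1 - (4 * x ^ 3 - 3 * x) ^ 2) := by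
    rcases le_or_gt 0 y with h | h
    · exact ⟨1, by norm_num, by rw [← hyx, Real.sqrt_sq h, one_mul]⟩
    · exact ⟨-1, by norm_num, by rw [← hyx, Real.sqrt_sq_eq_abs, abs_of_neg h]; ring⟩
  let g : ℝ → ℝ × ℝ := fun t => (t, ε * √(1 - (4 * t ^ 3 - 3 * t) ^ 2))
  have hg : Continuous g := by fun_prop
  have hg0 : ∀ t ∈ Icc (-1 : ℝ) 1, coreFun (g t).1 (g t).2 = 0 := by
    intro t ht
    have h1 : 0 ≤ 1 - (4 * t ^ 3 - 3 * t) ^ 2 := by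
      rw [one_sub_cheb_sq]
      exact mul_nonneg (by nlinarith [ht.1, ht.2]) (sq_nonneg _)
    simp only [g, coreFun, mul_pow, hε, Real.sq_sqrt h1]
    ring
  refine Zone.joined_of_planar (D := g '' Icc (-1) 1)
    (isPreconnected_Icc.image _ hg.continuousOn) ?_ ?_ hp ?_ ?_ ?_
  · rintro _ ⟨t, ht, rfl⟩
    rw [hg0 t ht]; norm_num
  · rintro _ ⟨t, ht, rfl⟩
    rw [hg0 t ht]
    have : √((1 : ℝ) / 4 - 0 ^ 2) = 1 / 2 := by
      rw [show (1 : ℝ) / 4 - 0 ^ 2 = (1 / 2) ^ 2 by norm_num, Real.sqrt_sq (by norm_num)]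
    rw [this]
    cases b <;> norm_num [Zone.sheet, Zone.carrier, sheetSign]
  · simp only [corePoint]
    rw [← mul_assoc, ← sq, sheetSign_sq]; norm_num
  · refine ⟨x, ?_, by simp only [g, ← hy]⟩
    have h2 : 0 ≤ (1 - x ^ 2) * (4 * x ^ 2 - 1) ^ 2 := by
      rw [← one_sub_cheb_sq, ← hyx]; exact sq_nonneg y
    by_contra hx
    have h3 : 1 < x ^ 2 := by
      by_contra! h4
      exact hx (abs_le.1 (sq_le_one_iff_abs_le_one x |>.1 h4))
    have h4 : 0 < (4 * x ^ 2 - 1) ^ 2 := pow_pos (by linarith) 2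
    nlinarith
  · refine ⟨1, by simp, ?_⟩
    simp only [g, corePoint]
    norm_num

theorem Zone.mem_sheet_lift {b : Bool} {q : ℝ × ℝ}
    (hq : |coreFun q.1 q.2| ≤ 2 / 5) :
    (q.1, q.2, sheetSign b * √(1 / 4 - coreFun q.1 q.2 ^ 2)) ∈ (Zone.sheet b).carrier := by
  have h1 : coreFun q.1 q.2 ^ 2 ≤ (2 / 5) ^ 2 := sq_le_sq' (neg_le_of_abs_le hq) (le_of_abs_le hq)
  have h2 : 1 / 4 < √(1 / 4 - coreFun q.1 q.2 ^ 2) := by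
    apply Real.lt_sqrt_of_sq_lt
    linarith
  cases b
  · simp only [Zone.sheet, Zone.carrier, sheetSign, Bool.false_eq_true, if_false, mem_ofPred_eq]
    linarith
  · simpa only [Zone.sheet, Zone.carrier, sheetSign, if_true, mem_ofPred_eq, one_mul] using h2

theorem Zone.Joined.trans {k : Zone} {p q r : BaseSurface} (h : k.Joined p q) (h' : k.Joined q r) :
    k.Joined p r := by
  obtain ⟨K, hK, hk, hp, hq⟩ := h
  obtain ⟨K', hK', hk', hq', hr⟩ := h'
  exact ⟨K ∪ K', hK.union q hq hq' hK', fun x hx => hx.elim (hk x) (hk' x), .inl hp, .inr hr⟩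

/-- The points of the central zone of a sheet are joined to its base point. -/
theorem Zone.joined_sheet {b : Bool} {p : BaseSurface}
    (hp : (p : ℝ × ℝ × ℝ) ∈ (Zone.sheet b).carrier) : (Zone.sheet b).Joined p (corePoint b) := by
  have hz : 0 < sheetSign b * p.1.2.2 := by
    cases b
    · have : p.1.2.2 < 0 := hp
      simp only [sheetSign, Bool.false_eq_true, if_false]; linarith
    · have : 1 / 4 < p.1.2.2 := hp
      simp only [sheetSign, if_true]; linarith
  by_cases hw : coreFun p.1.1 p.1.2.1 = 0
  · exact Zone.joined_core hz.le hw
  obtain ⟨f, hf, hf0, hf1, hft⟩ := exists_path_to_core _ _ hw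
  have hle := BaseSurface.abs_coreFun_le p
  have h1 : |coreFun (f 1).1 (f 1).2| ≤ 1 / 2 := by rw [hf1]; norm_num
  let q : BaseSurface := ⟨_, baseFun_lift b h1⟩
  have hq : 0 ≤ sheetSign b * q.1.2.2 := by
    simp only [q]
    rw [← mul_assoc, ← sq, sheetSign_sq, one_mul]
    exact Real.sqrt_nonneg _
  refine Zone.Joined.trans ?_ (Zone.joined_core hq hf1)
  refine Zone.joined_of_planar (D := f '' Icc 0 1) (isPreconnected_Icc.image _ hf.continuousOn)
    ?_ ?_ hz.le hq ⟨0, by simp, hf0⟩ ⟨1, by simp, rfl⟩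
  · rintro _ ⟨t, ht, rfl⟩
    exact (hft t ht).1.trans hle
  · rintro _ ⟨t, ht, rfl⟩
    have h2 : √(1 / 4 - coreFun p.1.1 p.1.2.1 ^ 2) ≤ √(1 / 4 - coreFun (f t).1 (f t).2 ^ 2) := by
      apply Real.sqrt_le_sqrt
      have := sq_le_sq.2 (hft t ht).1
      linarith
    have h3 := BaseSurface.eq_lift hz.le
    cases b
    · have h4 : p.1.2.2 < 0 := hp
      simp only [Zone.sheet, Zone.carrier, sheetSign, Bool.false_eq_true, if_false,
        mem_ofPred_eq] at h3 ⊢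
      linarith
    · have h4 : 1 / 4 < p.1.2.2 := hp
      simp only [Zone.sheet, Zone.carrier, sheetSign, if_true, mem_ofPred_eq] at h3 ⊢
      linarith

/-- The points of a collar are joined, within the collar, to points of the central zone of each of
the sheets to which they belong. -/
theorem Zone.exists_joined_sheet {k : Zone} {b : Bool} {p : BaseSurface}
    (hk : k = .out ∨ ∃ j, k = .inn j) (hp : (p : ℝ × ℝ × ℝ) ∈ k.carrier)
    (hz : 0 ≤ sheetSign b * p.1.2.2) :
    ∃ q : BaseSurface, k.Joined p q ∧ (q : ℝ × ℝ × ℝ) ∈ (Zone.sheet b).carrier := by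
  have hw : coreFun p.1.1 p.1.2.1 ≠ 0 := by
    rcases hk with rfl | ⟨j, rfl⟩
    · exact ne_of_gt hp
    · exact ne_of_lt hp.1
  obtain ⟨f, hf, hf0, hf1, hft⟩ := exists_path_to_core _ _ hw
  have hle := BaseSurface.abs_coreFun_le p
  obtain ⟨t, ⟨ht0, ht1⟩, ht⟩ : ∃ t ∈ Ico (0 : ℝ) 1, |coreFun (f t).1 (f t).2| < 2 / 5 := by
    have h1 : Filter.Tendsto (fun t => |coreFun (f t).1 (f t).2|) (𝓝[<] 1) (𝓝 0) := by
      have h2 : Continuous fun t => |coreFun (f t).1 (f t).2| := (continuous_coreFun.comp hf).abs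
      have h3 := h2.tendsto 1
      simp only [hf1, abs_zero] at h3
      exact h3.mono_left nhdsWithin_le_nhds
    have h2 := (h1.eventually (gt_mem_nhds (by norm_num : (0 : ℝ) < 2 / 5))).and
      (Ico_mem_nhdsLT (zero_lt_one' ℝ))
    obtain ⟨t, ht, ht'⟩ := h2.exists
    exact ⟨t, ht', ht⟩
  have h1 : |coreFun (f t).1 (f t).2| ≤ 1 / 2 := ht.le.trans (by norm_num)
  let q : BaseSurface := ⟨_, baseFun_lift b h1⟩
  have hq : 0 ≤ sheetSign b * q.1.2.2 := by
    simp only [q]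
    rw [← mul_assoc, ← sq, sheetSign_sq, one_mul]
    exact Real.sqrt_nonneg _
  refine ⟨q, ?_, Zone.mem_sheet_lift ht.le⟩
  refine Zone.joined_of_planar (D := f '' Icc 0 t) (isPreconnected_Icc.image _ hf.continuousOn)
    ?_ ?_ hz hq ⟨0, by simp [ht0], hf0⟩ ⟨t, by simp [ht0], rfl⟩
  · rintro _ ⟨t', ht', rfl⟩
    exact (hft t' ⟨ht'.1, ht'.2.trans ht1.le⟩).1.trans hle
  · rintro _ ⟨t', ht', rfl⟩
    have h2 := hft t' ⟨ht'.1, ht'.2.trans ht1.le⟩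
    have h3 : t' < 1 := ht'.2.trans_lt ht1
    rcases hk with rfl | ⟨j, rfl⟩
    · exact h2.2.1 h3 hp
    · refine ⟨(h2.2.2 h3 hp.1).1, ?_⟩
      rw [(h2.2.2 h3 hp.1).2]
      exact hp.2

/-- Each collar contains a point on the common boundary of the two sheets. -/
theorem Zone.exists_mem_boundary {k : Zone} (hk : k = .out ∨ ∃ j, k = .inn j) :
    ∃ p : BaseSurface, (p : ℝ × ℝ × ℝ) ∈ k.carrier ∧ p.1.2.2 = 0 := by
  have h2 : √(1 / 2 : ℝ) ^ 2 = 1 / 2 := Real.sq_sqrt (by norm_num)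
  have h3 : √(3 : ℝ) ^ 2 = 3 := Real.sq_sqrt (by norm_num)
  have h1 : (1 : ℝ) < √3 := by
    apply Real.lt_sqrt_of_sq_lt; norm_num
  rcases hk with rfl | ⟨j, rfl⟩
  · refine ⟨⟨(1, √(1 / 2), 0), ?_⟩, ?_, rfl⟩
    · simp only [baseFun, coreFun, h2]; norm_num
    · simp only [Zone.carrier, coreFun, mem_ofPred_eq, h2]; norm_num
  · obtain ⟨x, hx, hT⟩ : ∃ x ∈ lobe j, 4 * x ^ 3 - 3 * x = 0 := by
      fin_cases j
      · refine ⟨-√3 / 2, ?_, by ring_nf; rw [show √3 ^ 3 = √3 ^ 2 * √3 by ring, h3]; ring⟩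
        simp only [lobe, mem_Iio]; linarith
      · exact ⟨0, by simp only [lobe, mem_Ioo]; norm_num, by norm_num⟩
      · refine ⟨√3 / 2, ?_, by ring_nf; rw [show √3 ^ 3 = √3 ^ 2 * √3 by ring, h3]; ring⟩
        simp only [lobe, mem_Ioi]; linarith
    refine ⟨⟨(x, √(1 / 2), 0), ?_⟩, ⟨?_, hx⟩, rfl⟩
    · simp only [baseFun, coreFun, h2, hT]; norm_num
    · simp only [coreFun, h2, hT]; norm_num

theorem Zone.Joined.connectedComponent_eq {k : Zone} {p q : BaseSurface} (h : k.Joined p q) :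
    connectedComponent p = connectedComponent q := by
  obtain ⟨K, hK, -, hp, hq⟩ := h
  exact _root_.connectedComponent_eq (hK.subset_connectedComponent hp hq)

instance : ConnectedSpace BaseSurface := by
  have hs : ∀ (b : Bool) (p : BaseSurface), 0 ≤ sheetSign b * p.1.2.2 →
      connectedComponent p = connectedComponent (corePoint b) := by
    intro b p hz
    obtain ⟨k, hk⟩ := Zone.exists_mem p
    cases k with
    | up =>
      obtain rfl : b = true := by
        by_contra hb
        have h1 : 1 / 4 < p.1.2.2 := hk
        simp only [Bool.not_eq_true] at hb
        subst hb
        simp only [sheetSign, Bool.false_eq_true, if_false] at hz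
        linarith
      exact (Zone.joined_sheet (b := true) hk).connectedComponent_eq
    | down =>
      obtain rfl : b = false := by
        by_contra hb
        have h1 : p.1.2.2 < 0 := hk
        simp only [Bool.not_eq_false] at hb
        subst hb
        simp only [sheetSign, if_true] at hz
        linarith
      exact (Zone.joined_sheet (b := false) hk).connectedComponent_eq
    | out =>
      obtain ⟨q, h1, h2⟩ := Zone.exists_joined_sheet (.inl rfl) hk hz
      rw [h1.connectedComponent_eq, (Zone.joined_sheet h2).connectedComponent_eq]
    | inn j =>
      obtain ⟨q, h1, h2⟩ := Zone.exists_joined_sheet (.inr ⟨j, rfl⟩) hk hz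
      rw [h1.connectedComponent_eq, (Zone.joined_sheet h2).connectedComponent_eq]
  have hc : connectedComponent (corePoint false) = connectedComponent (corePoint true) := by
    obtain ⟨p, -, hp⟩ := Zone.exists_mem_boundary (k := .out) (.inl rfl)
    rw [← hs false p (by simp [hp]), ← hs true p (by simp [hp])]
  have hall : ∀ p : BaseSurface, connectedComponent p = connectedComponent (corePoint true) := by
    intro p
    rcases le_total 0 p.1.2.2 with h | h
    · exact hs true p (by simpa [sheetSign] using h)
    · rw [hs false p (by simpa [sheetSign] using h), hc]
  rw [connectedSpace_iff_connectedComponent]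
  exact ⟨corePoint true, eq_univ_of_forall fun p => (hall p) ▸ mem_connectedComponent⟩

/-! ### The fibre and the generators of the holonomy -/

/-- The plane, as the model of the leaves and of the transversals. -/
abbrev Plane : Type := EuclideanSpace ℝ (Fin 2)

/-- The fibre of the suspension. -/
abbrev Torus : Type := UnitAddCircle × UnitAddCircle

/-- A smooth plateau function, equal to `1` on `[-0.27, 0.27]` and with support `[-0.33, 0.33]`. -/
noncomputable def cutoff : ContDiffBump (0 : ℝ) :=
  ⟨27 / 100, 33 / 100, by norm_num, by norm_num⟩

/-- The function of period `1` which agrees with `g` on `[-1/2, 1/2)`. -/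
noncomputable def periodize (g : ℝ → ℝ) (t : ℝ) : ℝ :=
  g (t - round t)

theorem periodic_periodize (g : ℝ → ℝ) : Function.Periodic (periodize g) 1 := fun t => by
  simp only [periodize, round_add_one, Int.cast_add, Int.cast_one]
  congr 1
  ring

theorem periodize_eq {g : ℝ → ℝ} {t : ℝ} (n : ℤ) (h : |t - n| < 1 / 2) :
    periodize g t = g (t - n) := by
  have : round t = n := by
    rw [round_eq_iff]
    rw [abs_lt] at h
    constructor <;> linarith [h.1, h.2]
  rw [periodize, this]

theorem contDiff_periodize {g : ℝ → ℝ} (hg : ContDiff ℝ ∞ g)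
    (h0 : ∀ t, 33 / 100 ≤ |t| → g t = 0) : ContDiff ℝ ∞ (periodize g) := by
  rw [contDiff_iff_contDiffAt]
  intro t
  by_cases h : |t - round t| < 1 / 2
  · have h1 : periodize g =ᶠ[𝓝 t] fun u => g (u - (round t : ℤ)) := by
      have h2 : IsOpen {u : ℝ | |u - (round t : ℤ)| < 1 / 2} :=
        isOpen_lt (by fun_prop) continuous_const
      filter_upwards [h2.mem_nhds h] with u hu using periodize_eq _ hu
    refine ContDiffAt.congr_of_eventuallyEq ?_ h1
    exact (hg.comp (contDiff_id.sub contDiff_const)).contDiffAt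
  · have h1 : periodize g =ᶠ[𝓝 t] fun _ => 0 := by
      filter_upwards [Metric.ball_mem_nhds t (by norm_num : (0 : ℝ) < 1 / 10)] with u hu
      apply h0
      rw [Metric.mem_ball, Real.dist_eq] at hu
      have h2 := round_le t (round u)
      have h3 : |t - round u| ≤ |t - u| + |u - round u| := abs_sub_le _ _ _
      rw [abs_sub_comm t u] at h3
      push Not at h
      linarith
    exact contDiff_const.contDiffAt.congr_of_eventuallyEq h1

theorem cutoff_eq_zero {t : ℝ} (ht : 33 / 100 ≤ |t|) : cutoff t = 0 :=
  cutoff.zero_of_le_dist (by simpa [cutoff] using ht)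

theorem cutoff_eq_one {t : ℝ} (ht : |t| ≤ 27 / 100) : cutoff t = 1 :=
  cutoff.one_of_mem_closedBall (by simpa [cutoff] using ht)

/-- The horizontal displacement of the first generator, as a function of the ordinate `t`. It is
`3t` for `|t| ≤ 0.27`, it vanishes only at the multiples of `1/2`, and it lies in `(-1, 1)`. -/
noncomputable def horSpeed (t : ℝ) : ℝ :=
  1 / 2 * Real.sin (2 * Real.pi * t) +
    periodize (fun r => cutoff r * (3 * r - 1 / 2 * Real.sin (2 * Real.pi * r))) t

/-- The vertical displacement of the second generator, as a function of the abscissa `t`. It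
represents `3t` modulo `1` for `|t| ≤ 0.27`, and it vanishes at distance at least `0.33` from the
integers. -/
noncomputable def verSpeed (t : ℝ) : ℝ :=
  periodize (fun r => cutoff r * (3 * r + 3)) t

theorem contDiff_horSpeed : ContDiff ℝ ∞ horSpeed := by
  have h1 : ContDiff ℝ ∞ fun r : ℝ => 1 / 2 * Real.sin (2 * Real.pi * r) := by fun_prop
  have h2 : ContDiff ℝ ∞ fun r : ℝ => cutoff r * (3 * r - 1 / 2 * Real.sin (2 * Real.pi * r)) :=
    cutoff.contDiff.mul ((contDiff_const.mul contDiff_id).sub h1)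
  exact h1.add (contDiff_periodize h2 fun t ht => by rw [cutoff_eq_zero ht, zero_mul])

theorem contDiff_verSpeed : ContDiff ℝ ∞ verSpeed := by
  have h2 : ContDiff ℝ ∞ fun r : ℝ => cutoff r * (3 * r + 3) :=
    cutoff.contDiff.mul ((contDiff_const.mul contDiff_id).add contDiff_const)
  exact contDiff_periodize h2 fun t ht => by rw [cutoff_eq_zero ht, zero_mul]

theorem periodic_horSpeed : Function.Periodic horSpeed 1 := fun t => by
  simp only [horSpeed]
  rw [periodic_periodize _ t, show 2 * Real.pi * (t + 1) = 2 * Real.pi * t + 2 * Real.pi by ring,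
    Real.sin_add_two_pi]

theorem periodic_verSpeed : Function.Periodic verSpeed 1 := fun t => by
  simp only [verSpeed]
  rw [periodic_periodize _ t]

theorem horSpeed_eq {t : ℝ} (ht : |t| ≤ 27 / 100) : horSpeed t = 3 * t := by
  have h : |t - (0 : ℤ)| < 1 / 2 := by simp only [Int.cast_zero, sub_zero]; linarith
  simp only [horSpeed, periodize_eq 0 h, Int.cast_zero, sub_zero, cutoff_eq_one ht]
  ring

theorem verSpeed_eq {t : ℝ} (ht : |t| ≤ 27 / 100) : verSpeed t = 3 * t + 3 := by
  have h : |t - (0 : ℤ)| < 1 / 2 := by simp only [Int.cast_zero, sub_zero]; linarith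
  simp only [verSpeed, periodize_eq 0 h, Int.cast_zero, sub_zero, cutoff_eq_one ht, one_mul]

theorem verSpeed_eq_zero {t : ℝ} (h1 : 33 / 100 ≤ t) (h2 : t ≤ 67 / 100) : verSpeed t = 0 := by
  simp only [verSpeed, periodize]
  rw [cutoff_eq_zero, zero_mul]
  rcases le_or_gt (round t) 0 with h | h
  · have : ((round t : ℤ) : ℝ) ≤ 0 := by exact_mod_cast h
    rw [abs_of_nonneg] <;> linarith
  · have : (1 : ℝ) ≤ ((round t : ℤ) : ℝ) := by exact_mod_cast h
    rw [abs_of_nonpos] <;> linarith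

theorem horSpeed_pos_lt {t : ℝ} (h0 : 0 < t) (h1 : t < 1 / 2) : 0 < horSpeed t ∧ horSpeed t < 1 := by
  have h : |t - (0 : ℤ)| < 1 / 2 := by
    simp only [Int.cast_zero, sub_zero]; rwa [abs_of_pos h0]
  simp only [horSpeed, periodize_eq 0 h, Int.cast_zero, sub_zero]
  have hs0 : 0 < Real.sin (2 * Real.pi * t) :=
    Real.sin_pos_of_pos_of_lt_pi (by positivity) (by nlinarith [Real.pi_pos])
  have hs1 := Real.sin_le_one (2 * Real.pi * t)
  set s := Real.sin (2 * Real.pi * t)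
  have hc0 : 0 ≤ cutoff t := cutoff.nonneg
  have hc1 : cutoff t ≤ 1 := cutoff.le_one
  rcases le_or_gt (33 / 100) t with h2 | h2
  · rw [cutoff_eq_zero (by rwa [abs_of_pos h0])]
    constructor <;> linarith
  · constructor
    · rcases hc1.lt_or_eq with h3 | h3
      · nlinarith [mul_pos (sub_pos.2 h3) hs0, mul_nonneg hc0 h0.le]
      · rw [h3]; linarith
    · nlinarith

theorem horSpeed_neg (t : ℝ) (h : |t| < 1 / 2) : horSpeed (-t) = -horSpeed t := by
  have h1 : |t - (0 : ℤ)| < 1 / 2 := by simpa using h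
  have h2 : |-t - (0 : ℤ)| < 1 / 2 := by simpa using h
  have h3 : cutoff (-t) = cutoff t := cutoff.neg t
  simp only [horSpeed, periodize_eq 0 h1, periodize_eq 0 h2, Int.cast_zero, sub_zero, mul_neg,
    Real.sin_neg, h3]
  ring

/-- The horizontal displacement, as a function on the circle. -/
noncomputable def horCircle : UnitAddCircle → ℝ := periodic_horSpeed.lift

/-- The vertical displacement, as a function on the circle. -/
noncomputable def verCircle : UnitAddCircle → ℝ := periodic_verSpeed.lift

@[simp] theorem horCircle_coe (t : ℝ) : horCircle (t : UnitAddCircle) = horSpeed t := rfl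
@[simp] theorem verCircle_coe (t : ℝ) : verCircle (t : UnitAddCircle) = verSpeed t := rfl

theorem continuous_horCircle : Continuous horCircle :=
  (QuotientAddGroup.isQuotientMap_mk (N := AddSubgroup.zmultiples (1 : ℝ))).continuous_iff.2
    contDiff_horSpeed.continuous

theorem continuous_verCircle : Continuous verCircle :=
  (QuotientAddGroup.isQuotientMap_mk (N := AddSubgroup.zmultiples (1 : ℝ))).continuous_iff.2
    contDiff_verSpeed.continuous

/-- The coefficients of the two vertical generators, with the indices `1` and `2`; their ratio is
irrational. -/
noncomputable def verCoeff (j : Fin 3) : ℝ := if j = 1 then 1 else √2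

/-- The isotopies from the identity (`τ = 0`) to the three generators (`τ = 1`) of the holonomy
group: one horizontal and two commuting vertical shears of the torus. -/
noncomputable def isotopy (j : Fin 3) (τ : ℝ) (s : Torus) : Torus :=
  if j = 0 then (s.1 + (τ * horCircle s.2 : ℝ), s.2)
  else (s.1, s.2 + (τ * (verCoeff j * verCircle s.1) : ℝ))

theorem isotopy_zero (j : Fin 3) (s : Torus) : isotopy j 0 s = s := by
  simp [isotopy]

theorem isotopy_add (j : Fin 3) (τ τ' : ℝ) (s : Torus) :
    isotopy j (τ + τ') s = isotopy j τ (isotopy j τ' s) := by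
  simp only [isotopy]
  split_ifs
  · simp only [add_mul, AddCircle.coe_add]
    rw [add_assoc, add_comm (τ' * horCircle s.2 : UnitAddCircle)]
  · simp only [add_mul, AddCircle.coe_add]
    congr 1
    abel

theorem continuous_isotopy (j : Fin 3) : Continuous fun q : ℝ × Torus => isotopy j q.1 q.2 := by
  have h1 := continuous_horCircle
  have h2 := continuous_verCircle
  have h3 : Continuous ((↑) : ℝ → UnitAddCircle) := AddCircle.continuous_mk' 1
  simp only [isotopy]
  split_ifs <;> fun_prop

/-- The covering map from the plane to the torus. -/
noncomputable def toTorus (w : Plane) : Torus := ((w 0 : ℝ), (w 1 : ℝ))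

theorem continuous_toTorus : Continuous toTorus := by
  have h3 : Continuous ((↑) : ℝ → UnitAddCircle) := AddCircle.continuous_mk' 1
  unfold toTorus
  fun_prop

theorem isOpenMap_toTorus : IsOpenMap toTorus := by
  have h : IsOpenMap ((↑) : ℝ → UnitAddCircle) := QuotientAddGroup.isOpenMap_coe
  exact (h.prodMap h).comp
    (((EuclideanSpace.equiv (Fin 2) ℝ).toHomeomorph.trans
      (Homeomorph.finTwoArrow (X := ℝ))).isOpenMap)

theorem toTorus_surjective : Function.Surjective toTorus := by
  rintro ⟨a, b⟩
  obtain ⟨x, rfl⟩ := QuotientAddGroup.mk_surjective a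
  obtain ⟨y, rfl⟩ := QuotientAddGroup.mk_surjective b
  exact ⟨!₂[x, y], rfl⟩

theorem coe_eq_coe_iff {x y : ℝ} : (x : UnitAddCircle) = y ↔ ∃ n : ℤ, x = y + n := by
  rw [QuotientAddGroup.eq, AddSubgroup.mem_zmultiples_iff]
  constructor
  · rintro ⟨n, hn⟩
    refine ⟨-n, ?_⟩
    simp only [zsmul_eq_mul, mul_one] at hn
    push_cast
    linarith
  · rintro ⟨n, hn⟩
    refine ⟨-n, ?_⟩
    simp only [zsmul_eq_mul, mul_one]
    push_cast
    linarith

/-- The fibres of the covering map are the cosets of `ℤ²`. -/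
theorem toTorus_eq_iff {v w : Plane} :
    toTorus v = toTorus w ↔ ∃ n : Fin 2 → ℤ, v = w + WithLp.toLp 2 fun i => (n i : ℝ) := by
  simp only [toTorus, Prod.mk.injEq, coe_eq_coe_iff]
  constructor
  · rintro ⟨⟨a, ha⟩, ⟨b, hb⟩⟩
    refine ⟨![a, b], ?_⟩
    ext i
    fin_cases i
    · simpa using ha
    · simpa using hb
  · rintro ⟨n, rfl⟩
    exact ⟨⟨n 0, by simp⟩, ⟨n 1, by simp⟩⟩

theorem abs_coord_le (w : Plane) (i : Fin 2) : |w i| ≤ ‖w‖ := by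
  simpa using PiLp.norm_apply_le w i

theorem injOn_toTorus (c : Plane) (r : Ioc (0 : ℝ) (1 / 4)) :
    InjOn (fun w : Plane => toTorus (c + (r : ℝ) • w)) (Metric.ball 0 1) := by
  intro v hv w hw h
  rw [mem_ball_zero_iff] at hv hw
  obtain ⟨n, hn⟩ := toTorus_eq_iff.1 h
  obtain ⟨r, hr0, hr1⟩ := r
  have hi : ∀ i, v i = w i := by
    intro i
    have h1 := congrArg (fun u : Plane => u i) hn
    simp only [PiLp.add_apply, PiLp.smul_apply, smul_eq_mul] at h1
    have h2 := abs_lt.1 ((abs_coord_le v i).trans_lt hv)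
    have h3 := abs_lt.1 ((abs_coord_le w i).trans_lt hw)
    have h4 : (-1 : ℝ) < n i := by nlinarith [h2.1, h2.2, h3.1, h3.2]
    have h5 : (n i : ℝ) < 1 := by nlinarith [h2.1, h2.2, h3.1, h3.2]
    have h6 : n i = 0 := by
      have h7 : (-1 : ℤ) < n i := by exact_mod_cast h4
      have h8 : n i < 1 := by exact_mod_cast h5
      omega
    rw [h6] at h1
    simp only [Int.cast_zero] at h1
    exact mul_left_cancel₀ hr0.ne' (by linarith)
  ext i
  exact hi i

/-- The chart of the torus onto the unit disc, with domain the disc of radius `r` around the image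
of `c`. The bound `r ≤ 1/4` ensures that the covering map is injective on the disc. -/
noncomputable def torusChart (c : Plane) (r : Ioc (0 : ℝ) (1 / 4)) :
    OpenPartialHomeomorph Torus Plane :=
  (OpenPartialHomeomorph.ofContinuousOpen
    (InjOn.toPartialEquiv (fun w : Plane => toTorus (c + (r : ℝ) • w)) (Metric.ball 0 1)
      (injOn_toTorus c r))
    (by
      refine Continuous.continuousOn ?_
      exact continuous_toTorus.comp (by fun_prop))
    (by
      refine isOpenMap_toTorus.comp (g := toTorus) ?_
      exact ((Homeomorph.smulOfNeZero (r : ℝ) r.2.1.ne').trans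
        (Homeomorph.addLeft c)).isOpenMap)
    Metric.isOpen_ball).symm

@[simp] theorem torusChart_target (c : Plane) (r : Ioc (0 : ℝ) (1 / 4)) :
    (torusChart c r).target = Metric.ball 0 1 := rfl

@[simp] theorem torusChart_symm_apply (c w : Plane) (r : Ioc (0 : ℝ) (1 / 4)) :
    (torusChart c r).symm w = toTorus (c + (r : ℝ) • w) := rfl

theorem mem_torusChart_source (c : Plane) (r : Ioc (0 : ℝ) (1 / 4)) :
    toTorus c ∈ (torusChart c r).source := by
  have h : (torusChart c r).symm 0 ∈ (torusChart c r).source :=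
    (torusChart c r).map_target (by simp)
  simpa using h

/-- A self-map of the torus with an area preserving smooth lift to the plane. -/
def HasAreaLift (γ : Torus → Torus) : Prop :=
  ∃ g : Plane → Plane, ContDiff ℝ ∞ g ∧ (∀ w, toTorus (g w) = γ (toTorus w)) ∧
    ∀ w, (fderiv ℝ g w).det = 1

theorem HasAreaLift.id : HasAreaLift id :=
  ⟨_root_.id, contDiff_id, fun _ => rfl, fun w => by
    rw [fderiv_id]
    exact LinearMap.det_id⟩

theorem det_fderiv_shear {a b : Fin 2} (hab : a ≠ b) {f : ℝ → ℝ} (hf : ContDiff ℝ ∞ f) (w : Plane) :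
    (fderiv ℝ (fun w : Plane => w + f (w a) • EuclideanSpace.single b (1 : ℝ)) w).det = 1 := by
  have h1 : HasFDerivAt (fun w : Plane => w a)
      (EuclideanSpace.proj a : Plane →L[ℝ] ℝ) w := (EuclideanSpace.proj a : Plane →L[ℝ] ℝ).hasFDerivAt
  have h2 : HasDerivAt f (deriv f (w a)) (w a) :=
    (hf.differentiable (by simp) _).hasDerivAt
  have h3 := (hasFDerivAt_id w).add
    ((h2.comp_hasFDerivAt w h1).smul_const (EuclideanSpace.single b (1 : ℝ)))
  have h4 : fderiv ℝ (fun w : Plane => w + f (w a) • EuclideanSpace.single b (1 : ℝ)) w = _ :=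
    h3.fderiv
  rw [h4]
  have h5 := LinearMap.transvection.det
    (deriv f (w a) • (EuclideanSpace.proj a : Plane →L[ℝ] ℝ) : Plane →L[ℝ] ℝ).toLinearMap
    (EuclideanSpace.single b (1 : ℝ))
  have h6 : ((deriv f (w a) • (EuclideanSpace.proj a : Plane →L[ℝ] ℝ) : Plane →L[ℝ] ℝ).toLinearMap)
    (EuclideanSpace.single b (1 : ℝ)) = 0 := by
    simp [hab]
  rw [h6, add_zero] at h5
  exact h5

theorem HasAreaLift.isotopy (j : Fin 3) (τ : ℝ) : HasAreaLift (isotopy j τ) := by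
  by_cases hj : j = 0
  · have hf : ContDiff ℝ ∞ fun t => τ * horSpeed t := contDiff_const.mul contDiff_horSpeed
    refine ⟨fun w => w + (τ * horSpeed (w 1)) • EuclideanSpace.single 0 (1 : ℝ), ?_, ?_,
      det_fderiv_shear (by decide) hf⟩
    · have h1 : ContDiff ℝ ∞ fun w : Plane => w 1 := by fun_prop
      exact contDiff_id.add ((hf.comp h1).smul contDiff_const)
    · intro w
      simp [toTorus, _root_.isotopy, hj]
  · have hf : ContDiff ℝ ∞ fun t => τ * (verCoeff j * verSpeed t) :=
      contDiff_const.mul (contDiff_const.mul contDiff_verSpeed)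
    refine ⟨fun w => w + (τ * (verCoeff j * verSpeed (w 0))) • EuclideanSpace.single 1 (1 : ℝ),
      ?_, ?_, det_fderiv_shear (by decide) hf⟩
    · have h1 : ContDiff ℝ ∞ fun w : Plane => w 0 := by fun_prop
      exact contDiff_id.add ((hf.comp h1).smul contDiff_const)
    · intro w
      simp [toTorus, _root_.isotopy, hj]

/-- Read in two charts of the torus, a map with a lift is locally the lift followed by a
translation. -/
theorem torusChart_comp_eventuallyEq {γ : Torus → Torus} {g : Plane → Plane}
    (hg : ContDiff ℝ ∞ g) (hγ : ∀ w, toTorus (g w) = γ (toTorus w)) (c c' : Plane)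
    (r r' : Ioc (0 : ℝ) (1 / 4)) {w₀ : Plane}
    (hw₀ : γ ((torusChart c r).symm w₀) ∈ (torusChart c' r').source) :
    ∃ d : Plane, (fun w => torusChart c' r' (γ ((torusChart c r).symm w))) =ᶠ[𝓝 w₀]
      fun w => (r' : ℝ)⁻¹ • (g (c + (r : ℝ) • w) + d) := by
  set y₀ := torusChart c' r' (γ ((torusChart c r).symm w₀)) with hy₀
  have hy : y₀ ∈ Metric.ball (0 : Plane) 1 := (torusChart c' r').map_source hw₀
  have h1 : toTorus (c' + (r' : ℝ) • y₀) = toTorus (g (c + (r : ℝ) • w₀)) := by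
    rw [hγ, ← torusChart_symm_apply c' _ r', ← torusChart_symm_apply c _ r, hy₀,
      (torusChart c' r').left_inv hw₀]
  obtain ⟨n, hn⟩ := toTorus_eq_iff.1 h1
  set N : Plane := WithLp.toLp 2 fun i => (n i : ℝ)
  let F : Plane → Plane := fun w => (r' : ℝ)⁻¹ • (g (c + (r : ℝ) • w) + (N - c'))
  have hF : Continuous F := by
    have := hg.continuous
    fun_prop
  have hF0 : F w₀ = y₀ := by
    simp only [F]
    rw [← add_sub_assoc, ← hn, add_sub_cancel_left, smul_smul, inv_mul_cancel₀ r'.2.1.ne', one_smul]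
  refine ⟨N - c', ?_⟩
  have h2 : ∀ᶠ w in 𝓝 w₀, F w ∈ Metric.ball (0 : Plane) 1 :=
    hF.continuousAt.eventually_mem (Metric.isOpen_ball.mem_nhds (by rwa [hF0]))
  filter_upwards [h2] with w hw
  have h3 : (torusChart c' r').symm (F w) = γ ((torusChart c r).symm w) := by
    rw [torusChart_symm_apply, torusChart_symm_apply, ← hγ, toTorus_eq_iff]
    refine ⟨n, ?_⟩
    simp only [F, smul_smul, mul_inv_cancel₀ r'.2.1.ne', one_smul]
    change _ = _ + N
    abel
  rw [← h3]
  exact (torusChart c' r').right_inv hw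

theorem HasAreaLift.contDiffAt {γ : Torus → Torus} (h : HasAreaLift γ) (c c' : Plane)
    (r r' : Ioc (0 : ℝ) (1 / 4)) {w₀ : Plane}
    (hw₀ : γ ((torusChart c r).symm w₀) ∈ (torusChart c' r').source) :
    ContDiffAt ℝ ∞ (fun w => torusChart c' r' (γ ((torusChart c r).symm w))) w₀ := by
  obtain ⟨g, hg, hγ, -⟩ := h
  obtain ⟨d, hd⟩ := torusChart_comp_eventuallyEq hg hγ c c' r r' hw₀
  refine ContDiffAt.congr_of_eventuallyEq ?_ hd
  apply ContDiff.contDiffAt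
  fun_prop

theorem HasAreaLift.det_fderiv {γ : Torus → Torus} (h : HasAreaLift γ) (c c' : Plane)
    (r : Ioc (0 : ℝ) (1 / 4)) {w₀ : Plane}
    (hw₀ : γ ((torusChart c r).symm w₀) ∈ (torusChart c' r).source) :
    (fderiv ℝ (fun w => torusChart c' r (γ ((torusChart c r).symm w))) w₀).det = 1 := by
  obtain ⟨g, hg, hγ, hdet⟩ := h
  obtain ⟨d, hd⟩ := torusChart_comp_eventuallyEq hg hγ c c' r r hw₀
  rw [hd.fderiv_eq]
  have h1 : HasFDerivAt (fun w : Plane => c + (r : ℝ) • w)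
      ((r : ℝ) • ContinuousLinearMap.id ℝ Plane) w₀ :=
    ((hasFDerivAt_id w₀).const_smul (r : ℝ)).const_add c
  have h2 := (((hg.differentiable (by simp) (c + (r : ℝ) • w₀)).hasFDerivAt.comp w₀
    h1).add_const d).const_smul (r : ℝ)⁻¹
  have h3 : fderiv ℝ (fun w => (r : ℝ)⁻¹ • (g (c + (r : ℝ) • w) + d)) w₀ =
      fderiv ℝ g (c + (r : ℝ) • w₀) := by
    rw [show (fun w => (r : ℝ)⁻¹ • (g (c + (r : ℝ) • w) + d)) =
      fun w => (r : ℝ)⁻¹ • ((g ∘ fun w => c + (r : ℝ) • w) w + d) from rfl]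
    refine h2.fderiv.trans ?_
    ext1 v
    simp [smul_smul, inv_mul_cancel₀ r.2.1.ne']
  rw [h3, hdet]

/-! ### The suspension and its foliated charts -/

/-- The parameter of the isotopies across the interior collars. It is `0` on the zone of the lower
sheet and `1` on the zone of the upper sheet. -/
noncomputable def ramp (p : BaseSurface) : ℝ := max 0 (min 1 (4 * p.1.2.2))

theorem continuous_ramp : Continuous ramp := by
  unfold ramp
  fun_prop

theorem ramp_of_down {p : BaseSurface} (h : p.1.2.2 < 0) : ramp p = 0 := by
  rw [ramp, max_eq_left]
  exact (min_le_right _ _).trans (by linarith)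

theorem ramp_of_up {p : BaseSurface} (h : 1 / 4 < p.1.2.2) : ramp p = 1 := by
  rw [ramp, min_eq_left (by linarith), max_eq_right zero_le_one]

/-- The trivialization of the suspension over a zone is given by the identity, except over the
interior collars, where the isotopies are used. -/
noncomputable def Zone.twist : Zone → ℝ → Torus → Torus
  | .inn j => isotopy j
  | _ => fun _ => id

theorem Zone.twist_zero (k : Zone) (s : Torus) : k.twist 0 s = s := by
  cases k with
  | inn j => exact isotopy_zero j s
  | _ => rfl

theorem Zone.twist_add (k : Zone) (τ τ' : ℝ) (s : Torus) :
    k.twist (τ + τ') s = k.twist τ (k.twist τ' s) := by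
  cases k with
  | inn j => exact isotopy_add j τ τ' s
  | _ => rfl

theorem Zone.twist_neg_twist (k : Zone) (τ : ℝ) (s : Torus) : k.twist (-τ) (k.twist τ s) = s := by
  rw [← Zone.twist_add, neg_add_cancel, Zone.twist_zero]

theorem Zone.twist_twist_neg (k : Zone) (τ : ℝ) (s : Torus) : k.twist τ (k.twist (-τ) s) = s := by
  rw [← Zone.twist_add, add_neg_cancel, Zone.twist_zero]

theorem Zone.continuous_twist (k : Zone) : Continuous fun q : ℝ × Torus => k.twist q.1 q.2 := by
  cases k with
  | inn j => exact continuous_isotopy j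
  | _ => exact continuous_snd

/-- The holonomy from the trivialization over the zone `k` to the one over the zone `l`. It is the
identity for the pairs of distinct zones that do not meet. -/
noncomputable def Zone.holonomy : Zone → Zone → Torus → Torus
  | .up, .inn j => isotopy j 1
  | .inn j, .up => isotopy j (-1)
  | _, _ => id

theorem Zone.hasAreaLift_holonomy (k l : Zone) : HasAreaLift (k.holonomy l) := by
  unfold Zone.holonomy
  split
  · exact HasAreaLift.isotopy _ _
  · exact HasAreaLift.isotopy _ _
  · exact HasAreaLift.id

theorem lobe_disjoint {i j : Fin 3} {x : ℝ} (hi : x ∈ lobe i) (hj : x ∈ lobe j) : i = j := by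
  fin_cases i <;> fin_cases j <;>
    simp only [lobe, mem_Iio, mem_Ioi, mem_Ioo, Fin.reduceFinMk, Fin.zero_eta, Fin.mk_one] at * <;>
    first | rfl | (exfalso; linarith [hi.1]) | (exfalso; linarith [hj.1]) |
      (exfalso; linarith)

/-- The trivializations over two zones differ by a locally constant map, which makes the foliations
given by their second coordinates agree. -/
theorem Zone.twist_eq_holonomy {k l : Zone} {p : BaseSurface}
    (hk : (p : ℝ × ℝ × ℝ) ∈ k.carrier) (hl : (p : ℝ × ℝ × ℝ) ∈ l.carrier) (s : Torus) :
    l.twist (ramp p) s = k.holonomy l (k.twist (ramp p) s) := by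
  cases k with
  | inn i =>
    cases l with
    | inn j =>
      obtain rfl := lobe_disjoint hk.2 hl.2
      rfl
    | up =>
      simp only [Zone.twist, Zone.holonomy, ramp_of_up hl, ← isotopy_add, neg_add_cancel,
        isotopy_zero, id]
    | down =>
      simp only [Zone.twist, Zone.holonomy, ramp_of_down hl, isotopy_zero, id]
    | out => exact absurd (lt_trans hk.1 hl) (lt_irrefl _)
  | up =>
    cases l with
    | inn j => simp only [Zone.twist, Zone.holonomy, ramp_of_up hk, id]
    | _ => rfl
  | down =>
    cases l with
    | inn j => simp only [Zone.twist, Zone.holonomy, ramp_of_down hk, isotopy_zero, id]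
    | _ => rfl
  | out =>
    cases l with
    | inn j => exact absurd (lt_trans hl.1 hk) (lt_irrefl _)
    | _ => rfl

/-- The total space of the suspension. Its smooth structure is not the product structure: it is
defined by the foliated charts. -/
abbrev Suspension : Type := BaseSurface × Torus

/-- The trivialization over a zone, extended to the whole total space. -/
noncomputable def Zone.twistHomeomorph (k : Zone) : Suspension ≃ₜ Suspension where
  toFun q := (q.1, k.twist (ramp q.1) q.2)
  invFun q := (q.1, k.twist (-ramp q.1) q.2)
  left_inv q := by simp only [Zone.twist_neg_twist]
  right_inv q := by simp only [Zone.twist_twist_neg]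
  continuous_toFun := by
    have := continuous_ramp
    exact continuous_fst.prodMk (k.continuous_twist.comp (f := fun q : Suspension =>
      (ramp q.1, q.2)) (by fun_prop))
  continuous_invFun := by
    have := continuous_ramp
    exact continuous_fst.prodMk (k.continuous_twist.comp (f := fun q : Suspension =>
      (-ramp q.1, q.2)) (by fun_prop))

/-- A smooth chart of the base, onto the unit disc, with domain contained in a zone. Smoothness is
expressed in terms of the ambient space `ℝ³`. -/
structure BaseChart where
  zone : Zone
  chart : OpenPartialHomeomorph BaseSurface Plane
  target_eq : chart.target = Metric.ball 0 1
  mem_zone : ∀ p ∈ chart.source, (p : ℝ × ℝ × ℝ) ∈ zone.carrier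
  exists_smooth : ∃ A : ℝ × ℝ × ℝ → Plane, ContDiff ℝ ∞ A ∧ ∀ p : BaseSurface, chart p = A p
  exists_smooth_symm : ∃ σ : Plane → ℝ × ℝ × ℝ, ContDiffOn ℝ ∞ σ (Metric.ball 0 1) ∧
    ∀ u ∈ Metric.ball (0 : Plane) 1, (chart.symm u : ℝ × ℝ × ℝ) = σ u

theorem exists_baseChart (p : BaseSurface) :
    ∃ b : BaseChart, p ∈ b.chart.source ∧ b.chart p = 0 := by
  obtain ⟨k, hk⟩ := Zone.exists_mem p
  obtain ⟨κ, A, σ, h1, h2, h3, h4, h5, h6, h7, h8⟩ :=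
    exists_levelSet_chart (E := ℝ × ℝ × ℝ) (G := Plane) (by simp)
      contDiff_baseFun p (fderiv_baseFun_ne_zero p) k.isOpen_carrier hk
  exact ⟨⟨k, κ, h3, h4, ⟨A, h5, h6⟩, ⟨σ, h7, h8⟩⟩, h1, h2⟩

/-- The homothety of ratio `2` from the disc of radius `1/2` onto the unit disc. -/
noncomputable def doubling : OpenPartialHomeomorph Plane Plane where
  toFun u := (2 : ℝ) • u
  invFun u := (1 / 2 : ℝ) • u
  source := Metric.ball 0 (1 / 2)
  target := Metric.ball 0 1
  map_source' u hu := by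
    rw [mem_ball_zero_iff] at hu ⊢
    rw [norm_smul, Real.norm_of_nonneg zero_le_two]
    linarith
  map_target' u hu := by
    rw [mem_ball_zero_iff] at hu ⊢
    rw [norm_smul, Real.norm_of_nonneg (by norm_num)]
    linarith
  left_inv' u _ := by simp [smul_smul]
  right_inv' u _ := by simp [smul_smul]
  open_source := Metric.isOpen_ball
  open_target := Metric.isOpen_ball
  continuousOn_toFun := by fun_prop
  continuousOn_invFun := by fun_prop

/-- The restriction of a chart to the concentric disc of half the radius. -/
noncomputable def BaseChart.half (b : BaseChart) : BaseChart where
  zone := b.zone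
  chart := b.chart.trans doubling
  target_eq := by
    rw [OpenPartialHomeomorph.trans_target]
    refine inter_eq_left.2 ?_
    · intro u hu
      rw [mem_preimage, b.target_eq]
      exact Metric.ball_subset_ball (by norm_num) (doubling.map_target hu)
  mem_zone p hp := b.mem_zone p hp.1
  exists_smooth := by
    obtain ⟨A, hA, h⟩ := b.exists_smooth
    exact ⟨fun p => (2 : ℝ) • A p, hA.const_smul _, fun p => congrArg ((2 : ℝ) • ·) (h p)⟩
  exists_smooth_symm := by
    obtain ⟨σ, hσ, h⟩ := b.exists_smooth_symm
    have hm : ∀ u ∈ Metric.ball (0 : Plane) 1, (1 / 2 : ℝ) • u ∈ Metric.ball (0 : Plane) 1 :=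
      fun u hu => Metric.ball_subset_ball (by norm_num) (doubling.map_target hu)
    exact ⟨fun u => σ ((1 / 2 : ℝ) • u), hσ.comp (by fun_prop) hm, fun u hu => h _ (hm u hu)⟩

/-- The chart of the suspension given by a chart of the base and a disc in the fibre. -/
noncomputable def foliatedChart (b : BaseChart) (c : Plane) (r : Ioc (0 : ℝ) (1 / 4)) :
    OpenPartialHomeomorph Suspension (Plane × Plane) :=
  b.zone.twistHomeomorph.toOpenPartialHomeomorph.trans (b.chart.prod (torusChart c r))

section FoliatedChart

variable (b : BaseChart) (c : Plane) (r : Ioc (0 : ℝ) (1 / 4))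

theorem foliatedChart_target :
    (foliatedChart b c r).target = Metric.ball 0 1 ×ˢ Metric.ball 0 1 := by
  rw [foliatedChart, OpenPartialHomeomorph.trans_target]
  simp [b.target_eq]

theorem mem_foliatedChart_source {q : Suspension} : q ∈ (foliatedChart b c r).source ↔
    q.1 ∈ b.chart.source ∧ b.zone.twist (ramp q.1) q.2 ∈ (torusChart c r).source := by
  rw [foliatedChart, OpenPartialHomeomorph.trans_source]
  simp only [OpenPartialHomeomorph.prod_source, Homeomorph.toOpenPartialHomeomorph_source,
    univ_inter]
  rfl

theorem foliatedChart_apply (q : Suspension) : foliatedChart b c r q =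
    (b.chart q.1, torusChart c r (b.zone.twist (ramp q.1) q.2)) := rfl

theorem foliatedChart_symm_apply (v : Plane × Plane) : (foliatedChart b c r).symm v =
    (b.chart.symm v.1, b.zone.twist (-ramp (b.chart.symm v.1)) (toTorus (c + (r : ℝ) • v.2))) :=
  rfl

theorem toTorus_foliatedChart {q : Suspension} (hq : q ∈ (foliatedChart b c r).source) :
    toTorus (c + (r : ℝ) • (foliatedChart b c r q).2) = b.zone.twist (ramp q.1) q.2 := by
  rw [foliatedChart_apply, ← torusChart_symm_apply]
  exact (torusChart c r).left_inv ((mem_foliatedChart_source b c r).1 hq).2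

theorem mem_foliatedChart_source_of {p : BaseSurface} (hp : p ∈ b.chart.source) {w : Plane}
    (hw : w ∈ Metric.ball (0 : Plane) 1) {s : Torus}
    (hs : b.zone.twist (ramp p) s = toTorus (c + (r : ℝ) • w)) :
    (p, s) ∈ (foliatedChart b c r).source ∧ (foliatedChart b c r (p, s)).2 = w := by
  have h1 : toTorus (c + (r : ℝ) • w) = (torusChart c r).symm w := rfl
  rw [mem_foliatedChart_source, foliatedChart_apply]
  simp only [hs, h1]
  exact ⟨⟨hp, (torusChart c r).map_target hw⟩, (torusChart c r).right_inv hw⟩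

end FoliatedChart

/-- The change of the transverse coordinate between two foliated charts is given by the holonomy
between their zones. -/
theorem foliatedChart_snd (b b' : BaseChart) (c c' : Plane) (r r' : Ioc (0 : ℝ) (1 / 4))
    {q : Suspension} (hq : q ∈ (foliatedChart b c r).source)
    (hq' : q ∈ (foliatedChart b' c' r').source) :
    (foliatedChart b' c' r' q).2 =
      torusChart c' r' (b.zone.holonomy b'.zone ((torusChart c r).symm (foliatedChart b c r q).2)) := by
  rw [torusChart_symm_apply, toTorus_foliatedChart b c r hq, foliatedChart_apply]
  rw [Zone.twist_eq_holonomy (b.mem_zone _ ((mem_foliatedChart_source b c r).1 hq).1)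
    (b'.mem_zone _ ((mem_foliatedChart_source b' c' r').1 hq').1)]

theorem holonomy_mem_source (b b' : BaseChart) (c c' : Plane) (r r' : Ioc (0 : ℝ) (1 / 4))
    {q : Suspension} (hq : q ∈ (foliatedChart b c r).source)
    (hq' : q ∈ (foliatedChart b' c' r').source) :
    b.zone.holonomy b'.zone ((torusChart c r).symm (foliatedChart b c r q).2) ∈
      (torusChart c' r').source := by
  rw [torusChart_symm_apply, toTorus_foliatedChart b c r hq]
  rw [← Zone.twist_eq_holonomy (b.mem_zone _ ((mem_foliatedChart_source b c r).1 hq).1)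
    (b'.mem_zone _ ((mem_foliatedChart_source b' c' r').1 hq').1)]
  exact ((mem_foliatedChart_source b' c' r').1 hq').2

theorem contDiffOn_foliatedChart_transition (b b' : BaseChart) (c c' : Plane)
    (r r' : Ioc (0 : ℝ) (1 / 4)) :
    ContDiffOn ℝ ∞ (fun v => foliatedChart b' c' r' ((foliatedChart b c r).symm v))
      ((foliatedChart b c r).symm.trans (foliatedChart b' c' r')).source := by
  rintro ⟨u, w⟩ ⟨hv1, hv2⟩
  set e := foliatedChart b c r
  set e' := foliatedChart b' c' r'
  replace hv1 : (u, w) ∈ e.target := hv1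
  have ho := ((foliatedChart b c r).symm.trans (foliatedChart b' c' r')).open_source
  have hu : u ∈ Metric.ball (0 : Plane) 1 := by
    rw [foliatedChart_target] at hv1
    exact hv1.1
  obtain ⟨A, hA, hbA⟩ := b'.exists_smooth
  obtain ⟨σ, hσ, hbσ⟩ := b.exists_smooth_symm
  have h1 : ContDiffAt ℝ ∞ (fun v : Plane × Plane => A (σ v.1)) (u, w) :=
    hA.contDiffAt.comp _ (ContDiffAt.comp (u, w)
      ((hσ u hu).contDiffAt (Metric.isOpen_ball.mem_nhds hu)) contDiffAt_fst)
  have hm := holonomy_mem_source b b' c c' r r' (e.map_target hv1) hv2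
  rw [e.right_inv hv1] at hm
  have h2 : ContDiffAt ℝ ∞ (fun v : Plane × Plane =>
      torusChart c' r' (b.zone.holonomy b'.zone ((torusChart c r).symm v.2))) (u, w) :=
    ContDiffAt.comp (g := fun w => torusChart c' r' (b.zone.holonomy b'.zone
      ((torusChart c r).symm w))) (u, w)
      ((b.zone.hasAreaLift_holonomy b'.zone).contDiffAt c c' r r' hm) contDiffAt_snd
  refine ((h1.prodMk h2).congr_of_eventuallyEq ?_).contDiffWithinAt
  filter_upwards [ho.mem_nhds ⟨hv1, hv2⟩] with v hv
  have hv3 : v ∈ e.target := hv.1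
  refine Prod.ext ?_ ?_
  · have hu' : v.1 ∈ Metric.ball (0 : Plane) 1 := by
      rw [foliatedChart_target] at hv3
      exact hv3.1
    rw [foliatedChart_apply]
    simp only [hbA, e, foliatedChart_symm_apply, hbσ _ hu']
  · have h3 := foliatedChart_snd b b' c c' r r' (e.map_target hv3) hv.2
    rw [e.right_inv hv3] at h3
    exact h3

/-- A linear identification of the product of two planes with the model space of `4`-manifolds. -/
noncomputable def planeProdEquiv : (Plane × Plane) ≃L[ℝ] EuclideanSpace ℝ (Fin 4) :=
  ContinuousLinearEquiv.ofFinrankEq (by simp)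

/-- The smooth structure of the suspension has all the foliated charts as an atlas. -/
noncomputable instance : ChartedSpace (EuclideanSpace ℝ (Fin 4)) Suspension where
  atlas := {e | ∃ b c r, e = (foliatedChart b c r).trans
    planeProdEquiv.toHomeomorph.toOpenPartialHomeomorph}
  chartAt q := (foliatedChart (exists_baseChart q.1).choose
    (toTorus_surjective ((exists_baseChart q.1).choose.zone.twist (ramp q.1) q.2)).choose
    ⟨1 / 4, by norm_num, le_rfl⟩).trans planeProdEquiv.toHomeomorph.toOpenPartialHomeomorph
  mem_chart_source q := by
    rw [OpenPartialHomeomorph.trans_source]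
    refine ⟨?_, mem_univ _⟩
    rw [mem_foliatedChart_source]
    refine ⟨(exists_baseChart q.1).choose_spec.1, ?_⟩
    have h := (toTorus_surjective
      ((exists_baseChart q.1).choose.zone.twist (ramp q.1) q.2)).choose_spec
    have h2 := mem_torusChart_source (toTorus_surjective
      ((exists_baseChart q.1).choose.zone.twist (ramp q.1) q.2)).choose ⟨1 / 4, by norm_num, le_rfl⟩
    rwa [h] at h2
  chart_mem_atlas q := ⟨_, _, _, rfl⟩

instance : IsManifold (𝓡 4) ∞ Suspension := by
  refine isManifold_of_contDiffOn _ _ _ ?_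
  rintro _ _ ⟨b, c, r, rfl⟩ ⟨b', c', r', rfl⟩
  simp only [modelWithCornersSelf_coe, modelWithCornersSelf_coe_symm, Function.comp_id,
    Function.id_comp, preimage_id, range_id, inter_univ]
  have h := contDiffOn_foliatedChart_transition b b' c c' r r'
  refine (planeProdEquiv.contDiff.comp_contDiffOn (h.comp
    planeProdEquiv.symm.contDiff.contDiffOn (s := _) ?_))
  rintro v ⟨⟨-, hv1⟩, ⟨hv2, -⟩⟩
  exact ⟨hv1, hv2⟩

theorem isSmoothProductChart_foliatedChart (b : BaseChart) (c : Plane) (r : Ioc (0 : ℝ) (1 / 4)) :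
    IsSmoothProductChart 4 (foliatedChart b c r) := by
  set e := (foliatedChart b c r).trans planeProdEquiv.toHomeomorph.toOpenPartialHomeomorph with he
  have hmem : e ∈ IsManifold.maximalAtlas (𝓡 4) ∞ Suspension :=
    IsManifold.subset_maximalAtlas ⟨b, c, r, rfl⟩
  have hs : e.source = (foliatedChart b c r).source := by
    rw [he, OpenPartialHomeomorph.trans_source]
    simp
  refine ⟨foliatedChart_target b c r, ?_, ?_⟩
  · have h1 := contMDiffOn_of_mem_maximalAtlas hmem
    rw [hs] at h1
    have h2 := (planeProdEquiv.symm.contDiff (n := ∞)).contMDiff.comp_contMDiffOn h1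
    refine h2.congr fun q _ => ?_
    exact (planeProdEquiv.symm_apply_apply _).symm
  · have h1 := contMDiffOn_symm_of_mem_maximalAtlas hmem
    have h2 := h1.comp ((planeProdEquiv.contDiff (n := ∞)).contMDiff.contMDiffOn
      (s := (foliatedChart b c r).target)) (fun v hv => by
        rw [he, OpenPartialHomeomorph.trans_target]
        refine ⟨mem_univ _, ?_⟩
        change planeProdEquiv.symm (planeProdEquiv v) ∈ (foliatedChart b c r).target
        rwa [planeProdEquiv.symm_apply_apply])
    refine h2.congr fun v _ => ?_
    change _ = (foliatedChart b c r).symm (planeProdEquiv.symm (planeProdEquiv v))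
    rw [planeProdEquiv.symm_apply_apply]

theorem foliatedChart_snd_eq_iff (b b' : BaseChart) (c c' : Plane) (r r' : Ioc (0 : ℝ) (1 / 4))
    {x y : Suspension} (hx : x ∈ (foliatedChart b c r).source)
    (hx' : x ∈ (foliatedChart b' c' r').source) (hy : y ∈ (foliatedChart b c r).source)
    (hy' : y ∈ (foliatedChart b' c' r').source) :
    (foliatedChart b c r x).2 = (foliatedChart b c r y).2 ↔
      (foliatedChart b' c' r' x).2 = (foliatedChart b' c' r' y).2 := by
  constructor
  · intro h
    rw [foliatedChart_snd b b' c c' r r' hx hx', foliatedChart_snd b b' c c' r r' hy hy', h]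
  · intro h
    rw [foliatedChart_snd b' b c' c r' r hx' hx, foliatedChart_snd b' b c' c r' r hy' hy, h]

theorem sameLocalPlaques_foliatedChart (b b' : BaseChart) (c c' : Plane)
    (r r' : Ioc (0 : ℝ) (1 / 4)) :
    SameLocalPlaques (foliatedChart b c r) (foliatedChart b' c' r') := by
  intro x hx
  refine ⟨(foliatedChart b c r).source ∩ (foliatedChart b' c' r').source,
    ((foliatedChart b c r).open_source.inter (foliatedChart b' c' r').open_source).mem_nhds hx, ?_⟩
  intro y hy z hz
  exact foliatedChart_snd_eq_iff b b' c c' r r' hy.1 hy.2 hz.1 hz.2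

/-! ### The foliation and its transverse volume -/

/-- The radius of the discs of the fibre which are used in the foliated atlas. -/
noncomputable def fibreRadius : Ioc (0 : ℝ) (1 / 4) := ⟨1 / 8, by norm_num, by norm_num⟩

/-- The radius of the larger discs, which contain the closures of the previous ones. -/
noncomputable def bigRadius : Ioc (0 : ℝ) (1 / 4) := ⟨1 / 4, by norm_num, le_rfl⟩

theorem closure_foliatedChart_half_subset (b : BaseChart) (c : Plane) :
    closure (foliatedChart b.half c fibreRadius).source ⊆ (foliatedChart b c bigRadius).source := by
  set e := foliatedChart b c bigRadius with he
  set K : Set (Plane × Plane) := Metric.closedBall 0 (1 / 2) ×ˢ Metric.closedBall 0 (1 / 2) with hK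
  have hKt : K ⊆ e.target := by
    rw [he, foliatedChart_target]
    exact prod_mono (Metric.closedBall_subset_ball (by norm_num))
      (Metric.closedBall_subset_ball (by norm_num))
  have hKc : IsCompact K := (isCompact_closedBall _ _).prod (isCompact_closedBall _ _)
  have h1 : IsClosed (e.symm '' K) :=
    (hKc.image_of_continuousOn (e.continuousOn_symm.mono hKt)).isClosed
  have h2 : (foliatedChart b.half c fibreRadius).source ⊆ e.symm '' K := by
    rintro ⟨p, s⟩ hq
    have hp := ((mem_foliatedChart_source _ _ _).1 hq).1
    have hw : (foliatedChart b.half c fibreRadius (p, s)).2 ∈ Metric.ball (0 : Plane) 1 := by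
      have h3 := (foliatedChart b.half c fibreRadius).map_source hq
      rw [foliatedChart_target] at h3
      exact h3.2
    set w := (foliatedChart b.half c fibreRadius (p, s)).2 with hwd
    have h4 : b.zone.twist (ramp p) s = toTorus (c + (1 / 8 : ℝ) • w) :=
      (toTorus_foliatedChart b.half c fibreRadius hq).symm
    have h5 : (1 / 2 : ℝ) • w ∈ Metric.ball (0 : Plane) (1 / 2) := by
      rw [mem_ball_zero_iff] at hw ⊢
      rw [norm_smul, Real.norm_of_nonneg (by norm_num)]
      linarith
    obtain ⟨h6, h7⟩ := mem_foliatedChart_source_of b c bigRadius hp.1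
      (Metric.ball_subset_ball (by norm_num) h5) (s := s) (by
        rw [h4, smul_smul]
        norm_num [bigRadius])
    refine ⟨e (p, s), ⟨?_, ?_⟩, e.left_inv h6⟩
    · exact Metric.ball_subset_closedBall hp.2
    · rw [he, h7]
      exact Metric.ball_subset_closedBall h5
  refine (closure_minimal h2 h1).trans ?_
  rintro _ ⟨v, hv, rfl⟩
  exact e.map_target (hKt hv)

/-- The foliation of the suspension given by a covering by foliated charts. -/
noncomputable def suspensionFoliation {n : ℕ} (b : Fin n → BaseChart) (c : Fin n → Plane)
    (hcover : ∀ q, ∃ i, q ∈ (foliatedChart (b i).half (c i) fibreRadius).source) :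
    SmoothFoliation 4 2 2 Suspension where
  n := n
  chart i := foliatedChart (b i).half (c i) fibreRadius
  smooth_chart _ := isSmoothProductChart_foliatedChart _ _ _
  cover := hcover
  plaque_unique _ _ _ hx _ hy := (foliatedChart_snd_eq_iff _ _ _ _ _ _ hx.1 hx.2 hy.1 hy.2).1
  closure_subset i := ⟨foliatedChart (b i) (c i) bigRadius,
    isSmoothProductChart_foliatedChart _ _ _, fun _ => sameLocalPlaques_foliatedChart _ _ _ _ _ _,
    closure_foliatedChart_half_subset _ _⟩

theorem exists_finite_cover : ∃ (n : ℕ) (b : Fin n → BaseChart) (c : Fin n → Plane),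
    ∀ q, ∃ i, q ∈ (foliatedChart (b i).half (c i) fibreRadius).source := by
  have h : ∀ q : Suspension, ∃ b c, q ∈ (foliatedChart (BaseChart.half b) c fibreRadius).source := by
    intro q
    obtain ⟨b, hb, hb0⟩ := exists_baseChart q.1
    obtain ⟨c, hc⟩ := toTorus_surjective (b.zone.twist (ramp q.1) q.2)
    refine ⟨b, c, (mem_foliatedChart_source _ _ _).2 ⟨⟨hb, ?_⟩, ?_⟩⟩
    · change b.chart q.1 ∈ Metric.ball 0 (1 / 2)
      rw [hb0]
      exact Metric.mem_ball_self (by norm_num)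
    · change b.zone.twist (ramp q.1) q.2 ∈ _
      rw [← hc]
      exact mem_torusChart_source _ _
  choose b c hbc using h
  obtain ⟨t, ht⟩ := CompactSpace.elim_nhds_subcover
    (fun q => (foliatedChart (b q).half (c q) fibreRadius).source)
    (fun q => (foliatedChart (b q).half (c q) fibreRadius).open_source.mem_nhds (hbc q))
  refine ⟨t.card, fun i => b (t.equivFin.symm i), fun i => c (t.equivFin.symm i), fun q => ?_⟩
  have hq : q ∈ ⋃ x ∈ t, (foliatedChart (b x).half (c x) fibreRadius).source := by
    rw [ht]; trivial
  simp only [mem_iUnion] at hq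
  obtain ⟨x, hx, hq⟩ := hq
  refine ⟨t.equivFin ⟨x, hx⟩, ?_⟩
  simpa using hq

section Foliation

variable {n : ℕ} {b : Fin n → BaseChart} {c : Fin n → Plane}
  (hcover : ∀ q, ∃ i, q ∈ (foliatedChart (b i).half (c i) fibreRadius).source)

/-- The form `dy₁ ∧ dy₂` on all the discs. It is invariant, since the holonomy maps are area preserving
and all the discs have the same radius. -/
noncomputable def suspensionVolume : (suspensionFoliation b c hcover).InvariantVolume where
  density _ _ := 1
  smooth _ := contDiffOn_const
  ne_zero _ _ _ := one_ne_zero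
  invariant i j x hx := by
    rw [one_mul]
    obtain ⟨hx1, hx2⟩ := hx
    replace hx1 : x ∈ (foliatedChart (b i).half (c i) fibreRadius).source := hx1
    replace hx2 : x ∈ (foliatedChart (b j).half (c j) fibreRadius).source := hx2
    change (fderiv ℝ (fun y => (foliatedChart (b j).half (c j) fibreRadius
      ((foliatedChart (b i).half (c i) fibreRadius).symm
        ((foliatedChart (b i).half (c i) fibreRadius x).1, y))).2)
        (foliatedChart (b i).half (c i) fibreRadius x).2).det = 1
    set e := foliatedChart (b i).half (c i) fibreRadius with he
    set e' := foliatedChart (b j).half (c j) fibreRadius with he'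
    have hm := holonomy_mem_source (b i).half (b j).half (c i) (c j) fibreRadius fibreRadius hx1 hx2
    refine Eq.trans ?_ (((b i).half.zone.hasAreaLift_holonomy (b j).half.zone).det_fderiv
      (c i) (c j) fibreRadius hm)
    refine congrArg ContinuousLinearMap.det (Filter.EventuallyEq.fderiv_eq ?_)
    have ho := (e.symm.trans e').open_source
    have hmem : ((e x).1, (e x).2) ∈ (e.symm.trans e').source := by
      refine ⟨e.map_source hx1, ?_⟩
      change e.symm (e x) ∈ e'.source
      rwa [e.left_inv hx1]
    have hc : Continuous fun y : Plane => ((e x).1, y) := by fun_prop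
    filter_upwards [hc.continuousAt.preimage_mem_nhds (ho.mem_nhds hmem)] with y hy
    have hy1 : ((e x).1, y) ∈ e.target := hy.1
    have h3 := foliatedChart_snd (b i).half (b j).half (c i) (c j) fibreRadius fibreRadius
      (e.map_target hy1) hy.2
    rw [← he, e.right_inv hy1] at h3
    exact h3

/-- The point of the torus corresponding to a point of the transversal, in the trivialization over the
zone of the chart. The factor `1/8` is `fibreRadius`. -/
noncomputable def fibreValue (t : (suspensionFoliation b c hcover).Transversal) : Torus :=
  toTorus (c t.1 + (1 / 8 : ℝ) • (t.2 : Plane))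

theorem mem_plaque_iff (t : (suspensionFoliation b c hcover).Transversal) (q : Suspension) :
    q ∈ (suspensionFoliation b c hcover).plaque t ↔ q.1 ∈ (b t.1).half.chart.source ∧
      (b t.1).zone.twist (ramp q.1) q.2 = fibreValue hcover t := by
  obtain ⟨i, w, hw⟩ := t
  constructor
  · rintro ⟨h1, h2⟩
    replace h1 : q ∈ (foliatedChart (b i).half (c i) fibreRadius).source := h1
    replace h2 : (foliatedChart (b i).half (c i) fibreRadius q).2 = w := h2
    refine ⟨((mem_foliatedChart_source _ _ _).1 h1).1, ?_⟩
    have h3 := toTorus_foliatedChart _ _ _ h1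
    rw [h2] at h3
    exact h3.symm
  · rintro ⟨h1, h2⟩
    exact mem_foliatedChart_source_of (b i).half (c i) fibreRadius h1 hw h2

theorem exists_mem_plaque (q : Suspension) :
    ∃ t, q ∈ (suspensionFoliation b c hcover).plaque t := by
  obtain ⟨i, hi⟩ := hcover q
  have h := (foliatedChart (b i).half (c i) fibreRadius).map_source hi
  rw [foliatedChart_target] at h
  exact ⟨⟨i, ⟨_, h.2⟩⟩, hi, rfl⟩

theorem point_mem_plaque (t : (suspensionFoliation b c hcover).Transversal) :
    (suspensionFoliation b c hcover).point t ∈ (suspensionFoliation b c hcover).plaque t := by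
  obtain ⟨i, w, hw⟩ := t
  have h : ((0 : Plane), w) ∈ (foliatedChart (b i).half (c i) fibreRadius).target := by
    rw [foliatedChart_target]
    exact ⟨Metric.mem_ball_self one_pos, hw⟩
  refine ⟨(foliatedChart (b i).half (c i) fibreRadius).map_target h, ?_⟩
  exact congrArg Prod.snd ((foliatedChart (b i).half (c i) fibreRadius).right_inv h)

end Foliation

/-! ### Leaves and orbits of the holonomy group -/

/-- The generators of the holonomy group. -/
noncomputable def holonomyGen (j : Fin 3) : Equiv.Perm Torus where
  toFun := isotopy j 1
  invFun := isotopy j (-1)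
  left_inv s := by rw [← isotopy_add, neg_add_cancel, isotopy_zero]
  right_inv s := by rw [← isotopy_add, add_neg_cancel, isotopy_zero]

/-- The holonomy representation of a free group of rank `3`. -/
noncomputable def holonomyHom : FreeGroup (Fin 3) →* Equiv.Perm Torus :=
  FreeGroup.lift holonomyGen

/-- The orbit equivalence relation of the holonomy group. -/
def holonomyRel : Setoid Torus where
  r s s' := ∃ g, holonomyHom g s = s'
  iseqv :=
    { refl := fun s => ⟨1, by simp⟩
      symm := by
        rintro s _ ⟨g, rfl⟩
        exact ⟨g⁻¹, by simp⟩
      trans := by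
        rintro s _ _ ⟨g, rfl⟩ ⟨g', rfl⟩
        exact ⟨g' * g, by simp⟩ }

theorem holonomyRel_isotopy (j : Fin 3) (s : Torus) : holonomyRel s (isotopy j 1 s) :=
  ⟨FreeGroup.of j, by simp [holonomyHom, holonomyGen]⟩

theorem holonomyRel_isotopy_neg (j : Fin 3) (s : Torus) : holonomyRel s (isotopy j (-1) s) := by
  have h := holonomyRel_isotopy j (isotopy j (-1) s)
  rw [← isotopy_add, add_neg_cancel, isotopy_zero] at h
  exact holonomyRel.symm h

/-- A relation that contains the generators contains the holonomy relation. -/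
theorem holonomyRel_le {R : Setoid Torus} (hR : ∀ j s, R s (isotopy j 1 s)) {s s' : Torus}
    (h : holonomyRel s s') : R s s' := by
  obtain ⟨g, rfl⟩ := h
  induction g using FreeGroup.induction_on generalizing s with
  | C1 => simp
  | of j => simpa [holonomyHom, holonomyGen] using hR j s
  | inv_of j _ =>
    have h := hR j (isotopy j (-1) s)
    rw [← isotopy_add, add_neg_cancel, isotopy_zero] at h
    have h2 : holonomyHom (FreeGroup.of j)⁻¹ s = isotopy j (-1) s := by
      simp [holonomyHom, holonomyGen, Equiv.Perm.inv_def]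
    rw [h2]
    exact R.symm h
  | mul x y hx hy =>
    rw [map_mul, Equiv.Perm.mul_apply]
    exact R.trans hy hx

theorem Zone.holonomyRel_holonomy (k l : Zone) (s : Torus) : holonomyRel s (k.holonomy l s) := by
  unfold Zone.holonomy
  split
  · exact holonomyRel_isotopy _ _
  · exact holonomyRel_isotopy_neg _ _
  · exact holonomyRel.refl _

theorem Zone.holonomy_cases (k l : Zone) (s : Torus) :
    k.holonomy l s = s ∨ ∃ j, k.holonomy l s = isotopy j 1 s ∨ s = isotopy j 1 (k.holonomy l s) := by
  unfold Zone.holonomy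
  split
  · exact .inr ⟨_, .inl rfl⟩
  · exact .inr ⟨_, .inr (by rw [← isotopy_add, add_neg_cancel, isotopy_zero])⟩
  · exact .inl rfl

section Foliation

variable {n : ℕ} {b : Fin n → BaseChart} {c : Fin n → Plane}
  (hcover : ∀ q, ∃ i, q ∈ (foliatedChart (b i).half (c i) fibreRadius).source)

theorem holonomyRel_twist_of_mem_plaque {t : (suspensionFoliation b c hcover).Transversal}
    {q : Suspension} (hq : q ∈ (suspensionFoliation b c hcover).plaque t) {k : Zone}
    (hk : (q.1 : ℝ × ℝ × ℝ) ∈ k.carrier) :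
    holonomyRel (k.twist (ramp q.1) q.2) (fibreValue hcover t) := by
  obtain ⟨h1, h2⟩ := (mem_plaque_iff hcover t q).1 hq
  have h3 := Zone.twist_eq_holonomy hk ((b t.1).half.mem_zone _ h1) q.2
  have h4 := Zone.holonomyRel_holonomy k (b t.1).half.zone (k.twist (ramp q.1) q.2)
  rw [← h3] at h4
  exact h2 ▸ h4

theorem holonomyRel_of_leafRel {q q' : Suspension}
    (h : (suspensionFoliation b c hcover).leafRel q q') {k k' : Zone}
    (hk : (q.1 : ℝ × ℝ × ℝ) ∈ k.carrier) (hk' : (q'.1 : ℝ × ℝ × ℝ) ∈ k'.carrier) :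
    holonomyRel (k.twist (ramp q.1) q.2) (k'.twist (ramp q'.1) q'.2) := by
  replace h : Relation.EqvGen (fun x y => ∃ t : (suspensionFoliation b c hcover).Transversal,
    x ∈ (suspensionFoliation b c hcover).plaque t ∧
      y ∈ (suspensionFoliation b c hcover).plaque t) q q' := h
  induction h generalizing k k' with
  | rel x y h =>
    obtain ⟨t, hx, hy⟩ := h
    exact holonomyRel.trans (holonomyRel_twist_of_mem_plaque hcover hx hk)
      (holonomyRel.symm (holonomyRel_twist_of_mem_plaque hcover hy hk'))
  | refl x =>
    rw [Zone.twist_eq_holonomy hk hk']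
    exact Zone.holonomyRel_holonomy _ _ _
  | symm x y _ ih => exact holonomyRel.symm (ih hk' hk)
  | trans x y z _ _ ih1 ih2 =>
    obtain ⟨l, hl⟩ := Zone.exists_mem y.1
    exact holonomyRel.trans (ih1 hk hl) (ih2 hl hk')

/-- Over a connected set contained in a zone, the points with the same coordinate in the
trivialization lie in the same leaf. -/
theorem leafRel_of_joined {k : Zone} {p p' : BaseSurface} (h : k.Joined p p') (s : Torus) :
    (suspensionFoliation b c hcover).leafRel (p, k.twist (-ramp p) s)
      (p', k.twist (-ramp p') s) := by
  obtain ⟨K, hK, hk, hp, hp'⟩ := h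
  refine hK.induction₂ (fun p p' => (suspensionFoliation b c hcover).leafRel
    (p, k.twist (-ramp p) s) (p', k.twist (-ramp p') s)) ?_ ?_ ?_ hp hp'
  · intro x hx
    obtain ⟨t, ht⟩ := exists_mem_plaque hcover (x, k.twist (-ramp x) s)
    obtain ⟨h1, h2⟩ := (mem_plaque_iff hcover t _).1 ht
    have h3 : (b t.1).half.chart.source ∈ 𝓝[K] x :=
      mem_nhdsWithin_of_mem_nhds ((b t.1).half.chart.open_source.mem_nhds h1)
    filter_upwards [h3, self_mem_nhdsWithin] with y hy hyK
    refine Relation.EqvGen.rel _ _ ⟨t, ht, (mem_plaque_iff hcover t _).2 ⟨hy, ?_⟩⟩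
    rw [← h2]
    have h4 := Zone.twist_eq_holonomy (hk x hx) ((b t.1).half.mem_zone _ h1)
    have h5 := Zone.twist_eq_holonomy (hk y hyK) ((b t.1).half.mem_zone _ hy)
    change (b t.1).half.zone.twist (ramp y) _ = (b t.1).half.zone.twist (ramp x) _
    rw [h4, h5, Zone.twist_twist_neg, Zone.twist_twist_neg]
  · intro x y z _ _ _ hxy hyz
    exact Setoid.trans' _ hxy hyz
  · intro x y _ _ hxy
    exact Setoid.symm' _ hxy

theorem leafRel_sheet {e : Bool} {p : BaseSurface}
    (hp : (p : ℝ × ℝ × ℝ) ∈ (Zone.sheet e).carrier) (s : Torus) :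
    (suspensionFoliation b c hcover).leafRel (p, s) (corePoint e, s) := by
  have h := leafRel_of_joined hcover (Zone.joined_sheet hp) s
  have h2 : ∀ τ, (Zone.sheet e).twist τ s = s := by
    cases e <;> exact fun _ => rfl
  rwa [h2, h2] at h

theorem leafRel_out {e : Bool} {p : BaseSurface} (hp : (p : ℝ × ℝ × ℝ) ∈ Zone.out.carrier)
    (hz : 0 ≤ sheetSign e * p.1.2.2) (s : Torus) :
    (suspensionFoliation b c hcover).leafRel (p, s) (corePoint e, s) := by
  obtain ⟨q, h1, h2⟩ := Zone.exists_joined_sheet (.inl rfl) hp hz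
  exact Setoid.trans' _ (leafRel_of_joined hcover h1 s) (leafRel_sheet hcover h2 s)

theorem leafRel_inn_up {j : Fin 3} {p : BaseSurface} (hp : (p : ℝ × ℝ × ℝ) ∈ (Zone.inn j).carrier)
    (hz : 0 ≤ p.1.2.2) (s : Torus) :
    (suspensionFoliation b c hcover).leafRel (p, isotopy j (-ramp p) s)
      (corePoint true, isotopy j (-1) s) := by
  obtain ⟨q, h1, h2⟩ := Zone.exists_joined_sheet (b := true) (.inr ⟨j, rfl⟩) hp
    (by simpa [sheetSign] using hz)
  have h3 := leafRel_of_joined hcover h1 s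
  rw [ramp_of_up h2] at h3
  exact Setoid.trans' _ h3 (leafRel_sheet hcover h2 _)

theorem leafRel_inn_down {j : Fin 3} {p : BaseSurface}
    (hp : (p : ℝ × ℝ × ℝ) ∈ (Zone.inn j).carrier) (hz : p.1.2.2 ≤ 0) (s : Torus) :
    (suspensionFoliation b c hcover).leafRel (p, isotopy j (-ramp p) s) (corePoint false, s) := by
  obtain ⟨q, h1, h2⟩ := Zone.exists_joined_sheet (b := false) (.inr ⟨j, rfl⟩) hp
    (by simpa [sheetSign] using hz)
  have h3 := leafRel_of_joined hcover h1 s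
  rw [ramp_of_down h2, neg_zero, Zone.twist_zero] at h3
  exact Setoid.trans' _ h3 (leafRel_sheet hcover h2 _)

theorem leafRel_core_core (s : Torus) :
    (suspensionFoliation b c hcover).leafRel (corePoint false, s) (corePoint true, s) := by
  obtain ⟨p, hp, hz⟩ := Zone.exists_mem_boundary (k := .out) (.inl rfl)
  exact Setoid.trans' _ (Setoid.symm' _ (leafRel_out hcover (e := false) hp (by simp [hz]) s))
    (leafRel_out hcover (e := true) hp (by simp [hz]) s)

theorem leafRel_core_of_holonomyRel {s s' : Torus} (h : holonomyRel s s') :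
    (suspensionFoliation b c hcover).leafRel (corePoint true, s) (corePoint true, s') := by
  refine holonomyRel_le
    (R := (suspensionFoliation b c hcover).leafRel.comap fun s => (corePoint true, s)) ?_ h
  intro j s
  rw [Setoid.comap_rel]
  obtain ⟨p, hp, hz⟩ := Zone.exists_mem_boundary (k := .inn j) (.inr ⟨j, rfl⟩)
  have h1 := leafRel_inn_up hcover hp hz.ge (isotopy j 1 s)
  have h2 := leafRel_inn_down hcover hp hz.le (isotopy j 1 s)
  have hs : isotopy j (-1) (isotopy j 1 s) = s := by
    rw [← isotopy_add, neg_add_cancel, isotopy_zero]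
  rw [hs] at h1
  exact Setoid.trans' _ (Setoid.symm' _ h1) (Setoid.trans' _ h2 (leafRel_core_core hcover _))

/-- Every leaf meets the fibre over the base point of the upper sheet, in the expected orbit. -/
theorem exists_leafRel_core (q : Suspension) {k : Zone} (hk : (q.1 : ℝ × ℝ × ℝ) ∈ k.carrier) :
    (suspensionFoliation b c hcover).leafRel q (corePoint true, k.twist (ramp q.1) q.2) := by
  obtain ⟨p, s⟩ := q
  cases k with
  | up => exact leafRel_sheet hcover (e := true) hk s
  | down =>
    exact Setoid.trans' _ (leafRel_sheet hcover (e := false) hk s) (leafRel_core_core hcover s)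
  | out =>
    rcases le_total 0 p.1.2.2 with hz | hz
    · exact leafRel_out hcover (e := true) hk (by simpa [sheetSign] using hz) s
    · exact Setoid.trans' _ (leafRel_out hcover (e := false) hk (by simpa [sheetSign] using hz) s)
        (leafRel_core_core hcover s)
  | inn j =>
    have hs : isotopy j (-ramp p) (isotopy j (ramp p) s) = s := by
      rw [← isotopy_add, neg_add_cancel, isotopy_zero]
    rcases le_total 0 p.1.2.2 with hz | hz
    · have h := leafRel_inn_up hcover hk hz (isotopy j (ramp p) s)
      rw [hs] at h
      exact Setoid.trans' _ h
        (leafRel_core_of_holonomyRel hcover (holonomyRel.symm (holonomyRel_isotopy_neg j _)))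
    · have h := leafRel_inn_down hcover hk hz (isotopy j (ramp p) s)
      rw [hs] at h
      exact Setoid.trans' _ h (leafRel_core_core hcover _)

/-- The leaves correspond to the orbits of the holonomy group. -/
theorem transRel_iff (t t' : (suspensionFoliation b c hcover).Transversal) :
    (suspensionFoliation b c hcover).transRel t t' ↔
      holonomyRel (fibreValue hcover t) (fibreValue hcover t') := by
  have ht := point_mem_plaque hcover t
  have ht' := point_mem_plaque hcover t'
  obtain ⟨k, hk⟩ := Zone.exists_mem ((suspensionFoliation b c hcover).point t).1
  obtain ⟨k', hk'⟩ := Zone.exists_mem ((suspensionFoliation b c hcover).point t').1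
  have h1 := holonomyRel_twist_of_mem_plaque hcover ht hk
  have h2 := holonomyRel_twist_of_mem_plaque hcover ht' hk'
  constructor
  · intro h
    exact holonomyRel.trans (holonomyRel.symm h1)
      (holonomyRel.trans (holonomyRel_of_leafRel hcover h hk hk') h2)
  · intro h
    have h3 := exists_leafRel_core hcover _ hk
    have h4 := exists_leafRel_core hcover _ hk'
    change (suspensionFoliation b c hcover).leafRel _ _
    exact Setoid.trans' _ h3 (Setoid.trans' _ (leafRel_core_of_holonomyRel hcover
      (holonomyRel.trans h1 (holonomyRel.trans h (holonomyRel.symm h2)))) (Setoid.symm' _ h4))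

/-- Plaques that intersect differ by an element of the holonomy pseudogroup. -/
theorem exists_fibreValue_eq_of_adj {t t' : (suspensionFoliation b c hcover).Transversal}
    (h : (suspensionFoliation b c hcover).holonomyGraph.Adj t t') :
    fibreValue hcover t' = fibreValue hcover t ∨ ∃ j,
      fibreValue hcover t' = isotopy j 1 (fibreValue hcover t) ∨
      fibreValue hcover t = isotopy j 1 (fibreValue hcover t') := by
  obtain ⟨-, q, hq, hq'⟩ := h
  obtain ⟨h1, h2⟩ := (mem_plaque_iff hcover t q).1 hq
  obtain ⟨h1', h2'⟩ := (mem_plaque_iff hcover t' q).1 hq'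
  have h3 := Zone.twist_eq_holonomy ((b t.1).half.mem_zone _ h1) ((b t'.1).half.mem_zone _ h1') q.2
  replace h3 : fibreValue hcover t' = (b t.1).zone.holonomy (b t'.1).zone (fibreValue hcover t) := by
    rw [← h2, ← h2']
    exact h3
  rw [h3]
  exact Zone.holonomy_cases _ _ _

/-- The discs of the upper zone cover the torus. -/
theorem exists_fibreValue_eq (s : Torus) :
    ∃ t : (suspensionFoliation b c hcover).Transversal, fibreValue hcover t = s := by
  obtain ⟨t, ht⟩ := exists_mem_plaque hcover (corePoint true, s)
  obtain ⟨h1, h2⟩ := (mem_plaque_iff hcover t _).1 ht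
  refine ⟨t, h2.symm.trans ?_⟩
  have hup : ((corePoint true : BaseSurface) : ℝ × ℝ × ℝ) ∈ Zone.up.carrier := by
    change (1 / 4 : ℝ) < _
    norm_num [corePoint, sheetSign]
  have h3 := Zone.twist_eq_holonomy hup ((b t.1).half.mem_zone _ h1) s
  have h4 : (b t.1).zone = .up := by
    have h5 := (b t.1).half.mem_zone _ h1
    change _ ∈ (b t.1).zone.carrier at h5
    have h0 : coreFun (corePoint true).1.1 (corePoint true).1.2.1 = 0 := by
      norm_num [corePoint, coreFun]
    generalize (b t.1).zone = k at h5
    cases k with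
    | up => rfl
    | down =>
      have h6 : (corePoint true).1.2.2 < 0 := h5
      norm_num [corePoint, sheetSign] at h6
    | out =>
      have h6 : 0 < coreFun (corePoint true).1.1 (corePoint true).1.2.1 := h5
      exact absurd h0 h6.ne'
    | inn j => exact absurd h0 h5.1.ne
  rw [h4]
  rfl

end Foliation

/-! ### A criterion for non-amenability -/

section Amenability

variable {X : Type*}

theorem BddFunOn.add {C : Set X} {f g : X → ℝ} (hf : BddFunOn C f) (hg : BddFunOn C g) :
    BddFunOn C (f + g) := by
  obtain ⟨K, hK⟩ := hf
  obtain ⟨L, hL⟩ := hg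
  exact ⟨K + L, fun z hz => (abs_add_le _ _).trans (add_le_add (hK z hz) (hL z hz))⟩

theorem BddFunOn.smul {C : Set X} {f : X → ℝ} (a : ℝ) (hf : BddFunOn C f) :
    BddFunOn C (a • f) := by
  obtain ⟨K, hK⟩ := hf
  refine ⟨|a| * K, fun z hz => ?_⟩
  rw [Pi.smul_apply, smul_eq_mul, abs_mul]
  exact mul_le_mul_of_nonneg_left (hK z hz) (abs_nonneg a)

theorem BddFunOn.indicator_one (C B : Set X) : BddFunOn C (B.indicator 1) :=
  ⟨1, fun z _ => by by_cases h : z ∈ B <;> simp [h]⟩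

theorem IsMeanOn.mono {C : Set X} {m : (X → ℝ) → ℝ} (hm : IsMeanOn C m) {f g : X → ℝ}
    (hf : BddFunOn C f) (hg : BddFunOn C g) (h : ∀ z ∈ C, f z ≤ g z) : m f ≤ m g := by
  have h1 := hm.nonneg (g + (-1 : ℝ) • f) (hg.add (hf.smul _)) fun z hz => by
    simpa using h z hz
  rw [hm.map_add _ _ hg (hf.smul _), hm.map_smul _ _ hf] at h1
  linarith

theorem IsMeanOn.map_sum {C : Set X} {m : (X → ℝ) → ℝ} (hm : IsMeanOn C m) {ι : Type*}
    (s : Finset ι) {f : ι → X → ℝ} (hf : ∀ i, BddFunOn C (f i)) :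
    BddFunOn C (∑ i ∈ s, f i) ∧ m (∑ i ∈ s, f i) = ∑ i ∈ s, m (f i) := by
  classical
  induction s using Finset.induction_on with
  | empty =>
    have h0 : BddFunOn C (0 : X → ℝ) := ⟨0, fun z _ => by simp⟩
    refine ⟨by simpa using h0, ?_⟩
    have := hm.map_smul 0 0 h0
    simpa using this
  | insert i s hi ih =>
    rw [Finset.sum_insert hi, Finset.sum_insert hi]
    exact ⟨(hf i).add ih.1, by rw [hm.map_add _ _ (hf i) ih.1, ih.2]⟩

/-- Given a countable family `γ` of maps and an action `σ` of a free group, the set of the pairs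
`(s, z)` such that, for the first term `γ n z` of the sequence `γ k z` in the orbit of `s`, there
is a word with first letter `l` that moves `γ n z` to `s`. -/
def firstLetterSet (σ : FreeGroup Bool →* Equiv.Perm X) (γ : ℕ → X → X) (l : Bool × Bool) :
    Set (X × X) :=
  {p | ∃ n, (∃ v ∈ FreeGroup.startsWith l, σ v (γ n p.2) = p.1) ∧
    ∀ k < n, ∀ v, σ v (γ k p.2) ≠ p.1}

variable {σ : FreeGroup Bool →* Equiv.Perm X} {γ : ℕ → X → X}

theorem measurableSet_firstLetterSet [MeasurableSpace X] [MeasurableEq X]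
    (hσ : ∀ w, Measurable (σ w)) (hγ : ∀ n, Measurable (γ n)) (l : Bool × Bool) :
    MeasurableSet (firstLetterSet σ γ l) := by
  have h (n : ℕ) (v : FreeGroup Bool) : MeasurableSet {p : X × X | σ v (γ n p.2) = p.1} :=
    measurableSet_eq_fun ((hσ v).comp ((hγ n).comp measurable_snd)) measurable_fst
  simp only [firstLetterSet, ne_eq, ofPred_exists, ofPred_and, ofPred_forall]
  refine .iUnion fun n => .inter ?_ (.iInter fun k => .iInter fun _ => .iInter fun v => (h k v).compl)
  refine .iUnion fun v => .inter (.const _) (h n v)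

/-- At a point with trivial stabilizer, the first letter is unique. -/
theorem eq_of_mem_firstLetterSet {s z : X} (hs : ∀ w, σ w s = s → w = 1) {l l' : Bool × Bool}
    (h : (s, z) ∈ firstLetterSet σ γ l) (h' : (s, z) ∈ firstLetterSet σ γ l') : l = l' := by
  obtain ⟨n, ⟨v, hv, hvs⟩, hn⟩ := h
  obtain ⟨n', ⟨v', hv', hvs'⟩, hn'⟩ := h'
  have hnn : n = n' := by
    rcases lt_trichotomy n n' with h | h | h
    · exact absurd hvs (hn' n h v)
    · exact h
    · exact absurd hvs' (hn n' h v')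
  subst hnn
  have h1 : σ (v * v'⁻¹) s = s := by
    have h2 : γ n z = (σ v')⁻¹ s := (σ v').injective (by simpa using hvs')
    rw [map_mul, Equiv.Perm.mul_apply, map_inv, ← h2]
    exact hvs
  have h2 : v = v' := mul_inv_eq_one.1 (hs _ h1)
  subst h2
  by_contra hne
  exact (FreeGroup.startsWith.disjoint_iff_ne.2 hne).notMem_of_mem_left hv hv'

/-- The words that do not start with `a⁻¹` are moved by `a` to words that start with `a`. -/
theorem mem_firstLetterSet_or {s z : X} (hz : ∃ n, γ n z = s) (a : Bool) :
    (s, z) ∈ firstLetterSet σ γ (a, false) ∨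
      (σ (FreeGroup.of a) s, z) ∈ firstLetterSet σ γ (a, true) := by
  classical
  have hex : ∃ n, ∃ v, σ v (γ n z) = s := by
    obtain ⟨n, hn⟩ := hz
    exact ⟨n, 1, by simpa using hn⟩
  obtain ⟨v, hv⟩ := Nat.find_spec hex
  have hmin : ∀ k < Nat.find hex, ∀ v, σ v (γ k z) ≠ s := fun k hk v h =>
    Nat.find_min hex hk ⟨v, h⟩
  by_cases hva : v ∈ FreeGroup.startsWith (a, false)
  · exact .inl ⟨_, ⟨v, hva, hv⟩, hmin⟩
  · refine .inr ⟨_, ⟨FreeGroup.of a * v, FreeGroup.startsWith_mk_mul (w := (a, true)) v hva, ?_⟩,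
      fun k hk w hw => hmin k hk ((FreeGroup.of a)⁻¹ * w) ?_⟩
    · rw [map_mul, Equiv.Perm.mul_apply]
      exact congrArg _ hv
    · rw [map_mul, Equiv.Perm.mul_apply]
      change σ w (γ k z) = σ (FreeGroup.of a) s at hw
      rw [hw, map_inv]
      simp

/-- An equivalence relation on a finite measure space is not amenable if a free group of rank two
acts in a measure preserving and essentially free way such that each generator `a` preserves the
classes on a set `E a`, and the sum of the measures of these two sets exceeds the total mass. -/
theorem not_amenableRel_of_free [MeasurableSpace X] [MeasurableEq X] {R : Setoid X}
    {μ : Measure X} [IsFiniteMeasure μ] (hσ : ∀ w, MeasurePreserving (σ w) μ μ)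
    (hfree : ∀ᵐ s ∂μ, ∀ w, σ w s = s → w = 1) (hγ : ∀ n, Measurable (γ n))
    (hR : ∀ s z, R s z → ∃ n, γ n z = s) {E : Bool → Set X} (hE : ∀ a, MeasurableSet (E a))
    (hRE : ∀ a, ∀ s ∈ E a, R s (σ (FreeGroup.of a) s)) (hμ : μ univ < μ (E true) + μ (E false)) :
    ¬ AmenableRel R μ := by
  rintro ⟨m, hm, hmeas, hinv⟩
  set f : Bool × Bool → X × X → ℝ := fun l => (firstLetterSet σ γ l).indicator 1 with hf
  have hfl : ∀ l s, (fun z => f l (s, z)) = {z | (s, z) ∈ firstLetterSet σ γ l}.indicator 1 := by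
    intro l s
    ext z
    by_cases h : (s, z) ∈ firstLetterSet σ γ l <;> simp [hf, h]
  have hbdd : ∀ l s C, BddFunOn C (fun z => f l (s, z)) := by
    intro l s C
    rw [hfl]
    exact BddFunOn.indicator_one _ _
  set α : Bool × Bool → X → ℝ := fun l s => m s (fun z => f l (s, z)) with hα
  have hαm : ∀ l, AEMeasurable (fun s => ENNReal.ofReal (α l s)) μ := by
    intro l
    refine (hmeas (f l) ?_ ⟨1, fun t => ?_⟩).ennreal_ofReal
    · exact measurable_one.indicator (measurableSet_firstLetterSet (fun w => (hσ w).measurable) hγ l)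
    · by_cases h : t ∈ firstLetterSet σ γ l <;> simp [hf, h]
  have hone : ∀ C : Set X, BddFunOn C (fun _ => 1) := fun C => ⟨1, fun _ _ => by simp⟩
  -- the sets of points with distinct first letters are disjoint
  have hle : ∑ l, ∫⁻ s, ENNReal.ofReal (α l s) ∂μ ≤ μ univ := by
    rw [← lintegral_finsetSum' _ fun l _ => hαm l, ← lintegral_one]
    refine lintegral_mono_ae ?_
    filter_upwards [hm, hfree] with s hs hfs
    have h0 : ∀ l, 0 ≤ α l s := fun l => hs.nonneg _ (hbdd l s _) fun z _ =>
      indicator_nonneg (fun _ _ => zero_le_one) _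
    rw [← ENNReal.ofReal_sum_of_nonneg fun l _ => h0 l, ENNReal.ofReal_le_one]
    obtain ⟨hb, hsum⟩ := hs.map_sum Finset.univ (f := fun l z => f l (s, z)) fun l => hbdd l s _
    rw [← hsum, ← hs.map_one]
    refine hs.mono hb (hone _) fun z _ => ?_
    rw [Finset.sum_apply]
    by_cases hex : ∃ l, (s, z) ∈ firstLetterSet σ γ l
    · obtain ⟨l, hl⟩ := hex
      rw [Finset.sum_eq_single l]
      · simp [hf, hl]
      · intro l' _ hne
        have : (s, z) ∉ firstLetterSet σ γ l' := fun h => hne (eq_of_mem_firstLetterSet hfs h hl)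
        simp [hf, this]
      · simp
    · push Not at hex
      simp [hf, hex]
  have hge : ∀ a, μ (E a) ≤ ∫⁻ s, ENNReal.ofReal (α (a, false) s) ∂μ +
      ∫⁻ s, ENNReal.ofReal (α (a, true) s) ∂μ := by
    intro a
    have hp := hσ (FreeGroup.of a)
    have hmap : ∫⁻ s, ENNReal.ofReal (α (a, true) s) ∂μ =
        ∫⁻ s, ENNReal.ofReal (α (a, true) (σ (FreeGroup.of a) s)) ∂μ := by
      conv_lhs => rw [← hp.map_eq]
      exact lintegral_map' (by rw [hp.map_eq]; exact hαm _) hp.aemeasurable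
    rw [hmap, ← lintegral_add_left' (hαm _), ← lintegral_indicator_one (hE a)]
    refine lintegral_mono_ae ?_
    filter_upwards [hm, hinv] with s hs his
    by_cases hsE : s ∈ E a
    · have hRs := hRE a s hsE
      set g : X → ℝ := fun z => f (a, true) (σ (FreeGroup.of a) s, z) with hg
      have h1 : α (a, true) (σ (FreeGroup.of a) s) = m s g := (his _ hRs _ (hbdd _ _ _)).symm
      have h2 : 1 ≤ α (a, false) s + m s g := by
        rw [hα, ← hs.map_add _ _ (hbdd _ _ _) (hbdd _ _ _), ← hs.map_one]
        refine hs.mono (hone _) ((hbdd _ _ _).add (hbdd _ _ _)) fun z hz => ?_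
        have h3 : ∀ l s, 0 ≤ f l (s, z) := fun l s => indicator_nonneg (fun _ _ => zero_le_one) _
        have h4 := h3 (a, false) s
        have h5 := h3 (a, true) (σ (FreeGroup.of a) s)
        rw [Pi.add_apply]
        rcases mem_firstLetterSet_or (σ := σ) (hR s z hz) a with h | h
        · have : f (a, false) (s, z) = 1 := by simp [hf, h]
          linarith
        · have : f (a, true) (σ (FreeGroup.of a) s, z) = 1 := by simp [hf, h]
          linarith
      rw [indicator_of_mem hsE, Pi.one_apply, h1]
      refine le_trans ?_ ENNReal.ofReal_add_le
      rw [← ENNReal.ofReal_one]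
      exact ENNReal.ofReal_le_ofReal h2
    · simp [hsE]
  refine absurd hμ (not_lt.2 ((add_le_add (hge true) (hge false)).trans (le_trans (le_of_eq ?_) hle)))
  rw [Fintype.sum_prod_type]
  simp only [Fintype.sum_bool]
  ring

end Amenability

/-! ### A free group of automorphisms of the torus -/

section FreeAction

/-- The action of an integer matrix on the torus. -/
noncomputable def slTorusFun (M : Matrix.SpecialLinearGroup (Fin 2) ℤ) (s : Torus) : Torus :=
  (M 0 0 • s.1 + M 0 1 • s.2, M 1 0 • s.1 + M 1 1 • s.2)

theorem slTorusFun_mul (M N : Matrix.SpecialLinearGroup (Fin 2) ℤ) (s : Torus) :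
    slTorusFun (M * N) s = slTorusFun M (slTorusFun N s) := by
  simp only [slTorusFun, Matrix.SpecialLinearGroup.coe_mul, Matrix.mul_apply, Fin.sum_univ_two,
    add_smul, smul_add, mul_smul, Prod.mk.injEq]
  constructor <;> abel

theorem slTorusFun_one (s : Torus) : slTorusFun 1 s = s := by
  simp [slTorusFun]

/-- The action of `SL(2, ℤ)` on the torus. -/
noncomputable def slTorus : Matrix.SpecialLinearGroup (Fin 2) ℤ →* Equiv.Perm Torus where
  toFun M :=
    { toFun := slTorusFun M
      invFun := slTorusFun M⁻¹
      left_inv := fun s => by rw [← slTorusFun_mul, inv_mul_cancel, slTorusFun_one]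
      right_inv := fun s => by rw [← slTorusFun_mul, mul_inv_cancel, slTorusFun_one] }
  map_one' := Equiv.ext slTorusFun_one
  map_mul' M N := Equiv.ext (slTorusFun_mul M N)

theorem slTorus_apply (M : Matrix.SpecialLinearGroup (Fin 2) ℤ) (s : Torus) :
    slTorus M s = (M 0 0 • s.1 + M 0 1 • s.2, M 1 0 • s.1 + M 1 1 • s.2) := rfl

/-- Two unipotent matrices that generate a free group. -/
def freeMatrix (a : Bool) : Matrix.SpecialLinearGroup (Fin 2) ℤ :=
  if a then ⟨!![1, 3; 0, 1], by simp [Matrix.det_fin_two]⟩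
  else ⟨!![1, 0; 3, 1], by simp [Matrix.det_fin_two]⟩

theorem coe_freeMatrix_true : (freeMatrix true : Matrix (Fin 2) (Fin 2) ℤ) = !![1, 3; 0, 1] := rfl

theorem coe_freeMatrix_false : (freeMatrix false : Matrix (Fin 2) (Fin 2) ℤ) = !![1, 0; 3, 1] := rfl

/-- Ping-pong on the first column: the sets are the sectors between the lines `x = y`, `x = -y`
and the axis preserved by the generator. -/
theorem injective_lift_freeMatrix : Function.Injective (FreeGroup.lift freeMatrix) := by
  have key : ∀ g : Matrix.SpecialLinearGroup (Fin 2) ℤ, ¬(g 0 0 = 0 ∧ g 1 0 = 0) := by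
    rintro g ⟨h0, h1⟩
    have h := g.det_coe
    rw [Matrix.det_fin_two, h0, h1] at h
    simp at h
  refine FreeGroup.injective_lift_of_ping_pong (α := Matrix.SpecialLinearGroup (Fin 2) ℤ) freeMatrix
    (fun a => {g | if a then (0 ≤ g 1 0 ∧ g 1 0 < g 0 0) ∨ (g 1 0 ≤ 0 ∧ g 0 0 < g 1 0)
      else (0 ≤ g 0 0 ∧ g 0 0 < g 1 0) ∨ (g 0 0 ≤ 0 ∧ g 1 0 < g 0 0)})
    (fun a => {g | if a then (0 < g 1 0 ∧ g 0 0 < - g 1 0) ∨ (g 1 0 < 0 ∧ - g 1 0 < g 0 0)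
      else (0 < g 0 0 ∧ g 1 0 < - g 0 0) ∨ (g 0 0 < 0 ∧ - g 0 0 < g 1 0)}) ?_ ?_ ?_ ?_ ?_ ?_
  · rintro (_ | _)
    · exact ⟨freeMatrix false, by simp [coe_freeMatrix_false]⟩
    · exact ⟨freeMatrix true, by simp [coe_freeMatrix_true]⟩
  · rintro (_ | _) (_ | _) h <;> first | exact absurd rfl h | skip
    all_goals
      refine disjoint_left.2 fun g hg hg' => ?_
      simp only [mem_ofPred_eq, if_true, Bool.false_eq_true, if_false] at hg hg'
      omega
  · rintro (_ | _) (_ | _) h <;> first | exact absurd rfl h | skip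
    all_goals
      refine disjoint_left.2 fun g hg hg' => ?_
      simp only [mem_ofPred_eq, if_true, Bool.false_eq_true, if_false] at hg hg'
      omega
  · rintro (_ | _) (_ | _)
    all_goals
      refine disjoint_left.2 fun g hg hg' => ?_
      simp only [mem_ofPred_eq, if_true, Bool.false_eq_true, if_false] at hg hg'
      omega
  · rintro (_ | _) _ ⟨g, hg, rfl⟩
    all_goals
      have h := key g
      simp only [mem_compl_iff, mem_ofPred_eq, if_true, Bool.false_eq_true, if_false] at hg
      simp [coe_freeMatrix_true, coe_freeMatrix_false, Matrix.mul_apply, Fin.sum_univ_two]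
      omega
  · rintro (_ | _) _ ⟨g, hg, rfl⟩
    all_goals
      have h := key g
      simp only [mem_compl_iff, mem_ofPred_eq, if_true, Bool.false_eq_true, if_false] at hg
      simp [coe_freeMatrix_true, coe_freeMatrix_false, Matrix.mul_apply, Fin.sum_univ_two,
        Matrix.SpecialLinearGroup.coe_inv, Matrix.adjugate_fin_two]
      omega

/-- The action of the free group of rank two on the torus by automorphisms. -/
noncomputable def freeAction : FreeGroup Bool →* Equiv.Perm Torus :=
  slTorus.comp (FreeGroup.lift freeMatrix)

theorem freeAction_of (a : Bool) : freeAction (FreeGroup.of a) = slTorus (freeMatrix a) := by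
  rw [freeAction, MonoidHom.comp_apply, FreeGroup.lift_apply_of]

theorem freeAction_inv (a : Bool) : freeAction (FreeGroup.of a)⁻¹ = slTorus (freeMatrix a)⁻¹ := by
  rw [freeAction, MonoidHom.comp_apply, map_inv, FreeGroup.lift_apply_of]

theorem freeAction_true (s : Torus) :
    freeAction (FreeGroup.of true) s = (s.1 + (3 : ℤ) • s.2, s.2) := by
  rw [freeAction_of, slTorus_apply]
  simp [coe_freeMatrix_true]

theorem freeAction_false (s : Torus) :
    freeAction (FreeGroup.of false) s = (s.1, s.2 + (3 : ℤ) • s.1) := by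
  rw [freeAction_of, slTorus_apply]
  simp [coe_freeMatrix_false, add_comm]

theorem freeAction_inv_true (s : Torus) :
    freeAction (FreeGroup.of true)⁻¹ s = (s.1 + (-3 : ℤ) • s.2, s.2) := by
  rw [freeAction_inv, slTorus_apply]
  simp [coe_freeMatrix_true, Matrix.SpecialLinearGroup.coe_inv, Matrix.adjugate_fin_two]

theorem freeAction_inv_false (s : Torus) :
    freeAction (FreeGroup.of false)⁻¹ s = (s.1, s.2 + (-3 : ℤ) • s.1) := by
  rw [freeAction_inv, slTorus_apply]
  simp [coe_freeMatrix_false, Matrix.SpecialLinearGroup.coe_inv, Matrix.adjugate_fin_two, add_comm]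

theorem measurePreserving_verticalShear {f : UnitAddCircle → UnitAddCircle} (hf : Measurable f) :
    MeasurePreserving (fun s : Torus => (s.1, s.2 + f s.1)) volume volume := by
  refine (MeasurePreserving.id volume).skew_product (g := fun x y => y + f x) (by fun_prop) ?_
  exact ae_of_all _ fun x => (measurePreserving_add_right volume (f x)).map_eq

theorem measurePreserving_horizontalShear {f : UnitAddCircle → UnitAddCircle} (hf : Measurable f) :
    MeasurePreserving (fun s : Torus => (s.1 + f s.2, s.2)) volume volume :=
  (Measure.measurePreserving_swap.comp (measurePreserving_verticalShear hf)).comp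
    Measure.measurePreserving_swap

theorem measurePreserving_freeAction (w : FreeGroup Bool) :
    MeasurePreserving (freeAction w) volume volume := by
  have h (k : ℤ) : Measurable fun x : UnitAddCircle => k • x :=
    (continuous_zsmul k).measurable
  induction w using FreeGroup.induction_on with
  | C1 => rw [map_one]; exact MeasurePreserving.id _
  | of a =>
    cases a
    · exact (funext freeAction_false) ▸ measurePreserving_verticalShear (h 3)
    · exact (funext freeAction_true) ▸ measurePreserving_horizontalShear (h 3)
  | inv_of a _ =>
    cases a
    · exact (funext freeAction_inv_false) ▸ measurePreserving_verticalShear (h (-3))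
    · exact (funext freeAction_inv_true) ▸ measurePreserving_horizontalShear (h (-3))
  | mul x y hx hy =>
    rw [map_mul]
    exact hx.comp hy

theorem UnitAddCircle.volume_singleton (x : UnitAddCircle) : volume {x} = 0 := by
  have h := AddCircle.volume_closedBall 1 (x := x) 0
  rw [Metric.closedBall_zero] at h
  simpa using h

theorem volume_zsmul_eq (k : ℤ) (hk : k ≠ 0) (c : UnitAddCircle) :
    volume {x : UnitAddCircle | k • x = c} = 0 := by
  have h := (Measure.measurePreserving_zsmul (volume : Measure UnitAddCircle) hk).measure_preimage
    (measurableSet_singleton c).nullMeasurableSet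
  rw [UnitAddCircle.volume_singleton] at h
  exact h

theorem volume_zsmul_add_zsmul_eq_zero {k l : ℤ} (h : k ≠ 0 ∨ l ≠ 0) :
    volume {s : Torus | k • s.1 + l • s.2 = 0} = 0 := by
  have hc : Continuous fun s : Torus => k • s.1 + l • s.2 :=
    ((continuous_zsmul k).comp continuous_fst).add ((continuous_zsmul l).comp continuous_snd)
  have hm : MeasurableSet {s : Torus | k • s.1 + l • s.2 = 0} :=
    (isClosed_eq hc continuous_const).measurableSet
  have key {k l : ℤ} (hl : l ≠ 0) (hm : MeasurableSet {s : Torus | k • s.1 + l • s.2 = 0}) :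
      volume {s : Torus | k • s.1 + l • s.2 = 0} = 0 := by
    rw [Measure.volume_eq_prod, Measure.measure_prod_null hm]
    refine ae_of_all _ fun x => ?_
    simpa [eq_neg_iff_add_eq_zero, add_comm] using volume_zsmul_eq l hl (-(k • x))
  rcases h with h | h
  · have hs : {s : Torus | k • s.1 + l • s.2 = 0} =
        Prod.swap ⁻¹' {s : Torus | l • s.1 + k • s.2 = 0} := by
      ext s
      simp [add_comm]
    have hm' : MeasurableSet {s : Torus | l • s.1 + k • s.2 = 0} := by
      have h1 := hm.preimage (measurable_swap (α := UnitAddCircle) (β := UnitAddCircle))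
      rwa [hs, ← preimage_comp, Prod.swap_swap_eq, preimage_id] at h1
    rw [hs]
    exact (Measure.measurePreserving_swap.measure_preimage hm'.nullMeasurableSet).trans
      (key h hm')
  · exact key h hm

/-- The free group acts freely outside a countable union of one-dimensional subgroups. -/
theorem ae_free_freeAction :
    ∀ᵐ s : Torus, ∀ w, freeAction w s = s → w = 1 := by
  rw [ae_all_iff]
  intro w
  by_cases hw : w = 1
  · exact ae_of_all _ fun _ _ => hw
  set M := FreeGroup.lift freeMatrix w with hM
  have hM1 : M ≠ 1 := fun h => hw (injective_lift_freeMatrix (by rw [← hM, h, map_one]))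
  have hs : ∀ s, freeAction w s = s → (M 0 0 - 1) • s.1 + M 0 1 • s.2 = 0 ∧
      M 1 0 • s.1 + (M 1 1 - 1) • s.2 = 0 := by
    intro s h
    rw [freeAction, MonoidHom.comp_apply, ← hM, slTorus_apply] at h
    have h1 : M 0 0 • s.1 + M 0 1 • s.2 = s.1 := congrArg Prod.fst h
    have h2 : M 1 0 • s.1 + M 1 1 • s.2 = s.2 := congrArg Prod.snd h
    constructor
    · rw [sub_smul, one_smul, sub_add_eq_add_sub, h1, sub_self]
    · rw [sub_smul, one_smul, ← add_sub_assoc, h2, sub_self]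
  have hne : (M 0 0 - 1 ≠ 0 ∨ M 0 1 ≠ 0) ∨ (M 1 0 ≠ 0 ∨ M 1 1 - 1 ≠ 0) := by
    by_contra! hc
    refine hM1 (Matrix.SpecialLinearGroup.ext _ _ fun i j => ?_)
    fin_cases i <;> fin_cases j <;> simp <;> omega
  rcases hne with hne | hne
  · have h0 := measure_eq_zero_iff_ae_notMem.1 (volume_zsmul_add_zsmul_eq_zero hne)
    filter_upwards [h0] with s hs0 hw
    exact absurd (hs s hw).1 hs0
  · have h0 := measure_eq_zero_iff_ae_notMem.1 (volume_zsmul_add_zsmul_eq_zero hne)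
    filter_upwards [h0] with s hs0 hw
    exact absurd (hs s hw).2 hs0

end FreeAction

/-- The part of the torus on which the generator `a` of the free group coincides with a generator
of the holonomy group. -/
def agreeSet (a : Bool) : Set Torus :=
  if a then univ ×ˢ Metric.closedBall 0 (27 / 100) else Metric.closedBall 0 (27 / 100) ×ˢ univ

theorem exists_coe_eq_abs_eq_norm (x : UnitAddCircle) :
    ∃ t : ℝ, (t : UnitAddCircle) = x ∧ |t| = ‖x‖ := by
  obtain ⟨t, rfl⟩ := QuotientAddGroup.mk_surjective x
  refine ⟨t - round t, ?_, (UnitAddCircle.norm_eq).symm⟩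
  exact coe_eq_coe_iff.2 ⟨-round t, by push_cast; ring⟩

theorem measurableSet_agreeSet (a : Bool) : MeasurableSet (agreeSet a) := by
  cases a
  · exact Metric.isClosed_closedBall.measurableSet.prod .univ
  · exact MeasurableSet.univ.prod Metric.isClosed_closedBall.measurableSet

theorem volume_agreeSet (a : Bool) : volume (agreeSet a) = ENNReal.ofReal (54 / 100) := by
  have h : volume (Metric.closedBall (0 : UnitAddCircle) (27 / 100)) = ENNReal.ofReal (54 / 100) := by
    rw [AddCircle.volume_closedBall]
    norm_num
  cases a
  · simp [agreeSet, Measure.volume_eq_prod, Measure.prod_prod, h]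
  · simp [agreeSet, Measure.volume_eq_prod, Measure.prod_prod, h]

theorem holonomyRel_freeAction (a : Bool) {s : Torus} (hs : s ∈ agreeSet a) :
    holonomyRel s (freeAction (FreeGroup.of a) s) := by
  cases a
  · obtain ⟨t, ht, hn⟩ := exists_coe_eq_abs_eq_norm s.1
    have hle : |t| ≤ 27 / 100 := by
      rw [hn]
      simpa [agreeSet] using hs
    have h := holonomyRel_isotopy 1 s
    rw [freeAction_false]
    convert h using 1
    simp only [isotopy, verCoeff, ← ht, verCircle_coe, verSpeed_eq hle]
    simp only [one_ne_zero, if_false, if_true, one_mul, Prod.mk.injEq, true_and]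
    rw [← AddCircle.coe_zsmul]
    congr 1
    -- the constant `3` in `verSpeed` is an integer
    exact coe_eq_coe_iff.2 ⟨-3, by push_cast; simp⟩
  · obtain ⟨t, ht, hn⟩ := exists_coe_eq_abs_eq_norm s.2
    have hle : |t| ≤ 27 / 100 := by
      rw [hn]
      simpa [agreeSet] using hs
    have h := holonomyRel_isotopy 0 s
    rw [freeAction_true]
    convert h using 1
    simp only [isotopy, ← ht, horCircle_coe, horSpeed_eq hle]
    simp only [if_true, one_mul, Prod.mk.injEq, and_true]
    rw [← AddCircle.coe_zsmul]
    simp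

theorem measurable_holonomyHom (g : FreeGroup (Fin 3)) : Measurable (holonomyHom g) := by
  have h (j : Fin 3) (τ : ℝ) : Measurable (isotopy j τ) :=
    ((continuous_isotopy j).comp (by fun_prop : Continuous fun s : Torus => (τ, s))).measurable
  induction g using FreeGroup.induction_on with
  | C1 => rw [map_one]; exact measurable_id
  | of j => rw [holonomyHom, FreeGroup.lift_apply_of]; exact h j 1
  | inv_of j _ =>
    rw [map_inv, holonomyHom, FreeGroup.lift_apply_of]; exact h j (-1)
  | mul x y hx hy =>
    rw [map_mul]
    exact hx.comp hy

theorem not_amenableRel_holonomyRel : ¬ AmenableRel holonomyRel volume := by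
  obtain ⟨g, hg⟩ := exists_surjective_nat (FreeGroup (Fin 3))
  refine not_amenableRel_of_free (σ := freeAction) (γ := fun n => holonomyHom (g n)) (E := agreeSet)
    measurePreserving_freeAction ae_free_freeAction (fun n => measurable_holonomyHom _) ?_
    measurableSet_agreeSet (fun a s hs => holonomyRel_freeAction a hs) ?_
  · intro s z h
    obtain ⟨k, hk⟩ := holonomyRel.symm h
    obtain ⟨n, rfl⟩ := hg k
    exact ⟨n, hk⟩
  · rw [volume_agreeSet, volume_agreeSet, ← ENNReal.ofReal_add (by norm_num) (by norm_num),
      Measure.volume_eq_prod, Measure.prod_apply MeasurableSet.univ]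
    simp
    norm_num

/-! ### Ergodicity of the holonomy group -/

theorem ae_addOrderOf_zsmul_eq_zero {k : ℤ} (hk : k ≠ 0) :
    ∀ᵐ x : UnitAddCircle, addOrderOf (k • x) = 0 := by
  have h : ∀ᵐ x : UnitAddCircle, ∀ n : ℕ, 0 < n → ((n : ℤ) * k) • x ≠ 0 := by
    rw [ae_all_iff]
    intro n
    by_cases hn : 0 < n
    · have h1 := measure_eq_zero_iff_ae_notMem.1 (volume_zsmul_eq (n * k) (by positivity) 0)
      filter_upwards [h1] with x hx _ using hx
    · exact ae_of_all _ fun x h => absurd h hn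
  filter_upwards [h] with x hx
  rw [addOrderOf_eq_zero_iff']
  intro n hn h0
  apply hx n hn
  rwa [mul_smul, natCast_zsmul]

/-- A set that is invariant under an irrational rotation is null or conull. -/
theorem ae_mem_or_ae_notMem_of_add {a : UnitAddCircle} (ha : addOrderOf a = 0)
    {A : Set UnitAddCircle} (hA : MeasurableSet A) (h : ∀ x, x + a ∈ A ↔ x ∈ A) :
    (∀ᵐ x, x ∈ A) ∨ ∀ᵐ x, x ∉ A :=
  (AddCircle.ergodic_add_right.2 ha).toPreErgodic.ae_mem_or_ae_notMem hA (ext h)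

/-- If almost all the slices with abscissa in `I` and almost all the slices with ordinate in `I`
are null or conull, then the trace of the set on the strip `I × Y` is null or conull. -/
theorem ae_strip_mem_or_notMem {X : Type*} [MeasurableSpace X] {μ : Measure X} [SFinite μ]
    {B : Set (X × X)} (hB : MeasurableSet B) {I : Set X} (hI : MeasurableSet I) (hμ : μ I ≠ 0)
    (hV : ∀ᵐ x ∂μ, x ∈ I → (∀ᵐ y ∂μ, (x, y) ∈ B) ∨ ∀ᵐ y ∂μ, (x, y) ∉ B)
    (hH : ∀ᵐ y ∂μ, y ∈ I → (∀ᵐ x ∂μ, (x, y) ∈ B) ∨ ∀ᵐ x ∂μ, (x, y) ∉ B) :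
    (∀ᵐ p ∂μ.prod μ, p.1 ∈ I → p ∈ B) ∨ ∀ᵐ p ∂μ.prod μ, p.1 ∈ I → p ∉ B := by
  have hstrip : MeasurableSet (Prod.fst ⁻¹' I : Set (X × X)) := measurable_fst hI
  -- a set all of whose slices over `I` are null has null trace on the strip
  have key : ∀ C : Set (X × X), MeasurableSet C →
      (∀ᵐ x ∂μ, x ∈ I → ∀ᵐ y ∂μ, (x, y) ∉ C) → ∀ᵐ p ∂μ.prod μ, p.1 ∈ I → p ∉ C := by
    intro C hC h
    rw [Measure.ae_prod_iff_ae_ae (hstrip.imp hC.compl)]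
    filter_upwards [h] with x hx
    by_cases hxI : x ∈ I
    · filter_upwards [hx hxI] with y hy _ using hy
    · exact ae_of_all _ fun y h => absurd h hxI
  by_contra hcon
  rw [not_or] at hcon
  obtain ⟨h1, h0⟩ := hcon
  have hS : ∀ C : Set (X × X), MeasurableSet C → MeasurableSet {x | x ∈ I ∧ ∀ᵐ y ∂μ, (x, y) ∈ C} :=
    fun C hC => hI.inter (measurableSet_eq_fun
      (measurable_measure_prodMk_left (ν := μ) hC.compl) measurable_const)
  have hswap : ∀ C : Set (X × X), MeasurableSet C →
      ∀ᵐ y ∂μ, ∀ᵐ x ∂μ, (x ∈ I ∧ ∀ᵐ y ∂μ, (x, y) ∈ C) → (x, y) ∈ C := by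
    intro C hC
    rw [← Measure.ae_ae_comm]
    · refine ae_of_all _ fun x => ?_
      by_cases hx : x ∈ I ∧ ∀ᵐ y ∂μ, (x, y) ∈ C
      · filter_upwards [hx.2] with y hy _ using hy
      · exact ae_of_all _ fun y h => absurd h hx
    · exact MeasurableSet.imp (measurable_fst (hS C hC)) hC
  have hy : ∃ᵐ y ∂μ, y ∈ I := frequently_ae_mem_iff.2 hμ
  obtain ⟨y, hyI, hyH, hy1, hy0⟩ :=
    (hy.and_eventually (hH.and ((hswap B hB).and (hswap Bᶜ hB.compl)))).exists
  rcases hyH hyI with h | h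
  · apply h1
    have h2 : ∀ᵐ x ∂μ, x ∈ I → ∀ᵐ y ∂μ, (x, y) ∉ Bᶜ := by
      filter_upwards [hV, hy0, h] with x hx hx0 hxB hxI
      rcases hx hxI with h3 | h3
      · filter_upwards [h3] with y hy using not_not.2 hy
      · exact absurd hxB (hx0 ⟨hxI, h3⟩)
    filter_upwards [key Bᶜ hB.compl h2] with p hp hpI using not_not.1 (hp hpI)
  · apply h0
    refine key B hB ?_
    filter_upwards [hV, hy1, h] with x hx hx1 hxB hxI
    rcases hx hxI with h3 | h3
    · exact absurd (hx1 ⟨hxI, h3⟩) hxB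
    · exact h3

/-- An arithmetic progression with difference `d` enters every half-open interval of length `d`,
modulo integers. -/
theorem exists_nat_mul_mem_arc (x : UnitAddCircle) {d : ℝ} (hd : 0 < d) (a : ℝ) :
    ∃ (k : ℕ) (v : ℝ), a ≤ v ∧ v < a + d ∧
      (v : UnitAddCircle) = x + ((k * d : ℝ) : UnitAddCircle) := by
  obtain ⟨u, rfl⟩ := QuotientAddGroup.mk_surjective x
  set n : ℤ := ⌊a - u⌋ with hn
  have h1 : (n : ℝ) ≤ a - u := Int.floor_le _
  have h0 : 0 ≤ a - (u + n) := by linarith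
  set k : ℕ := ⌈(a - (u + n)) / d⌉₊ with hk
  have h2 : (a - (u + n)) / d ≤ k := Nat.le_ceil _
  have h3 : (k : ℝ) < (a - (u + n)) / d + 1 :=
    Nat.ceil_lt_add_one (div_nonneg h0 hd.le)
  refine ⟨k, u + n + k * d, ?_, ?_, ?_⟩
  · rw [div_le_iff₀ hd] at h2
    linarith
  · have h4 : (k : ℝ) * d < ((a - (u + n)) / d + 1) * d := mul_lt_mul_of_pos_right h3 hd
    rw [add_mul, div_mul_cancel₀ _ hd.ne'] at h4
    linarith
  · change _ = (u : UnitAddCircle) + _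
    rw [← AddCircle.coe_add]
    exact coe_eq_coe_iff.2 ⟨n, by ring⟩

theorem isotopy_zero_apply (τ : ℝ) (s : Torus) :
    isotopy 0 τ s = (s.1 + (τ * horCircle s.2 : ℝ), s.2) := rfl

theorem holonomyRel_isotopy_nat (j : Fin 3) (k : ℕ) (s : Torus) :
    holonomyRel s (isotopy j k s) := by
  induction k with
  | zero => rw [Nat.cast_zero, isotopy_zero]
  | succ k ih =>
    rw [Nat.cast_succ, add_comm, isotopy_add]
    exact holonomyRel.trans ih (holonomyRel_isotopy j _)

theorem measurePreserving_isotopy_zero (τ : ℝ) :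
    MeasurePreserving (isotopy 0 τ) volume volume := by
  refine measurePreserving_horizontalShear (f := fun y => (τ * horCircle y : ℝ)) ?_
  have h3 : Continuous ((↑) : ℝ → UnitAddCircle) := AddCircle.continuous_mk' 1
  exact (h3.comp (continuous_const.mul continuous_horCircle)).measurable

/-- Away from the two circles fixed by the horizontal generator, its forward orbits visit the
strip where the second generator is linear. -/
theorem exists_isotopy_zero_mem_agreeSet {s : Torus} (h0 : s.2 ≠ 0)
    (h1 : s.2 ≠ ((1 / 2 : ℝ) : UnitAddCircle)) :
    ∃ k : ℕ, isotopy 0 k s ∈ agreeSet false := by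
  have key : ∀ (x : UnitAddCircle) (d : ℝ), 0 < d → d ≤ 1 / 2 →
      ∃ k : ℕ, ‖x + ((k * d : ℝ) : UnitAddCircle)‖ ≤ 27 / 100 := by
    intro x d hd hd2
    obtain ⟨k, v, hv1, hv2, hv⟩ := exists_nat_mul_mem_arc x hd (-(27 / 100))
    refine ⟨k, ?_⟩
    rw [← hv]
    refine (QuotientAddGroup.norm_mk_le_norm).trans ?_
    rw [Real.norm_eq_abs, abs_le]
    constructor <;> linarith
  obtain ⟨t, ht, htn⟩ := exists_coe_eq_abs_eq_norm s.2
  have ht2 : |t| ≤ 1 / 2 := by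
    rw [htn]
    simpa using AddCircle.norm_le_half_period (p := 1) (x := s.2) one_ne_zero
  have ht0 : t ≠ 0 := by
    rintro rfl
    exact h0 (by rw [← ht]; rfl)
  have ht3 : |t| < 1 / 2 := by
    refine lt_of_le_of_ne ht2 fun h => h1 ?_
    rw [← ht]
    rcases abs_eq (by norm_num : (0 : ℝ) ≤ 1 / 2) |>.1 h with rfl | rfl
    · rfl
    · exact coe_eq_coe_iff.2 ⟨-1, by norm_num⟩
  have hspeed : horSpeed t ≠ 0 ∧ |horSpeed t| < 1 := by
    rcases lt_or_gt_of_ne ht0 with h | h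
    · have := horSpeed_pos_lt (t := -t) (by linarith) (by linarith [(abs_lt.1 ht3).1])
      rw [horSpeed_neg t ht3] at this
      exact ⟨by linarith, by rw [abs_lt]; constructor <;> linarith⟩
    · have := horSpeed_pos_lt h (by linarith [(abs_lt.1 ht3).2])
      exact ⟨this.1.ne', by rw [abs_lt]; constructor <;> linarith⟩
  obtain ⟨d, hd, hdn⟩ := exists_coe_eq_abs_eq_norm (horSpeed t : UnitAddCircle)
  have hd2 : |d| ≤ 1 / 2 := by
    rw [hdn]
    simpa using AddCircle.norm_le_half_period (p := 1) (x := (horSpeed t : UnitAddCircle)) one_ne_zero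
  have hd0 : d ≠ 0 := by
    rintro rfl
    obtain ⟨n, hn⟩ := coe_eq_coe_iff.1 hd
    have h2 : |(n : ℝ)| < 1 := by
      rw [show (n : ℝ) = -horSpeed t by linarith, abs_neg]
      exact hspeed.2
    have h3 : n = 0 := by
      rw [← Int.abs_lt_one_iff]
      exact_mod_cast h2
    rw [h3] at hn
    exact hspeed.1 (by simpa using hn.symm)
  have hmul : ∀ k : ℕ, ((k * horCircle s.2 : ℝ) : UnitAddCircle) = ((k * d : ℝ) : UnitAddCircle) := by
    intro k
    rw [← ht, horCircle_coe, ← nsmul_eq_mul, ← nsmul_eq_mul, AddCircle.coe_nsmul,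
      AddCircle.coe_nsmul, hd]
  have hgoal : ∃ k : ℕ, ‖s.1 + ((k * d : ℝ) : UnitAddCircle)‖ ≤ 27 / 100 := by
    rcases lt_or_gt_of_ne hd0 with h | h
    · obtain ⟨k, hk⟩ := key (-s.1) (-d) (by linarith) (by linarith [(abs_le.1 hd2).1])
      refine ⟨k, ?_⟩
      rw [mul_neg, AddCircle.coe_neg, ← neg_add, norm_neg] at hk
      exact hk
    · exact key _ _ h (by linarith [(abs_le.1 hd2).2])
  obtain ⟨k, hk⟩ := hgoal
  refine ⟨k, ?_⟩
  rw [isotopy_zero_apply, hmul]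
  simpa [agreeSet] using hk

/-- A saturated set that is null on the strip is null. -/
theorem volume_eq_zero_of_strip {B : Set Torus} (hinv : ∀ y z, holonomyRel y z → (y ∈ B ↔ z ∈ B))
    (h : ∀ᵐ p : Torus, p ∈ agreeSet false → p ∉ B) : volume B = 0 := by
  rw [measure_eq_zero_iff_ae_notMem]
  have h1 : ∀ᵐ p : Torus, ∀ k : ℕ, isotopy 0 k p ∈ agreeSet false → isotopy 0 k p ∉ B :=
    ae_all_iff.2 fun k => (measurePreserving_isotopy_zero k).quasiMeasurePreserving.ae h
  have h2 : ∀ c : UnitAddCircle, ∀ᵐ p : Torus, p.2 ≠ c := fun c =>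
    Measure.quasiMeasurePreserving_snd.ae
      (measure_eq_zero_iff_ae_notMem.1 (UnitAddCircle.volume_singleton c))
  filter_upwards [h1, h2 0, h2 ((1 / 2 : ℝ) : UnitAddCircle)] with p hp h0 h1
  obtain ⟨k, hk⟩ := exists_isotopy_zero_mem_agreeSet h0 h1
  exact fun hpB => hp k hk ((hinv _ _ (holonomyRel_isotopy_nat 0 k p)).1 hpB)

theorem ergodicRel_holonomyRel : ErgodicRel holonomyRel (volume : Measure Torus) := by
  intro B hB hinv
  have hstrip := ae_strip_mem_or_notMem (μ := (volume : Measure UnitAddCircle)) hB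
    (I := Metric.closedBall 0 (27 / 100)) Metric.isClosed_closedBall.measurableSet ?_ ?_ ?_
  · rcases hstrip with h | h
    · right
      refine volume_eq_zero_of_strip (fun y z hyz => not_congr (hinv y z hyz)) ?_
      filter_upwards [h] with p hp hps
      exact not_not.2 (hp (by simpa [agreeSet] using hps))
    · left
      refine volume_eq_zero_of_strip hinv ?_
      filter_upwards [h] with p hp hps
      exact hp (by simpa [agreeSet] using hps)
  · rw [AddCircle.volume_closedBall]
    norm_num
  · filter_upwards [ae_addOrderOf_zsmul_eq_zero (k := 3) (by norm_num)] with x hx hxI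
    refine ae_mem_or_ae_notMem_of_add hx (measurable_prodMk_left hB) fun y => ?_
    have h := holonomyRel_freeAction false (s := (x, y)) (by simpa [agreeSet] using hxI)
    rw [freeAction_false] at h
    exact (hinv _ _ h).symm
  · filter_upwards [ae_addOrderOf_zsmul_eq_zero (k := 3) (by norm_num)] with y hy hyI
    refine ae_mem_or_ae_notMem_of_add hy (measurable_prodMk_right hB) fun x => ?_
    have h := holonomyRel_freeAction true (s := (x, y)) (by simpa [agreeSet] using hyI)
    rw [freeAction_true] at h
    exact (hinv _ _ h).symm

/-! ### Følner sets in the leaves -/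

theorem holonomyRel_isotopy_int (j : Fin 3) (k : ℤ) (s : Torus) :
    holonomyRel s (isotopy j k s) := by
  obtain ⟨n, rfl | rfl⟩ := k.eq_nat_or_neg
  · exact holonomyRel_isotopy_nat j n s
  · have h := holonomyRel_isotopy_nat j n (isotopy j (-n) s)
    rw [← isotopy_add, add_neg_cancel, isotopy_zero] at h
    push_cast
    exact holonomyRel.symm h

theorem isotopy_of_ne_zero {j : Fin 3} (hj : j ≠ 0) (τ : ℝ) (s : Torus) :
    isotopy j τ s = (s.1, s.2 + (τ * (verCoeff j * verCircle s.1) : ℝ)) := by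
  rw [isotopy, if_neg hj]

theorem isotopy_eq_self {j : Fin 3} (hj : j ≠ 0) (τ : ℝ) {s : Torus} (hs : verCircle s.1 = 0) :
    isotopy j τ s = s := by
  simp [isotopy_of_ne_zero hj, hs]

/-- One of the two vertical generators has an irrational rotation number on each circle where they
do not vanish. -/
theorem exists_irrational_verCoeff {r : ℝ} (hr : r ≠ 0) :
    ∃ j : Fin 3, j ≠ 0 ∧ Irrational (verCoeff j * r) := by
  by_cases h : Irrational r
  · exact ⟨1, by decide, by simpa [verCoeff] using h⟩
  · refine ⟨2, by decide, ?_⟩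
    obtain ⟨q, rfl⟩ := not_not.1 h
    have hq : q ≠ 0 := by
      rintro rfl
      simp at hr
    have h2 : verCoeff 2 = √2 := rfl
    rw [h2]
    exact irrational_sqrt_two.mul_ratCast hq

/-- Every orbit of the holonomy group contains arbitrarily long segments of an orbit of the
horizontal generator that consist of fixed points of the vertical generators: either the orbit of
`s` is such a segment, or `s` can be moved vertically to a small positive ordinate, where the
horizontal generator moves slowly. -/
theorem exists_holonomyRel_segment (s : Torus) (n : ℕ) :
    ∃ s₀, holonomyRel s s₀ ∧ ∀ i : ℕ, i ≤ n → verCircle (isotopy 0 i s₀).1 = 0 := by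
  by_cases hall : ∀ i : ℕ, i ≤ n → verCircle (isotopy 0 i s).1 = 0
  · exact ⟨s, holonomyRel.refl s, hall⟩
  push Not at hall
  obtain ⟨i, -, hi⟩ := hall
  set s₁ := isotopy 0 i s with hs₁
  obtain ⟨j, hj, hirr⟩ := exists_irrational_verCoeff hi
  set a := verCoeff j * verCircle s₁.1 with ha
  have hdense : DenseRange fun k : ℤ => s₁.2 + k • (a : UnitAddCircle) := by
    have h1 : DenseRange fun k : ℤ => k • (a : UnitAddCircle) :=
      AddCircle.denseRange_zsmul_coe_iff.2 (by simpa using hirr)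
    exact (Homeomorph.addLeft s₁.2).surjective.denseRange.comp h1
      (Homeomorph.addLeft s₁.2).continuous
  -- at an ordinate `t` with `0 < t < 1 / (10 (n + 1))` the horizontal generator moves by `3 t`, so
  -- that `n + 1` steps are shorter than the interval `[0.33, 0.67]`
  have hδ : (0 : ℝ) < 1 / 10 / (n + 1) := by positivity
  obtain ⟨k, t, ⟨ht0, ht1⟩, htk⟩ := hdense.exists_mem_open
    (QuotientAddGroup.isOpenMap_coe (N := AddSubgroup.zmultiples (1 : ℝ)) _
      (isOpen_Ioo (a := (0 : ℝ)) (b := 1 / 10 / (n + 1)))) ((nonempty_Ioo.2 hδ).image _)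
  have ht2 : t * (n + 1) < 1 / 10 := by rwa [lt_div_iff₀ (by positivity)] at ht1
  have ht3 : t < 1 / 10 := by nlinarith [(Nat.cast_nonneg n : (0 : ℝ) ≤ n)]
  have hs₂ : isotopy j k s₁ = (s₁.1, (t : UnitAddCircle)) := by
    rw [isotopy_of_ne_zero hj, ← ha, ← zsmul_eq_mul, AddCircle.coe_zsmul]
    exact Prod.ext rfl htk.symm
  have hhor : horCircle (t : UnitAddCircle) = 3 * t := by
    rw [horCircle_coe, horSpeed_eq]
    rw [abs_of_pos ht0]
    linarith
  obtain ⟨l, v, hv1, hv2, hv⟩ := exists_nat_mul_mem_arc s₁.1 (d := 3 * t) (by linarith) (33 / 100)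
  have hs₃ : isotopy 0 l (isotopy j k s₁) = ((v : UnitAddCircle), (t : UnitAddCircle)) := by
    rw [hs₂, isotopy_zero_apply, hhor, hv]
  refine ⟨isotopy 0 l (isotopy j k s₁), holonomyRel.trans (holonomyRel_isotopy_nat 0 i s)
    (holonomyRel.trans (holonomyRel_isotopy_int j k s₁) (holonomyRel_isotopy_nat 0 l _)), ?_⟩
  intro i hi
  have hin : (i : ℝ) ≤ n := by exact_mod_cast hi
  rw [hs₃, isotopy_zero_apply, hhor, ← AddCircle.coe_add, verCircle_coe]
  apply verSpeed_eq_zero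
  · have : 0 ≤ (i : ℝ) * (3 * t) := by positivity
    linarith
  · nlinarith

section Foliation

variable {n : ℕ} {b : Fin n → BaseChart} {c : Fin n → Plane}
  (hcover : ∀ q, ∃ i, q ∈ (foliatedChart (b i).half (c i) fibreRadius).source)

theorem fibreValue_injective {t t' : (suspensionFoliation b c hcover).Transversal}
    (h1 : t.1 = t'.1) (h2 : fibreValue hcover t = fibreValue hcover t') : t = t' := by
  obtain ⟨i, w, hw⟩ := t
  obtain ⟨i', w', hw'⟩ := t'
  obtain rfl : i = i' := h1
  have := injOn_toTorus (c i) fibreRadius hw hw' h2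
  subst this
  rfl

theorem finite_fibreValue_eq (s : Torus) :
    {t | fibreValue hcover t = s}.Finite ∧ {t | fibreValue hcover t = s}.ncard ≤ n := by
  have hinj : InjOn Prod.fst {t | fibreValue hcover t = s} := fun t ht t' ht' h =>
    fibreValue_injective hcover h (ht.trans ht'.symm)
  refine ⟨Finite.of_finite_image (toFinite _) hinj, ?_⟩
  rw [← hinj.ncard_image]
  exact (ncard_le_card _).trans (by simp [suspensionFoliation])

/-- The Følner sets are the vertices over a long segment of an orbit of the horizontal generator that
is fixed by the vertical ones. Each point of the torus has at most `n` vertices over it. -/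
theorem isFolnerAt_suspensionFoliation (t : (suspensionFoliation b c hcover).Transversal) :
    (suspensionFoliation b c hcover).IsFolnerAt t := by
  intro ε hε
  obtain ⟨N, hN⟩ := exists_nat_ge (2 * (n : ℝ) * n / ε)
  obtain ⟨s₀, hs₀, hfix⟩ := exists_holonomyRel_segment (fibreValue hcover t) N
  set e : ℤ → Torus := fun i => isotopy 0 i s₀ with he
  have he1 : ∀ i, isotopy 0 1 (e i) = e (i + 1) := fun i => by
    simp only [he]
    rw [← isotopy_add, Int.cast_add, Int.cast_one, add_comm]
  have heN : ∀ i : ℕ, i ≤ N → ∀ j ≠ 0, ∀ τ, isotopy j τ (e i) = e i := fun i hi j hj τ =>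
    isotopy_eq_self hj τ (by simpa [he] using hfix i hi)
  set S : Set Torus := (fun i : ℕ => e i) '' Iic N with hS
  have hSfin : S.Finite := (finite_Iic N).image _
  have hfin : (fibreValue hcover ⁻¹' S).Finite :=
    hSfin.preimage' fun s _ => (finite_fibreValue_eq hcover s).1
  have hSA : S ⊆ fibreValue hcover '' (fibreValue hcover ⁻¹' S) := by
    intro s hs
    obtain ⟨u, rfl⟩ := exists_fibreValue_eq hcover s
    exact ⟨u, hs, rfl⟩
  have hcard : S.ncard ≤ hfin.toFinset.card := by
    rw [← ncard_eq_toFinset_card _ hfin]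
    exact (ncard_le_ncard hSA (hfin.image _)).trans (ncard_image_le hfin)
  -- a boundary edge leaves the segment at one of its two ends
  have hbd : ∀ u u', fibreValue hcover u ∈ S → fibreValue hcover u' ∉ S →
      (suspensionFoliation b c hcover).holonomyGraph.Adj u u' →
      (fibreValue hcover u = e N ∧ fibreValue hcover u' = e (N + 1)) ∨
      (fibreValue hcover u = e 0 ∧ fibreValue hcover u' = e (-1)) := by
    rintro u u' ⟨i, hi, hu⟩ hu' hadj
    rw [mem_Iic] at hi
    change e i = _ at hu
    have hne : fibreValue hcover u' ≠ e i := fun h => hu' ⟨i, hi, h.symm⟩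
    rcases exists_fibreValue_eq_of_adj hcover hadj with h | ⟨j, h | h⟩
    · exact absurd (h.trans hu.symm) hne
    · rw [← hu] at h
      by_cases hj : j = 0
      · rw [hj, he1] at h
        rcases hi.lt_or_eq with h2 | rfl
        · exact absurd ⟨i + 1, h2, by rw [h]; push_cast; rfl⟩ hu'
        · exact .inl ⟨hu.symm, h⟩
      · exact absurd (h.trans (heN i hi j hj 1)) hne
    · rw [← hu] at h
      have h3 : fibreValue hcover u' = isotopy j (-1) (e i) := by
        rw [h, ← isotopy_add, neg_add_cancel, isotopy_zero]
      by_cases hj : j = 0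
      · have h4 : isotopy 0 (-1) (e i) = e (i - 1) := by
          simp only [he]
          rw [← isotopy_add]
          push_cast
          ring_nf
        rw [hj, h4] at h3
        rcases Nat.eq_zero_or_pos i with rfl | h2
        · exact .inr ⟨hu.symm, by simpa using h3⟩
        · refine absurd ⟨i - 1, (Nat.sub_le _ _).trans hi, ?_⟩ hu'
          rw [h3]
          push_cast [Nat.cast_sub h2]
          rfl
      · exact absurd (h3.trans (heN i hi j hj (-1))) hne
  obtain ⟨hN0, hN1⟩ := finite_fibreValue_eq hcover (e N)
  obtain ⟨hS0, hS1⟩ := finite_fibreValue_eq hcover (e (N + 1))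
  obtain ⟨hz0, hz1⟩ := finite_fibreValue_eq hcover (e 0)
  obtain ⟨hm0, hm1⟩ := finite_fibreValue_eq hcover (e (-1))
  set D := ({t | fibreValue hcover t = e N} ×ˢ {t | fibreValue hcover t = e (N + 1)}) ∪
    ({t | fibreValue hcover t = e 0} ×ˢ {t | fibreValue hcover t = e (-1)}) with hD
  have hDfin : D.Finite := (hN0.prod hS0).union (hz0.prod hm0)
  set bd := {p : (suspensionFoliation b c hcover).Transversal ×
    (suspensionFoliation b c hcover).Transversal | p.1 ∈ hfin.toFinset ∧ p.2 ∉ hfin.toFinset ∧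
      (suspensionFoliation b c hcover).holonomyGraph.Adj p.1 p.2} with hbddef
  have hbdD : bd ⊆ D := by
    rintro ⟨u, u'⟩ ⟨h1, h2, h3⟩
    rw [Finite.mem_toFinset] at h1 h2
    exact hbd u u' h1 h2 h3
  have hDcard : D.ncard ≤ n * n + n * n := by
    refine (ncard_union_le _ _).trans ?_
    rw [ncard_prod, ncard_prod]
    gcongr
  refine ⟨hfin.toFinset, ?_, ?_, hDfin.subset hbdD, ?_⟩
  · obtain ⟨u, hu⟩ := exists_fibreValue_eq hcover (e 0)
    exact ⟨u, hfin.mem_toFinset.2 ⟨0, Nat.zero_le _, hu.symm⟩⟩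
  · intro u hu
    obtain ⟨i, -, hi⟩ := hfin.mem_toFinset.1 hu
    refine (transRel_iff hcover t u).2 (hi ▸ ?_)
    exact holonomyRel.trans hs₀ (holonomyRel_isotopy_int 0 i s₀)
  · change (bd.ncard : ℝ) ≤ _
    by_cases hinj : InjOn (fun i : ℕ => e i) (Iic N)
    · have h1 : S.ncard = N + 1 := by
        rw [hS, hinj.ncard_image]
        simp
      have h2 : (N : ℝ) + 1 ≤ hfin.toFinset.card := by
        rw [h1] at hcard
        exact_mod_cast hcard
      have h3 : (bd.ncard : ℝ) ≤ n * n + n * n := by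
        exact_mod_cast (ncard_le_ncard hbdD hDfin).trans hDcard
      rw [div_le_iff₀ hε] at hN
      nlinarith
    · -- the segment is a periodic orbit, without boundary
      have hper : ∃ p : ℕ, 0 < p ∧ p ≤ N ∧ ∀ i : ℤ, e (i + p) = e i := by
        have hpos : ∀ i j : ℕ, j ≤ N → i < j → e i = e j →
            ∃ p : ℕ, 0 < p ∧ p ≤ N ∧ ∀ i : ℤ, e (i + p) = e i := by
          intro i j hj hij h
          refine ⟨j - i, by omega, by omega, fun k => ?_⟩
          have h2 := congrArg (isotopy 0 (k - i)) h
          simp only [he] at h2 ⊢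
          rw [← isotopy_add, ← isotopy_add] at h2
          convert h2.symm using 2
          · push_cast [Nat.cast_sub hij.le]
            ring
          · push_cast
            ring
        simp only [InjOn, not_forall] at hinj
        obtain ⟨i, hi, j, hj, h, hne⟩ := hinj
        rcases lt_or_gt_of_ne hne with h2 | h2
        · exact hpos i j hj h2 h
        · exact hpos j i hi h2 h.symm
      obtain ⟨p, hp0, hpN, hp⟩ := hper
      have hempty : bd = ∅ := by
        rw [eq_empty_iff_forall_notMem]
        rintro ⟨u, u'⟩ ⟨h1, h2, h3⟩
        rw [Finite.mem_toFinset] at h1 h2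
        rcases hbd u u' h1 h2 h3 with ⟨-, h⟩ | ⟨-, h⟩
        · refine h2 ⟨N + 1 - p, ?_, ?_⟩
          · rw [mem_Iic]
            omega
          · change e _ = fibreValue hcover u'
            rw [h, ← hp]
            congr 1
            omega
        · refine h2 ⟨p - 1, ?_, ?_⟩
          · rw [mem_Iic]
            omega
          · change e _ = fibreValue hcover u'
            rw [h, ← hp (-1)]
            congr 1
            omega
      rw [hempty]
      rw [ncard_empty, Nat.cast_zero]
      exact mul_nonneg hε.le (Nat.cast_nonneg _)

end Foliation

/-! ### From the torus to the total transversal -/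

section Transfer

variable {X Y : Type*} [MeasurableSpace X] [MeasurableSpace Y] {R : Setoid X} {S : Setoid Y}
  {μ : Measure X} {ν : Measure Y} {π : X → Y} {σ : Y → X}

/-- Ergodicity passes to the inverse image of a relation by a nonsingular map with a measurable
section. -/
theorem ErgodicRel.of_section (hS : ErgodicRel S ν) (hπ : Measure.QuasiMeasurePreserving π μ ν)
    (hσ : Measurable σ) (hπσ : ∀ y, π (σ y) = y) (hR : ∀ x x', R x x' ↔ S (π x) (π x')) :
    ErgodicRel R μ := by
  intro B hB hinv
  have hBσ : π ⁻¹' (σ ⁻¹' B) = B := by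
    ext x
    exact hinv _ _ ((hR _ _).2 (by rw [hπσ]))
  rcases hS (σ ⁻¹' B) (hσ hB) fun y z hyz =>
    hinv _ _ ((hR _ _).2 (by rwa [hπσ, hπσ])) with h | h
  · left
    rw [← hBσ]
    exact hπ.preimage_null h
  · right
    rw [← hBσ, ← preimage_compl]
    exact hπ.preimage_null h

/-- The means on the classes of the inverse image of a relation by a map with a nonsingular section
induce means on the classes of the relation. -/
theorem AmenableRel.of_section (h : AmenableRel R μ) (hπ : Measurable π)
    (hσ : Measure.QuasiMeasurePreserving σ ν μ) (hπσ : ∀ y, π (σ y) = y)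
    (hR : ∀ x x', R x x' ↔ S (π x) (π x')) : AmenableRel S ν := by
  obtain ⟨m, hm, hmeas, hinv⟩ := h
  have hmem : ∀ y z, z ∈ eqvClass R (σ y) → π z ∈ eqvClass S y := by
    intro y z hz
    have h := (hR _ _).1 hz
    rwa [hπσ] at h
  have hbdd : ∀ (y) (f : Y → ℝ), BddFunOn (eqvClass S y) f →
      BddFunOn (eqvClass R (σ y)) (f ∘ π) := by
    rintro y f ⟨K, hK⟩
    exact ⟨K, fun z hz => hK _ (hmem y z hz)⟩
  refine ⟨fun y f => m (σ y) (f ∘ π), ?_, ?_, ?_⟩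
  · filter_upwards [hσ.ae hm] with y hy
    exact
      { map_add := fun f g hf hg => hy.map_add _ _ (hbdd y f hf) (hbdd y g hg)
        map_smul := fun c f hf => hy.map_smul c _ (hbdd y f hf)
        nonneg := fun f hf h0 => hy.nonneg _ (hbdd y f hf) fun z hz => h0 _ (hmem y z hz)
        map_one := hy.map_one }
  · rintro f hf ⟨K, hK⟩
    have h1 := hmeas (fun p => f (π p.1, π p.2))
      (hf.comp ((hπ.comp measurable_fst).prodMk (hπ.comp measurable_snd))) ⟨K, fun p => hK _⟩
    have h2 := h1.comp_quasiMeasurePreserving hσ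
    simp only [Function.comp_def, hπσ] at h2
    exact h2
  · filter_upwards [hσ.ae hinv] with y hy z hyz f hf
    exact hy (σ z) ((hR _ _).2 (by rwa [hπσ, hπσ])) _ (hbdd y f hf)

end Transfer

theorem quasiMeasurePreserving_coe :
    Measure.QuasiMeasurePreserving ((↑) : ℝ → UnitAddCircle) volume volume := by
  refine ⟨AddCircle.measurable_mk', Measure.AbsolutelyContinuous.mk fun N hN h0 => ?_⟩
  rw [Measure.map_apply AddCircle.measurable_mk' hN]
  have h1 : ((↑) : ℝ → UnitAddCircle) ⁻¹' N ⊆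
      ⋃ k : ℤ, ((↑) ⁻¹' N ∩ Ioc (k : ℝ) (k + 1) : Set ℝ) := by
    intro x hx
    refine mem_iUnion.2 ⟨⌈x⌉ - 1, hx, ?_, ?_⟩
    · push_cast
      linarith [Int.ceil_lt_add_one x]
    · push_cast
      linarith [Int.le_ceil x]
  refine measure_mono_null h1 (measure_iUnion_null fun k => ?_)
  rw [← Measure.restrict_apply (AddCircle.measurable_mk' hN)]
  exact ((UnitAddCircle.measurePreserving_mk k).measure_preimage hN.nullMeasurableSet).trans h0

/-- The volume of the plane is the product measure. -/
theorem volume_preserving_coords :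
    MeasurePreserving (fun w : Plane => (w 0, w 1)) volume volume :=
  (volume_preserving_finTwoArrow ℝ).comp (PiLp.volume_preserving_ofLp (Fin 2))

theorem quasiMeasurePreserving_toTorus :
    Measure.QuasiMeasurePreserving toTorus volume volume :=
  (QuasiMeasurePreserving.prodMap quasiMeasurePreserving_coe quasiMeasurePreserving_coe).comp
    volume_preserving_coords.quasiMeasurePreserving

theorem quasiMeasurePreserving_affine (c : Plane) {r : ℝ} (hr : r ≠ 0) :
    Measure.QuasiMeasurePreserving (fun w : Plane => c + r • w) volume volume := by
  refine ⟨by fun_prop, Measure.AbsolutelyContinuous.mk fun N hN h0 => ?_⟩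
  rw [Measure.map_apply (by fun_prop) hN]
  change volume ((fun w => r • w) ⁻¹' ((fun w => c + w) ⁻¹' N)) = 0
  rw [Measure.addHaar_preimage_smul _ hr, measure_preimage_add, h0, mul_zero]

/-- The representative of a point of the torus in the half-open square of side `1` centred at `c`. -/
noncomputable def squareLift (c : Plane) (s : Torus) : Plane :=
  !₂[(AddCircle.equivIoc 1 (c 0 - 1 / 2) s.1 : ℝ), (AddCircle.equivIoc 1 (c 1 - 1 / 2) s.2 : ℝ)]

theorem toTorus_squareLift (c : Plane) (s : Torus) : toTorus (squareLift c s) = s := by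
  refine Prod.ext ?_ ?_
  · exact (AddCircle.equivIoc 1 (c 0 - 1 / 2)).symm_apply_apply s.1
  · exact (AddCircle.equivIoc 1 (c 1 - 1 / 2)).symm_apply_apply s.2

theorem squareLift_toTorus {c w : Plane} (h : ‖w - c‖ < 1 / 2) : squareLift c (toTorus w) = w := by
  have hi : ∀ i, w i ∈ Ioc (c i - 1 / 2) (c i - 1 / 2 + 1) := by
    intro i
    have h1 := (abs_coord_le (w - c) i).trans_lt h
    rw [PiLp.sub_apply, abs_lt] at h1
    constructor <;> linarith [h1.1, h1.2]
  ext i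
  fin_cases i
  · exact congrArg Subtype.val (AddCircle.equivIoc_coe_eq (hi 0))
  · exact congrArg Subtype.val (AddCircle.equivIoc_coe_eq (hi 1))

theorem quasiMeasurePreserving_squareLift (c : Plane) :
    Measure.QuasiMeasurePreserving (squareLift c) volume volume := by
  have h1 : ∀ a : ℝ, Measure.QuasiMeasurePreserving
      (fun x : UnitAddCircle => (AddCircle.equivIoc 1 a x : ℝ)) volume volume := by
    intro a
    refine Measure.QuasiMeasurePreserving.comp (μb := Measure.comap Subtype.val volume) ?_
      (AddCircle.measurePreserving_equivIoc 1).quasiMeasurePreserving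
    refine ⟨measurable_subtype_coe, ?_⟩
    rw [map_comap_subtype_coe measurableSet_Ioc]
    exact Measure.absolutelyContinuous_of_le Measure.restrict_le_self
  have h2 : MeasurePreserving (fun p : ℝ × ℝ => (!₂[p.1, p.2] : Plane)) volume volume :=
    (PiLp.volume_preserving_toLp (Fin 2)).comp (volume_preserving_finTwoArrow ℝ).symm
  exact h2.quasiMeasurePreserving.comp (QuasiMeasurePreserving.prodMap (h1 _) (h1 _))

section Foliation

variable {n : ℕ} {b : Fin n → BaseChart} {c : Fin n → Plane}
  (hcover : ∀ q, ∃ i, q ∈ (foliatedChart (b i).half (c i) fibreRadius).source)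

theorem suspensionVolume_measure : (suspensionVolume hcover).measure =
    (Measure.count : Measure (Fin (suspensionFoliation b c hcover).n)).prod
      (Measure.comap Subtype.val (volume : Measure Plane)) := by
  have h : (fun t : (suspensionFoliation b c hcover).Transversal =>
      ENNReal.ofReal |(suspensionVolume hcover).density t.1 t.2|) = 1 := by
    ext t
    simp [suspensionVolume]
  rw [SmoothFoliation.InvariantVolume.measure, h, withDensity_one]

theorem quasiMeasurePreserving_val :
    Measure.QuasiMeasurePreserving (Subtype.val : Metric.ball (0 : Plane) 1 → Plane)
      (Measure.comap Subtype.val volume) volume := by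
  refine ⟨measurable_subtype_coe, ?_⟩
  rw [map_comap_subtype_coe Metric.isOpen_ball.measurableSet]
  exact Measure.absolutelyContinuous_of_le Measure.restrict_le_self

instance : IsFiniteMeasure
    (Measure.comap (Subtype.val : Metric.ball (0 : Plane) 1 → Plane) volume) where
  measure_univ_lt_top := by
    rw [comap_subtype_coe_apply Metric.isOpen_ball.measurableSet, image_univ, Subtype.range_coe]
    exact measure_ball_lt_top

theorem measurable_fibreValue : Measurable (fibreValue hcover) := by
  refine measurable_from_prod_countable_right fun i => ?_
  have h : Continuous fun w : Metric.ball (0 : Plane) 1 => c i + (fibreRadius : ℝ) • (w : Plane) := by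
    fun_prop
  exact (continuous_toTorus.comp h).measurable

theorem quasiMeasurePreserving_fibreValue :
    Measure.QuasiMeasurePreserving (fibreValue hcover) (suspensionVolume hcover).measure volume := by
  refine ⟨measurable_fibreValue hcover, Measure.AbsolutelyContinuous.mk fun N hN h0 => ?_⟩
  rw [Measure.map_apply (measurable_fibreValue hcover) hN, suspensionVolume_measure,
    Measure.measure_prod_null (measurable_fibreValue hcover hN)]
  refine ae_of_all _ fun i => ?_
  exact ((quasiMeasurePreserving_toTorus.comp (quasiMeasurePreserving_affine (c i)
    (r := fibreRadius) (by norm_num [fibreRadius]))).comp quasiMeasurePreserving_val).preimage_null h0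

/-- There is a nonsingular section of the projection from the total transversal to the fibre. -/
theorem exists_section_fibreValue :
    ∃ σ : Torus → (suspensionFoliation b c hcover).Transversal,
      Measure.QuasiMeasurePreserving σ volume (suspensionVolume hcover).measure ∧
      ∀ s, fibreValue hcover (σ s) = s := by
  set F := suspensionFoliation b c hcover with hF
  -- the coordinate in the disc of index `i`, defined on the part `U i` of the torus
  set κ : Fin F.n → Torus → Plane := fun i s => -((8 : ℝ) • c i) + (8 : ℝ) • squareLift (c i) s with hκ
  have hκm : ∀ i, Measure.QuasiMeasurePreserving (κ i) volume volume := fun i =>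
    (quasiMeasurePreserving_affine _ (by norm_num)).comp (quasiMeasurePreserving_squareLift (c i))
  set U : Fin F.n → Set Torus := fun i => {s | ‖κ i s‖ < 1} with hU
  have hUm : ∀ i, MeasurableSet (U i) := fun i =>
    measurableSet_lt (hκm i).measurable.norm measurable_const
  have hUcover : ∀ s, ∃ i, s ∈ U i := by
    intro s
    obtain ⟨⟨i, w, hw⟩, rfl⟩ := exists_fibreValue_eq hcover s
    refine ⟨i, ?_⟩
    rw [mem_ball_zero_iff] at hw
    have h1 : squareLift (c i) (toTorus (c i + (1 / 8 : ℝ) • w)) = c i + (1 / 8 : ℝ) • w := by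
      apply squareLift_toTorus
      rw [add_sub_cancel_left, norm_smul]
      norm_num
      linarith
    change ‖-((8 : ℝ) • c i) + (8 : ℝ) • squareLift (c i) (toTorus (c i + (1 / 8 : ℝ) • w))‖ < 1
    rw [h1, smul_add, neg_add_cancel_left, smul_smul]
    norm_num
    exact hw
  set g : Fin F.n → Torus → F.Transversal := fun i s =>
    (i, ⟨(Metric.ball 0 1).indicator id (κ i s), by
      by_cases h : κ i s ∈ Metric.ball (0 : Plane) 1
      · rwa [indicator_of_mem h]
      · rw [indicator_of_notMem h]
        simp⟩) with hg
  have hgm : ∀ i, Measurable (g i) := fun i => measurable_const.prodMk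
    (((measurable_id.indicator Metric.isOpen_ball.measurableSet).comp
      (hκm i).measurable).subtype_mk)
  have hgU : ∀ i, ∀ s ∈ U i, ((g i s).2 : Plane) = κ i s := fun i s hs =>
    indicator_of_mem (mem_ball_zero_iff.2 hs) _
  have : Nonempty (Fin F.n) := ⟨(hUcover 0).choose⟩
  obtain ⟨σ, hσ, hσg⟩ := exists_measurable_piecewise (disjointed U)
    (fun i => by
      rw [disjointed_eq_inter_compl]
      exact (hUm i).inter (.iInter fun j => .iInter fun _ => (hUm j).compl)) g hgm
    (fun i j hij s hs => absurd hs.2 ((disjoint_disjointed U hij).notMem_of_mem_left hs.1))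
  have hσU : ∀ s, ∃ i, s ∈ U i ∧ σ s = g i s := by
    intro s
    have h1 : s ∈ ⋃ i, disjointed U i := by
      rw [iUnion_disjointed]
      exact mem_iUnion.2 (hUcover s)
    obtain ⟨i, hi⟩ := mem_iUnion.1 h1
    exact ⟨i, disjointed_subset U i hi, hσg i hi⟩
  refine ⟨σ, ⟨hσ, Measure.AbsolutelyContinuous.mk fun A hA h0 => ?_⟩, fun s => ?_⟩
  · rw [Measure.map_apply hσ hA]
    rw [suspensionVolume_measure, Measure.measure_prod_null hA] at h0
    have h2 : ∀ i, volume ((Subtype.val : Metric.ball (0 : Plane) 1 → Plane) ''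
        (Prod.mk i ⁻¹' A)) = 0 := by
      intro i
      rw [← comap_subtype_coe_apply Metric.isOpen_ball.measurableSet]
      exact Measure.ae_count_iff.1 h0 i
    refine measure_mono_null (t := ⋃ i, κ i ⁻¹' (Subtype.val '' (Prod.mk i ⁻¹' A))) ?_
      (measure_iUnion_null fun i => (hκm i).preimage_null (h2 i))
    intro s hs
    obtain ⟨i, hi, hsi⟩ := hσU s
    refine mem_iUnion.2 ⟨i, (g i s).2, ?_, hgU i s hi⟩
    rw [mem_preimage, hsi] at hs
    exact hs
  · obtain ⟨i, hi, hsi⟩ := hσU s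
    rw [hsi]
    change toTorus (c i + (1 / 8 : ℝ) • ((g i s).2 : Plane)) = s
    rw [hgU i s hi, hκ]
    simp only
    rw [smul_add, smul_neg, smul_smul, smul_smul]
    norm_num
    exact toTorus_squareLift _ _

end Foliation

theorem proposition3p4 :
    ∃ (M : Type) (_ : TopologicalSpace M) (_ : ChartedSpace (EuclideanSpace ℝ (Fin 4)) M),
      IsManifold (𝓡 4) ∞ M ∧ CompactSpace M ∧ T2Space M ∧ ConnectedSpace M ∧
      ∃ (F : SmoothFoliation 4 2 2 M) (Ω : F.InvariantVolume),
        ErgodicRel F.transRel Ω.measure ∧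
        (∀ t : F.Transversal, F.IsFolnerAt t) ∧
        ¬ AmenableRel F.transRel Ω.measure := by
  obtain ⟨n, b, c, hcover⟩ := exists_finite_cover
  obtain ⟨σ, hσ, hsec⟩ := exists_section_fibreValue hcover
  have hπ := quasiMeasurePreserving_fibreValue hcover
  have : T2Space Suspension := inferInstanceAs (T2Space (BaseSurface × Torus))
  have : CompactSpace Suspension := inferInstanceAs (CompactSpace (BaseSurface × Torus))
  have : ConnectedSpace Suspension := inferInstanceAs (ConnectedSpace (BaseSurface × Torus))
  refine ⟨Suspension, inferInstance, inferInstance, inferInstance, inferInstance, inferInstance,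
    inferInstance, suspensionFoliation b c hcover, suspensionVolume hcover,
    ergodicRel_holonomyRel.of_section hπ hσ.measurable hsec (transRel_iff hcover),
    isFolnerAt_suspensionFoliation hcover, fun h => not_amenableRel_holonomyRel
      (h.of_section hπ.measurable hσ hsec (transRel_iff hcover))⟩
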